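/- **Setting.** Let $f(x,\theta)$, $\theta\in\mathbb R^p$, be a real mean function, $x_1,x_2,\dots$ design points, $\theta_0$ the true parameter, and $Y_1,Y_2,\dots$ integrable random variables with $E(Y_i)=f_i:=f(x_i,\theta_0)$. Write $J_i(\theta)=\nabla f(x_i,\theta)/f(x_i,\theta)$, $K_i(\theta)=\nabla^2 f(x_i,\theta)/f(x_i,\theta)$, $J_i=J_i(\theta_0)$, $\bar J=n^{-1}\sum_{i\le n}J_i$, and let $\mathbf J$ be the $n\times p$ matrix with rows $J_i^T$. The QL estimating function is $$H_n^{QL}(\theta)=n^{-1/2}\sum_{i=1}^n h_i(Y_i,\theta),\qquad h_i(y,\theta)=\frac{y-f(x_i,\theta)}{f(x_i,\theta)^2}\nabla f(x_i,\theta),$$ and the ML estimating function is the score $H_n^{ML}(\theta,\sigma)=n^{-1/2}(\partial l/\partial\theta,\partial l/\partial\sigma)$, where $l$ is the log-likelihood of independent $N(f(x_i,\theta),\sigma^2f(x_i,\theta)^2)$ observations. **Regularity conditions (R).** There are $r,\kappa>0$ and $M_i$ such that, for all $i$ and all $\theta$ with $\|\theta-\theta_0\|<r$: $f(x_i,\cdot)$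 is $C^2$ on this ball, $f_i\ne0$, $|f(x_i,\theta)|\ge\kappa|f_i|$, $\|J_i(\theta)\|\le M_i$, $\|K_i(\theta)\|\le M_i^2$; for every $\varepsilon>0$ there is $T$ with $\sum_{i\le n,\,M_i>T}M_i^2\le\varepsilon n$ for all large $n$ (in particular $\sum J_i$, $\sum J_iJ_i^T$, $\sum K_i$ are $O(n)$); for every $\varepsilon>0$ there are $\delta>0$ and $w_i$ with $\|K_i(\theta)-K_i(\theta_0)\|\le w_i$ for $\|\theta-\theta_0\|<\delta$ and $\sum_{i\le n}w_i\le\varepsilon n$ for all large $n$; and there is $c>0$ with $\mathbf J^T\mathbf J\succeq c\,n\,I$ for all large $n$. **Conventions.** For $H_n$ with true parameter value $\eta_0$ ($\eta_0=\theta_0$ for QL, $\eta_0=(\theta_0,\sigma)$ for ML), a *consistent root* is a sequence of random vectors $\hat\eta_n\to\eta_0$ in probability with $P(H_n(\hat\eta_n)=0)\to1$. "$Z_n\sim MVN(0,V_n)$ in large samples" means $E\,g(\sqrt n Z_n)-\int g\,dN(0,nV_n)\to0$ for every bounded continuous $g$. The sandwich matrix is $V_n=E[-H_n'(\eta_0)]^{-1}\,\mathrm{Var}(H_n(\eta_0))\,E[-H_n'(\eta_0)]^{-1}$.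 **Theorem.** 1. *(QL, unbiasedness.)* $E\,h_i(Y_i,\theta_0)=0$ for every $i$ and $E\,H_n^{QL}(\theta_0)=0$ for every $n$; if $\mathrm{Var}(Y_i)<\infty$, then $h_i(Y_i,\theta_0)$ has finite variance. 2. *(QL, large samples.)* Assume (R), that the $Y_i$ are independent, and that the squared relative errors $\{(Y_i-f_i)/f_i\}^2$ are uniformly integrable. Then the ingredients of the sandwich matrix exist ($H_n^{QL}$ is differentiable at $\theta_0$, the expectation and the variance are finite, and $E[-H_n']$ is invertible for large $n$); consistent roots $\hat\theta_n$ exist; and for every consistent root $$\hat\theta_n-\theta_0=\{-H_n'(\theta_0)\}^{-1}H_n(\theta_0)+o_p(n^{-1/2}),\qquad \hat\theta_n-\theta_0\sim MVN(0,V_n)\ \text{in large samples}.$$ Here $E[-H_n'(\theta_0)]=n^{-1/2}\mathbf J^T\mathbf J$, $\mathrm{Var}(H_n(\theta_0))=n^{-1}\sum_{i\le n}\frac{\mathrm{Var}(Y_i)}{f_i^2}J_iJ_i^T$, and, whenever $\mathbf J^T\mathbf J$ is invertible, $V_n=(\mathbf J^T\mathbf J)^{-1}\big[\sum_{i\le n}\frac{\mathrm{Var}(Y_i)}{f_i^2}J_iJ_i^T\big](\mathbf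 J^T\mathbf J)^{-1}$. If $\mathrm{Var}(Y_i)=\sigma^2f_i^2$ for all $i$, with $\sigma>0$, then $V_n=\sigma^2(\mathbf J^T\mathbf J)^{-1}$, so that $\hat\theta_n-\theta_0\sim MVN(0,\sigma^2(\mathbf J^T\mathbf J)^{-1})$ in large samples. 3. *(ML, unbiasedness.)* Let $\sigma>0$ and $\mathrm{Var}(Y_i)=\sigma^2f_i^2<\infty$ for all $i$. If $f_i\ne0$ and $f(x_i,\cdot)$ is differentiable at $\theta_0$ for all $i$, then $E\,H_n^{ML}(\theta_0,\sigma)=0$ for every $n$, and the equation for $\theta$ alone is unbiased too: at $\theta=\theta_0$, $$E\Big[\tfrac1n\sum_i\tfrac{(Y_i-f_i)^2}{f_i^2}\sum_i\tfrac{\nabla f_i}{f_i}-\sum_i\tfrac{Y_i-f_i}{f_i^2}\nabla f_i-\sum_i\tfrac{(Y_i-f_i)^2}{f_i^3}\nabla f_i\Big]=0 .$$ 4. *(ML, large samples.)* Let $\sigma>0$ and $\mathrm{Var}(Y_i)=\sigma^2f_i^2$ for all $i$. Assume (R), that the $Y_i$ are independent, and that the fourth powers $\{(Y_i-f_i)/f_i\}^4$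 are uniformly integrable. Then the ingredients of the sandwich matrix of $H_n^{ML}$ at $(\theta_0,\sigma)$ exist in the sense of 2; consistent roots $(\hat\theta_n,\hat\sigma_n)$ exist; and for every consistent root $(\hat\theta_n-\theta_0,\hat\sigma_n-\sigma)\sim MVN(0,V_n)$ in large samples. If moreover $E(Y_i-f_i)^3=0$ and $E(Y_i-f_i)^4=3\sigma^4f_i^4$ for all $i$ (as for normal errors), then in large samples $$\hat\theta_n-\theta_0\sim MVN\Big(0,\ \sigma^2\Big[\mathbf J^T\mathbf J+2\sigma^2\sum_{i\le n}(J_i-\bar J)(J_i-\bar J)^T\Big]^{-1}\Big).$$ -/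

import Mathlib

open MeasureTheory ProbabilityTheory Filter Topology

noncomputable section

namespace PropErr

/-! ### Generic notions for estimating equations -/

section Generic

variable {Ω : Type*} [MeasurableSpace Ω] {ι : Type*} [Fintype ι] [DecidableEq ι]

/-- The Jacobian matrix `(∂ F_a / ∂ θ_b)` of `F` at `θ`. -/
def jac (F : EuclideanSpace ℝ ι → EuclideanSpace ℝ ι) (θ : EuclideanSpace ℝ ι) :
    Matrix ι ι ℝ :=
  Matrix.of fun a b => (fderiv ℝ F θ (EuclideanSpace.single b 1)) a

/-- Entrywise expectation of a random matrix. -/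
def meanMat (μ : Measure Ω) (A : Ω → Matrix ι ι ℝ) : Matrix ι ι ℝ :=
  Matrix.of fun a b => ∫ ω, A ω a b ∂μ

/-- Variance (covariance matrix) of a random vector. -/
def varMat (μ : Measure Ω) (Z : Ω → EuclideanSpace ℝ ι) : Matrix ι ι ℝ :=
  Matrix.of fun a b => covariance (fun ω => Z ω a) (fun ω => Z ω b) μ

/-- `E[-H'(θ)]`, for a random function `H`. -/
def meanNegJac (μ : Measure Ω) (H : Ω → EuclideanSpace ℝ ι → EuclideanSpace ℝ ι)
    (θ : EuclideanSpace ℝ ι) : Matrix ι ι ℝ :=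
  meanMat μ fun ω => -jac (H ω) θ

/-- The sandwich matrix `E[-H'(θ)]⁻¹ Var(H(θ)) E[-H'(θ)]⁻¹`. -/
def sandwich (μ : Measure Ω) (H : Ω → EuclideanSpace ℝ ι → EuclideanSpace ℝ ι)
    (θ : EuclideanSpace ℝ ι) : Matrix ι ι ℝ :=
  (meanNegJac μ H θ)⁻¹ * varMat μ (fun ω => H ω θ) * (meanNegJac μ H θ)⁻¹

/-- All the ingredients of the sandwich matrix exist: `H_n` is differentiable at `θ`, its Jacobian
is integrable, `H_n(θ)` has finite second moments, and `E[-H_n'(θ)]` is invertible for all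
large `n`. -/
def SandwichWellDefined (μ : Measure Ω)
    (H : ℕ → Ω → EuclideanSpace ℝ ι → EuclideanSpace ℝ ι) (θ : EuclideanSpace ℝ ι) : Prop :=
  (∀ n ω, DifferentiableAt ℝ (H n ω) θ) ∧
  (∀ n a b, Integrable (fun ω => jac (H n ω) θ a b) μ) ∧
  (∀ n, MemLp (fun ω => H n ω θ) 2 μ) ∧
  ∀ᶠ n in atTop, IsUnit (meanNegJac μ (H n) θ).det

/-- In large samples `Z_n ∼ MVN(0, V_n)`, at the scale `n^{-1/2}`: the law of `√n Z_n` and the law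
`MVN(0, n V_n)` approach each other weakly, i.e. the expectations of every bounded continuous
function under the two laws have a difference that tends to `0`. -/
def AsympMVN (μ : Measure Ω) (Z : ℕ → Ω → EuclideanSpace ℝ ι) (V : ℕ → Matrix ι ι ℝ) : Prop :=
  ∀ g : BoundedContinuousFunction (EuclideanSpace ℝ ι) ℝ,
    Tendsto (fun n : ℕ => ∫ ω, g (Real.sqrt n • Z n ω) ∂μ
        - ∫ z, g z ∂(multivariateGaussian 0 ((n : ℝ) • V n))) atTop (𝓝 0)

/-- `est` is a consistent sequence of solutions of the estimating equations `H_n(θ) = 0`: it solves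
the equation with probability tending to one, and converges in probability to `θ₀`. -/
def IsConsistentRoot (μ : Measure Ω) (H : ℕ → Ω → EuclideanSpace ℝ ι → EuclideanSpace ℝ ι)
    (θ₀ : EuclideanSpace ℝ ι) (est : ℕ → Ω → EuclideanSpace ℝ ι) : Prop :=
  (∀ n, AEMeasurable (est n) μ) ∧
  Tendsto (fun n => μ {ω | H n ω (est n ω) ≠ 0}) atTop (𝓝 0) ∧
  TendstoInMeasure μ est atTop (fun _ => θ₀)

/-- `est_n - θ₀ = {-H_n'(θ₀)}⁻¹ H_n(θ₀) + o_p(n^{-1/2})`. -/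
def LinearExpansion (μ : Measure Ω) (H : ℕ → Ω → EuclideanSpace ℝ ι → EuclideanSpace ℝ ι)
    (θ₀ : EuclideanSpace ℝ ι) (est : ℕ → Ω → EuclideanSpace ℝ ι) : Prop :=
  TendstoInMeasure μ
    (fun (n : ℕ) ω => Real.sqrt n •
      (est n ω - θ₀ - Matrix.toEuclideanCLM (𝕜 := ℝ) (-jac (H n ω) θ₀)⁻¹ (H n ω θ₀)))
    atTop (fun _ => 0)

end Generic

/-! ### The proportional error nonlinear regression model -/

section Model

variable {𝓧 : Type*} {p : ℕ}

/-- `∇f(x, θ) / f(x, θ)`; at the true parameter this is the vector `J`. -/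
def relGrad (f : 𝓧 → EuclideanSpace ℝ (Fin p) → ℝ) (x : 𝓧) (θ : EuclideanSpace ℝ (Fin p)) :
    EuclideanSpace ℝ (Fin p) :=
  (f x θ)⁻¹ • gradient (f x) θ

/-- `(∂²f(x, θ)/∂θ∂θᵀ) / f(x, θ)`, as an operator; at the true parameter this is `K`. -/
def relHess (f : 𝓧 → EuclideanSpace ℝ (Fin p) → ℝ) (x : 𝓧) (θ : EuclideanSpace ℝ (Fin p)) :
    EuclideanSpace ℝ (Fin p) →L[ℝ] EuclideanSpace ℝ (Fin p) :=
  (f x θ)⁻¹ • fderiv ℝ (gradient (f x)) θ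

/-- The `n × p` matrix with rows `J_iᵀ`. -/
def designMatrix (f : 𝓧 → EuclideanSpace ℝ (Fin p) → ℝ) (x : ℕ → 𝓧)
    (θ : EuclideanSpace ℝ (Fin p)) (n : ℕ) : Matrix (Fin n) (Fin p) ℝ :=
  Matrix.of fun i a => relGrad f (x i) θ a

/-- The matrix `JᵀJ = ∑ J_i J_iᵀ`. -/
def gram (f : 𝓧 → EuclideanSpace ℝ (Fin p) → ℝ) (x : ℕ → 𝓧)
    (θ : EuclideanSpace ℝ (Fin p)) (n : ℕ) : Matrix (Fin p) (Fin p) ℝ :=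
  (designMatrix f x θ n).transpose * designMatrix f x θ n

/-- The mean `J̄` of `J_1, …, J_n`. -/
def meanRelGrad (f : 𝓧 → EuclideanSpace ℝ (Fin p) → ℝ) (x : ℕ → 𝓧)
    (θ : EuclideanSpace ℝ (Fin p)) (n : ℕ) : EuclideanSpace ℝ (Fin p) :=
  (n : ℝ)⁻¹ • ∑ i ∈ Finset.range n, relGrad f (x i) θ

/-- The matrix `u uᵀ`. -/
def outer (u : EuclideanSpace ℝ (Fin p)) : Matrix (Fin p) (Fin p) ℝ :=
  Matrix.of fun a b => u a * u b

/-- Regularity of the mean function along the design `x_0, x_1, …` near the true parameter: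
`f` is twice continuously differentiable and bounded away from `0` relative to its true value on
a ball; there `‖∇f/f‖ ≤ M_i` and `‖∇²f/f‖ ≤ M_i²`, where the averages of `M_i²` are uniformly
integrable (so that `∑ J_i`, `∑ J_i J_iᵀ`, `∑ K_i` are `O(n)`); the second derivatives are
continuous at the true parameter, uniformly on average; and `JᵀJ / n` is bounded away from
singularity. -/
def RegularDesign (f : 𝓧 → EuclideanSpace ℝ (Fin p) → ℝ) (x : ℕ → 𝓧)
    (θ₀ : EuclideanSpace ℝ (Fin p)) : Prop :=
  (∃ (r κ : ℝ) (M : ℕ → ℝ), 0 < r ∧ 0 < κ ∧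
    (∀ i, ContDiffOn ℝ 2 (f (x i)) (Metric.ball θ₀ r)) ∧
    (∀ i, f (x i) θ₀ ≠ 0) ∧
    (∀ i, ∀ θ ∈ Metric.ball θ₀ r, κ * |f (x i) θ₀| ≤ |f (x i) θ|) ∧
    (∀ i, ∀ θ ∈ Metric.ball θ₀ r,
      ‖relGrad f (x i) θ‖ ≤ M i ∧ ‖relHess f (x i) θ‖ ≤ M i ^ 2) ∧
    (∀ ε > 0, ∃ T : ℝ, ∀ᶠ n : ℕ in atTop,
      ∑ i ∈ Finset.range n with T < M i, M i ^ 2 ≤ ε * n)) ∧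
  (∀ ε > 0, ∃ δ > 0, ∃ w : ℕ → ℝ,
    (∀ i, ∀ θ ∈ Metric.ball θ₀ δ, ‖relHess f (x i) θ - relHess f (x i) θ₀‖ ≤ w i) ∧
    ∀ᶠ n : ℕ in atTop, ∑ i ∈ Finset.range n, w i ≤ ε * n) ∧
  (∃ c > 0, ∀ᶠ n : ℕ in atTop, ∀ v : EuclideanSpace ℝ (Fin p),
    c * n * ‖v‖ ^ 2 ≤ ∑ i ∈ Finset.range n, inner ℝ (relGrad f (x i) θ₀) v ^ 2)

/-! #### Quasi-likelihood -/

/-- The `i`-th term `{(y - f) / f²} ∇f` of the QL estimating function. -/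
def qlTerm (f : 𝓧 → EuclideanSpace ℝ (Fin p) → ℝ) (x : 𝓧) (y : ℝ)
    (θ : EuclideanSpace ℝ (Fin p)) : EuclideanSpace ℝ (Fin p) :=
  ((y - f x θ) / f x θ ^ 2) • gradient (f x) θ

/-- The QL estimating function `H_n(θ) = n^{-1/2} ∑ {(y_i - f_i) / f_i²} ∇f_i`. -/
def qlH (f : 𝓧 → EuclideanSpace ℝ (Fin p) → ℝ) (x : ℕ → 𝓧) (y : ℕ → ℝ) (n : ℕ)
    (θ : EuclideanSpace ℝ (Fin p)) : EuclideanSpace ℝ (Fin p) :=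
  (Real.sqrt n)⁻¹ • ∑ i ∈ Finset.range n, qlTerm f (x i) (y i) θ

/-- The QL estimating function as a random function, with the responses `Y_i` inserted. -/
def qlEq {Ω : Type*} (f : 𝓧 → EuclideanSpace ℝ (Fin p) → ℝ) (x : ℕ → 𝓧) (Y : ℕ → Ω → ℝ)
    (n : ℕ) (ω : Ω) (θ : EuclideanSpace ℝ (Fin p)) : EuclideanSpace ℝ (Fin p) :=
  qlH f x (fun i => Y i ω) n θ

/-- `∑ (Var(Y_i) / f_i²) J_i J_iᵀ`. -/
def weightedGram {Ω : Type*} [MeasurableSpace Ω] (μ : Measure Ω)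
    (f : 𝓧 → EuclideanSpace ℝ (Fin p) → ℝ) (x : ℕ → 𝓧) (Y : ℕ → Ω → ℝ)
    (θ : EuclideanSpace ℝ (Fin p)) (n : ℕ) : Matrix (Fin p) (Fin p) ℝ :=
  ∑ i ∈ Finset.range n, (variance (Y i) μ / f (x i) θ ^ 2) • outer (relGrad f (x i) θ)

/-! #### Maximum likelihood -/

/-- The combined parameter `(θ, σ)`. -/
def joint (θ : EuclideanSpace ℝ (Fin p)) (σ : ℝ) : EuclideanSpace ℝ (Fin p ⊕ Unit) :=
  WithLp.toLp 2 (Sum.elim (fun a => θ a) (fun _ => σ))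

/-- The component `θ` of `(θ, σ)`. -/
def thetaPart (η : EuclideanSpace ℝ (Fin p ⊕ Unit)) : EuclideanSpace ℝ (Fin p) :=
  WithLp.toLp 2 fun a => η (Sum.inl a)

/-- The component `σ` of `(θ, σ)`. -/
def sigmaPart (η : EuclideanSpace ℝ (Fin p ⊕ Unit)) : ℝ := η (Sum.inr ())

/-- The log-likelihood of `(θ, σ)` for independent `N(f_i, σ² f_i²)` observations. -/
def logLik (f : 𝓧 → EuclideanSpace ℝ (Fin p) → ℝ) (x : ℕ → 𝓧) (y : ℕ → ℝ) (n : ℕ)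
    (η : EuclideanSpace ℝ (Fin p ⊕ Unit)) : ℝ :=
  ∑ i ∈ Finset.range n, Real.log (gaussianPDFReal (f (x i) (thetaPart η))
    (Real.toNNReal ((sigmaPart η * f (x i) (thetaPart η)) ^ 2)) (y i))

/-- The ML estimating function: the score `n^{-1/2} (∂l/∂θ, ∂l/∂σ)`. -/
def mlH (f : 𝓧 → EuclideanSpace ℝ (Fin p) → ℝ) (x : ℕ → 𝓧) (y : ℕ → ℝ) (n : ℕ)
    (η : EuclideanSpace ℝ (Fin p ⊕ Unit)) : EuclideanSpace ℝ (Fin p ⊕ Unit) :=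
  (Real.sqrt n)⁻¹ • gradient (logLik f x y n) η

/-- The ML estimating function as a random function, with the responses `Y_i` inserted. -/
def mlEq {Ω : Type*} (f : 𝓧 → EuclideanSpace ℝ (Fin p) → ℝ) (x : ℕ → 𝓧) (Y : ℕ → Ω → ℝ)
    (n : ℕ) (ω : Ω) (η : EuclideanSpace ℝ (Fin p ⊕ Unit)) : EuclideanSpace ℝ (Fin p ⊕ Unit) :=
  mlH f x (fun i => Y i ω) n η

/-- The ML estimating function for `θ` alone, with `σ²` replaced by `n⁻¹ ∑ (y_i - f_i)² / f_i²`. -/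
def mlProfile (f : 𝓧 → EuclideanSpace ℝ (Fin p) → ℝ) (x : ℕ → 𝓧) (y : ℕ → ℝ) (n : ℕ)
    (θ : EuclideanSpace ℝ (Fin p)) : EuclideanSpace ℝ (Fin p) :=
  ((n : ℝ)⁻¹ * ∑ i ∈ Finset.range n, (y i - f (x i) θ) ^ 2 / f (x i) θ ^ 2) •
      (∑ i ∈ Finset.range n, (f (x i) θ)⁻¹ • gradient (f (x i)) θ)
    - ∑ i ∈ Finset.range n, ((y i - f (x i) θ) / f (x i) θ ^ 2) • gradient (f (x i)) θ
    - ∑ i ∈ Finset.range n, ((y i - f (x i) θ) ^ 2 / f (x i) θ ^ 3) • gradient (f (x i)) θ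

end Model

end PropErr

end

set_option linter.unusedSectionVars false

noncomputable section

namespace PropErr

/-! ### The Lindeberg bound for characteristic functions -/

/-! Quasi-likelihood and maximum likelihood are two instances of one situation, `RegularScore`: an
equation `n^{-1/2} ∑ ψ_i(Y_i, θ) = 0` with independent centred terms, whose average expected
negative derivative `avgInfo` is symmetric and bounded below. Everything asymptotic is proved once
for that structure.

Write `B_n` for `avgInfo` and `G_n` for the average `n⁻¹ ∑ ψ_i`. A weak law with truncated weights,
together with equicontinuity on average, shows that `G_n'` is uniformly close to `-B_n` on a fixed
small ball with probability tending to one (`tendsto_measure_deriv_far`). There `G_n + B_n` has a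
small Lipschitz constant, which settles the rest deterministically. The map `u ↦ u + B_n⁻¹ G_n(u)`
is a contraction, so a root exists, measurably as a limit of iterations (`exists_measurable_root`);
and every root near `θ₀` equals `θ₀ + B_n⁻¹ G_n(θ₀)` up to a small multiple of `‖G_n(θ₀)‖`
(`norm_sub_inverse_le_of_root`). As `√n G_n(θ₀) = H_n(θ₀)` is bounded in mean square, this is the
linear expansion.

No limiting covariance is assumed, so normality is an approximation by moving Gaussian laws. A
quantitative Lindeberg bound compares the characteristic function of `H_n(θ₀)` with that of the
normal law of equal variance (`tendsto_charFun_scoreSum`). Boundedness of the covariances turns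
closeness of characteristic functions into weak closeness by compactness
(`tendsto_integral_sub_multivariateGaussian`).

Both models fit because their scores are polynomials in the relative response `Y_i / f_i`, of degree
1 for QL and 2 for ML, with coefficients depending continuously on the ratio of means, the relative
gradient `J`, the relative Hessian `K` and the parameter (`DesignBounds.exists_regularScore`).
Taking expectations makes `K` cancel: `-E ψ_i'` is `J_i J_iᵀ` for QL and the normal information
matrix for ML. Under normal third and fourth moments the ML score has covariance equal to that
information, the sandwich collapses to its inverse, and a Schur complement in the `σ` direction
centres the `J_i`. -/

theorem norm_prod_sub_prod_le_sum {ι : Type*} (s : Finset ι) (a b : ι → ℂ)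
    (ha : ∀ i ∈ s, ‖a i‖ ≤ 1) (hb : ∀ i ∈ s, ‖b i‖ ≤ 1) :
    ‖∏ i ∈ s, a i - ∏ i ∈ s, b i‖ ≤ ∑ i ∈ s, ‖a i - b i‖ := by
  classical
  induction s using Finset.induction_on with
  | empty => simp
  | insert j s hj ih =>
    rw [Finset.prod_insert hj, Finset.prod_insert hj, Finset.sum_insert hj]
    have hA : ‖∏ i ∈ s, a i‖ ≤ 1 := by
      rw [norm_prod]
      exact Finset.prod_le_one (fun i _ => norm_nonneg _)
        fun i hi => ha i (Finset.mem_insert_of_mem hi)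
    have h := ih (fun i hi => ha i (Finset.mem_insert_of_mem hi))
      (fun i hi => hb i (Finset.mem_insert_of_mem hi))
    -- Telescoping: one factor is exchanged at a time, all the others having norm at most one.
    calc ‖a j * ∏ i ∈ s, a i - b j * ∏ i ∈ s, b i‖
        = ‖(a j - b j) * ∏ i ∈ s, a i + b j * (∏ i ∈ s, a i - ∏ i ∈ s, b i)‖ := by
          congr 1; ring
      _ ≤ ‖a j - b j‖ * 1 + 1 * ‖∏ i ∈ s, a i - ∏ i ∈ s, b i‖ := by
          refine (norm_add_le _ _).trans ?_
          rw [norm_mul, norm_mul]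
          have := hb j (Finset.mem_insert_self _ _)
          gcongr
      _ ≤ _ := by linarith

/-- Below the threshold the cubic remainder is at most `ε x²`; above it a crude quadratic bound
suffices, since that region is what the Lindeberg condition controls. For `|x| > 1` the terms add up
to `2|x| + x²/2`, whence the generous constant 4. -/
theorem norm_cexp_sub_taylor_two_le (x : ℝ) {ε : ℝ} (hε0 : 0 ≤ ε) (hε : ε ≤ 1) :
    ‖Complex.exp (x * Complex.I) - 1 - x * Complex.I + x ^ 2 / 2‖
      ≤ ε * x ^ 2 + (if ε < |x| then 4 * x ^ 2 else 0) := by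
  have hsmall : |x| ≤ 1 →
      ‖Complex.exp (x * Complex.I) - 1 - x * Complex.I + x ^ 2 / 2‖ ≤ |x| * x ^ 2 := by
    intro hx
    have h := Complex.exp_bound (x := x * Complex.I) (by simpa using hx) (n := 3) (by norm_num)
    have e : ∑ m ∈ Finset.range 3, ((x : ℂ) * Complex.I) ^ m / (m.factorial : ℂ)
        = 1 + x * Complex.I - x ^ 2 / 2 := by
      simp only [Finset.sum_range_succ, Finset.sum_range_zero, Nat.factorial]
      push_cast
      ring_nf
      simp [Complex.I_sq]
      ring
    rw [e] at h
    have e2 : Complex.exp (x * Complex.I) - 1 - x * Complex.I + x ^ 2 / 2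
        = Complex.exp (x * Complex.I) - (1 + x * Complex.I - x ^ 2 / 2) := by ring
    rw [e2]
    refine h.trans ?_
    have : ‖(x : ℂ) * Complex.I‖ = |x| := by simp
    rw [this]
    norm_num [Nat.factorial]
    have h3 : |x| ^ 3 = |x| * x ^ 2 := by rw [← sq_abs x]; ring
    rw [h3]
    have : 0 ≤ |x| * x ^ 2 := by positivity
    linarith
  have hε2 : 0 ≤ ε * x ^ 2 := by positivity
  split_ifs with h
  · by_cases hx : |x| ≤ 1
    · have h1 := hsmall hx
      have : |x| * x ^ 2 ≤ 1 * x ^ 2 := by gcongr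
      nlinarith [sq_nonneg x]
    · push Not at hx
      have h1 : ‖Complex.exp (x * Complex.I) - 1‖ ≤ |x| := by
        have := Real.norm_exp_I_mul_ofReal_sub_one_le (x := x)
        rwa [mul_comm, Real.norm_eq_abs] at this
      have h2 : |x| ≤ x ^ 2 := by
        rw [← sq_abs x]
        nlinarith
      calc _ ≤ ‖Complex.exp (x * Complex.I) - 1‖ + ‖(x : ℂ) * Complex.I‖ + ‖(x : ℂ) ^ 2 / 2‖ :=
            (norm_add_le _ _).trans (by gcongr; exact norm_sub_le _ _)
        _ ≤ |x| + |x| + x ^ 2 / 2 := by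
            have e : ‖(x : ℂ) ^ 2 / 2‖ = x ^ 2 / 2 := by simp
            rw [e]
            gcongr
            simp
        _ ≤ _ := by nlinarith
  · push Not at h
    refine (hsmall (h.trans hε)).trans ?_
    rw [add_zero]
    gcongr

theorem abs_exp_neg_sub_one_add_le {u : ℝ} (hu : 0 ≤ u) : |Real.exp (-u) - 1 + u| ≤ u ^ 2 := by
  have h1 := Real.add_one_le_exp (-u)
  have h2 : Real.exp (-u) ≤ 1 - u + u ^ 2 := by
    rw [Real.exp_neg, inv_le_iff_one_le_mul₀ (Real.exp_pos u)]
    have h := Real.add_one_le_exp u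
    have h3 : 0 ≤ 1 - u + u ^ 2 := by nlinarith [sq_nonneg (u - 1)]
    calc (1 : ℝ) ≤ (1 - u + u ^ 2) * (u + 1) := by nlinarith [pow_nonneg hu 3]
      _ ≤ _ := by gcongr
  rw [abs_le]
  constructor <;> nlinarith [sq_nonneg u]

section Lindeberg

variable {Ω : Type*} [MeasurableSpace Ω] {μ : Measure Ω} [IsProbabilityMeasure μ]

/-- The characteristic function at 1 and the Gaussian factor of equal variance `v` are both compared
with `1 - v/2`. The Gaussian error is quadratic in `v`, and one factor `v` is traded for the
truncation level plus the Lindeberg tail, so that the errors stay small after summation. -/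
theorem norm_integral_cexp_sub_le {X : Ω → ℝ} (hm : Measurable X) (hX : MemLp X 2 μ)
    (h0 : ∫ ω, X ω ∂μ = 0) {ε : ℝ} (hε0 : 0 ≤ ε) (hε : ε ≤ 1) :
    ‖∫ ω, Complex.exp (X ω * Complex.I) ∂μ - Complex.exp (-(∫ ω, X ω ^ 2 ∂μ) / 2 : ℝ)‖
      ≤ ε * ∫ ω, X ω ^ 2 ∂μ + 4 * (∫ ω in {ω | ε < |X ω|}, X ω ^ 2 ∂μ)
        + (∫ ω, X ω ^ 2 ∂μ) * (ε ^ 2 + ∫ ω in {ω | ε < |X ω|}, X ω ^ 2 ∂μ) := by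
  set v := ∫ ω, X ω ^ 2 ∂μ
  set L := ∫ ω in {ω | ε < |X ω|}, X ω ^ 2 ∂μ
  have hsq : Integrable (fun ω => X ω ^ 2) μ := hX.integrable_sq
  have hi : Integrable X μ := hX.integrable (by norm_num)
  have hv : 0 ≤ v := integral_nonneg fun ω => sq_nonneg _
  have hL : 0 ≤ L := integral_nonneg fun ω => sq_nonneg _
  have hS : MeasurableSet {ω | ε < |X ω|} := measurableSet_lt measurable_const hm.abs
  have hexp : Integrable (fun ω => Complex.exp (X ω * Complex.I)) μ := by
    refine Integrable.of_bound (by fun_prop) 1 (ae_of_all _ fun ω => ?_)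
    rw [Complex.norm_exp_ofReal_mul_I]
  have hsqC : Integrable (fun ω => (X ω : ℂ) ^ 2 / 2) μ := by
    have := hsq.ofReal (𝕜 := ℂ)
    simpa using this.div_const 2
  have hiC : Integrable (fun ω => (X ω : ℂ) * Complex.I) μ := (hi.ofReal (𝕜 := ℂ)).mul_const _
  have hvL : v ≤ ε ^ 2 + L := by
    rw [show v = (∫ ω in {ω | ε < |X ω|}, X ω ^ 2 ∂μ) + ∫ ω in {ω | ε < |X ω|}ᶜ, X ω ^ 2 ∂μ from
      (integral_add_compl hS hsq).symm, add_comm]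
    gcongr
    calc ∫ ω in {ω | ε < |X ω|}ᶜ, X ω ^ 2 ∂μ ≤ ∫ ω in {ω | ε < |X ω|}ᶜ, ε ^ 2 ∂μ := by
          refine setIntegral_mono_on hsq.integrableOn (integrable_const _).integrableOn hS.compl
            fun ω hω => ?_
          simp only [Set.mem_compl_iff, Set.mem_ofPred_eq, not_lt] at hω
          rw [← sq_abs]
          gcongr
      _ ≤ ε ^ 2 := by
          rw [setIntegral_const, smul_eq_mul]
          exact mul_le_of_le_one_left (sq_nonneg _) measureReal_le_one
  have hmain : ‖∫ ω, Complex.exp (X ω * Complex.I) ∂μ - 1 + (v / 2 : ℝ)‖ ≤ ε * v + 4 * L := by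
    have e : ∫ ω, Complex.exp (X ω * Complex.I) ∂μ - 1 + (v / 2 : ℝ)
        = ∫ ω, (Complex.exp (X ω * Complex.I) - 1 - X ω * Complex.I + X ω ^ 2 / 2) ∂μ := by
      have hc : Integrable (fun _ : Ω => (1 : ℂ)) μ := integrable_const _
      have h1 : Integrable (fun ω => Complex.exp (X ω * Complex.I) - 1) μ := hexp.sub hc
      have h2 : Integrable (fun ω => Complex.exp (X ω * Complex.I) - 1 - X ω * Complex.I) μ :=
        h1.sub hiC
      rw [integral_add h2 hsqC, integral_sub h1 hiC,
        integral_sub hexp hc, integral_mul_const, integral_complex_ofReal, h0, integral_div]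
      have : ∫ ω, (X ω : ℂ) ^ 2 ∂μ = (v : ℂ) := by
        rw [← integral_complex_ofReal]
        simp
      rw [this]
      simp
    rw [e]
    calc _ ≤ ∫ ω, (ε * X ω ^ 2 + {ω | ε < |X ω|}.indicator (fun ω => 4 * X ω ^ 2) ω) ∂μ := by
          refine norm_integral_le_of_norm_le
            ((hsq.const_mul ε).add ((hsq.const_mul 4).indicator hS)) (ae_of_all _ fun ω => ?_)
          have := norm_cexp_sub_taylor_two_le (X ω) hε0 hε
          simpa only [Set.indicator, Set.mem_ofPred_eq] using this
      _ = ε * v + 4 * L := by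
          rw [integral_add (hsq.const_mul ε) ((hsq.const_mul 4).indicator hS),
            integral_indicator hS, integral_const_mul, integral_const_mul]
  have hexpv : ‖Complex.exp (-v / 2 : ℝ) - 1 + (v / 2 : ℝ)‖ ≤ (v / 2) ^ 2 := by
    have := abs_exp_neg_sub_one_add_le (u := v / 2) (by positivity)
    rw [← Real.norm_eq_abs, ← Complex.norm_real] at this
    convert this using 2
    push_cast
    ring_nf
  calc _ = ‖(∫ ω, Complex.exp (X ω * Complex.I) ∂μ - 1 + (v / 2 : ℝ))
          - (Complex.exp (-v / 2 : ℝ) - 1 + (v / 2 : ℝ))‖ := by congr 1; ring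
    _ ≤ (ε * v + 4 * L) + (v / 2) ^ 2 := (norm_sub_le _ _).trans (add_le_add hmain hexpv)
    _ ≤ _ := by nlinarith

theorem norm_integral_cexp_sum_sub_le {X : ℕ → Ω → ℝ} (hm : ∀ i, Measurable (X i))
    (hX : ∀ i, MemLp (X i) 2 μ) (h0 : ∀ i, ∫ ω, X i ω ∂μ = 0) (hind : iIndepFun X μ)
    (s : Finset ℕ) {ε : ℝ} (hε0 : 0 ≤ ε) (hε : ε ≤ 1) :
    ‖∫ ω, Complex.exp ((∑ i ∈ s, X i ω : ℝ) * Complex.I) ∂μ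
        - Complex.exp (-(∑ i ∈ s, ∫ ω, X i ω ^ 2 ∂μ) / 2 : ℝ)‖
      ≤ ε * (∑ i ∈ s, ∫ ω, X i ω ^ 2 ∂μ) + 4 * (∑ i ∈ s, ∫ ω in {ω | ε < |X i ω|}, X i ω ^ 2 ∂μ)
        + (∑ i ∈ s, ∫ ω, X i ω ^ 2 ∂μ) *
          (ε ^ 2 + ∑ i ∈ s, ∫ ω in {ω | ε < |X i ω|}, X i ω ^ 2 ∂μ) := by
  have e1 : ∫ ω, Complex.exp ((∑ i ∈ s, X i ω : ℝ) * Complex.I) ∂μ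
      = ∏ i ∈ s, ∫ ω, Complex.exp (X i ω * Complex.I) ∂μ := by
    have h := congrFun ((hind.restrict s).charFun_map_fun_finsetSum_eq_prod
      (fun i _ => (hm i).aemeasurable)) 1
    rw [charFun_apply_real, integral_map (by fun_prop) (by fun_prop), Finset.prod_apply] at h
    simp only [Complex.ofReal_one, one_mul] at h
    rw [h]
    refine Finset.prod_congr rfl fun i _ => ?_
    rw [charFun_apply_real, integral_map (hm i).aemeasurable (by fun_prop)]
    simp
  have e2 : Complex.exp (-(∑ i ∈ s, ∫ ω, X i ω ^ 2 ∂μ) / 2 : ℝ)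
      = ∏ i ∈ s, Complex.exp (-(∫ ω, X i ω ^ 2 ∂μ) / 2 : ℝ) := by
    rw [← Complex.exp_sum]
    congr 1
    rw [← Complex.ofReal_sum, ← Finset.sum_div, Finset.sum_neg_distrib]
  have hnn : ∀ i, 0 ≤ ∫ ω in {ω | ε < |X i ω|}, X i ω ^ 2 ∂μ := fun i =>
    integral_nonneg fun ω => sq_nonneg _
  have hvn : ∀ i, 0 ≤ ∫ ω, X i ω ^ 2 ∂μ := fun i => integral_nonneg fun ω => sq_nonneg _
  rw [e1, e2]
  refine (norm_prod_sub_prod_le_sum s _ _ (fun i _ => ?_) fun i _ => ?_).trans ?_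
  · refine (norm_integral_le_integral_norm _).trans ?_
    simp [Complex.norm_exp_ofReal_mul_I]
  · rw [Complex.norm_exp_ofReal]
    exact Real.exp_le_one_iff.2 (by have := hvn i; linarith)
  refine (Finset.sum_le_sum fun i _ => norm_integral_cexp_sub_le (hm i) (hX i) (h0 i) hε0 hε).trans
    ?_
  rw [Finset.sum_add_distrib, Finset.sum_add_distrib, ← Finset.mul_sum, ← Finset.mul_sum,
    Finset.sum_mul]
  gcongr with i hi
  -- Each tail is replaced by the sum of all tails, which makes the second factor common to the
  -- whole row.
  exact Finset.single_le_sum (f := fun i => ∫ ω in {ω | ε < |X i ω|}, X i ω ^ 2 ∂μ)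
    (fun j _ => hnn j) hi

/-- Lindeberg's central limit theorem for a triangular array whose row variances are bounded, but
need not converge: the characteristic functions of the row sums approach those of normal laws. -/
theorem tendsto_integral_cexp_sub_of_lindeberg {X : ℕ → ℕ → Ω → ℝ}
    (hm : ∀ n i, Measurable (X n i)) (hX : ∀ n i, MemLp (X n i) 2 μ)
    (h0 : ∀ n i, ∫ ω, X n i ω ∂μ = 0) (hind : ∀ n, iIndepFun (X n) μ) {C : ℝ}
    (hC : ∀ᶠ n : ℕ in atTop, ∑ i ∈ Finset.range n, ∫ ω, X n i ω ^ 2 ∂μ ≤ C)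
    (hL : ∀ ε > 0, Tendsto (fun n : ℕ => ∑ i ∈ Finset.range n,
      ∫ ω in {ω | ε < |X n i ω|}, X n i ω ^ 2 ∂μ) atTop (𝓝 0)) :
    Tendsto (fun n : ℕ => ∫ ω, Complex.exp ((∑ i ∈ Finset.range n, X n i ω : ℝ) * Complex.I) ∂μ
        - Complex.exp (-(∑ i ∈ Finset.range n, ∫ ω, X n i ω ^ 2 ∂μ) / 2 : ℝ)) atTop (𝓝 0) := by
  have hC0 : 0 ≤ C := by
    obtain ⟨n, hn⟩ := hC.exists
    exact le_trans (Finset.sum_nonneg fun i _ => integral_nonneg fun ω => sq_nonneg _) hn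
  rw [tendsto_zero_iff_norm_tendsto_zero]
  refine Metric.tendsto_nhds.2 fun τ hτ => ?_
  -- Once the tail sum is at most `ε`, and using `ε² ≤ ε`, the bound becomes `εC + 4ε + 2Cε`, which
  -- is below `ε(4C + 4)`.
  obtain ⟨ε, hε0, hε1, hετ⟩ : ∃ ε > 0, ε ≤ 1 ∧ ε * (4 * C + 4) < τ := by
    refine ⟨min 1 (τ / (2 * (4 * C + 4))), by positivity, min_le_left _ _, ?_⟩
    calc _ ≤ τ / (2 * (4 * C + 4)) * (4 * C + 4) := by gcongr; exact min_le_right _ _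
      _ = τ / 2 := by field_simp
      _ < τ := by linarith
  filter_upwards [hC, (hL ε hε0).eventually (ge_mem_nhds hε0)] with n hn hLn
  rw [dist_zero_right, norm_norm]
  refine (norm_integral_cexp_sum_sub_le (hm n) (hX n) (h0 n) (hind n) _ hε0.le hε1).trans_lt ?_
  refine lt_of_le_of_lt ?_ hετ
  have hε2 : ε ^ 2 ≤ ε := by nlinarith
  have hv : 0 ≤ ∑ i ∈ Finset.range n, ∫ ω, X n i ω ^ 2 ∂μ :=
    Finset.sum_nonneg fun i _ => integral_nonneg fun ω => sq_nonneg _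
  calc _ ≤ ε * C + 4 * ε + C * (ε + ε) := by gcongr
    _ ≤ _ := by nlinarith

end Lindeberg

/-! ### Weak approximation by normal laws -/

section Weak

variable {ι : Type*} [Fintype ι] [DecidableEq ι]

theorem posSemidef_of_tendsto {ι : Type*} [Fintype ι] {C : ℕ → Matrix ι ι ℝ} {A : Matrix ι ι ℝ}
    (hC : ∀ᶠ n in atTop, (C n).PosSemidef) (h : Tendsto C atTop (𝓝 A)) : A.PosSemidef := by
  refine Matrix.PosSemidef.of_dotProduct_mulVec_nonneg ?_ fun v => ?_
  · have h1 : Tendsto (fun n => (C n).conjTranspose) atTop (𝓝 A.conjTranspose) :=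
      (continuous_id.matrix_conjTranspose.tendsto A).comp h
    refine tendsto_nhds_unique (h1.congr' ?_) h
    filter_upwards [hC] with n hn using hn.1
  · have hcont : Continuous fun M : Matrix ι ι ℝ => star v ⬝ᵥ M.mulVec v := by fun_prop
    refine ge_of_tendsto ((hcont.tendsto A).comp h) ?_
    filter_upwards [hC] with n hn using hn.dotProduct_mulVec_nonneg v

theorem charFun_multivariateGaussian_zero {S : Matrix ι ι ℝ} (hS : S.PosSemidef)
    (t : EuclideanSpace ℝ ι) :
    charFun (multivariateGaussian 0 S) t = Complex.exp (-(t ⬝ᵥ S.mulVec t) / 2 : ℝ) := by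
  rw [charFun_multivariateGaussian hS]
  congr 1
  push_cast
  simp
  ring

/-- If the characteristic functions of `ν_n` approach those of the laws `N(0, C_n)`, where the
matrices `C_n` are bounded, then `ν_n` and `N(0, C_n)` approach each other weakly. -/
theorem tendsto_integral_sub_multivariateGaussian {ν : ℕ → Measure (EuclideanSpace ℝ ι)}
    [∀ n, IsProbabilityMeasure (ν n)] {C : ℕ → Matrix ι ι ℝ} {K : ℝ}
    (hC : ∀ᶠ n in atTop, (C n).PosSemidef) (hK : ∀ᶠ n in atTop, ∀ a b, |C n a b| ≤ K)
    (h : ∀ t : EuclideanSpace ℝ ι, Tendsto (fun n => charFun (ν n) t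
      - Complex.exp (-(t ⬝ᵥ (C n).mulVec t) / 2 : ℝ)) atTop (𝓝 0))
    (g : BoundedContinuousFunction (EuclideanSpace ℝ ι) ℝ) :
    Tendsto (fun n => ∫ z, g z ∂(ν n) - ∫ z, g z ∂(multivariateGaussian 0 (C n))) atTop (𝓝 0) := by
  -- The covariances eventually stay in a compact set. Every subsequence therefore has a further one
  -- along which `C_n` converges to some `A`, and there both laws converge to `N(0, A)` by Lévy's
  -- theorem.
  refine tendsto_of_subseq_tendsto fun ns hns => ?_
  have hcpt : IsCompact (Set.univ.pi fun _ => Set.univ.pi fun _ => Set.Icc (-K) K :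
      Set (Matrix ι ι ℝ)) :=
    isCompact_univ_pi fun _ => isCompact_univ_pi fun _ => isCompact_Icc
  have hfr : ∃ᶠ n in atTop, C (ns n) ∈ (Set.univ.pi fun _ => Set.univ.pi fun _ => Set.Icc (-K) K :
      Set (Matrix ι ι ℝ)) := by
    refine Eventually.frequently ?_
    filter_upwards [hns.eventually hK] with n hn a _ b _
    exact abs_le.1 (hn a b)
  obtain ⟨A, φ, hφ, hA⟩ : ∃ (A : Matrix ι ι ℝ) (φ : ℕ → ℕ), StrictMono φ ∧
      Tendsto (fun k => C (ns (φ k))) atTop (𝓝 A) := by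
    obtain ⟨A, -, φ, hφ, hA⟩ := hcpt.tendsto_subseq' hfr
    exact ⟨A, φ, hφ, hA⟩
  have hφt : Tendsto (fun k => ns (φ k)) atTop atTop := hns.comp hφ.tendsto_atTop
  have hpsd : ∀ᶠ k in atTop, (C (ns (φ k))).PosSemidef := hφt.eventually hC
  have hAp : A.PosSemidef := posSemidef_of_tendsto hpsd hA
  have hlim : ∀ t : EuclideanSpace ℝ ι, Tendsto
      (fun k => Complex.exp (-(t ⬝ᵥ (C (ns (φ k))).mulVec t) / 2 : ℝ)) atTop
      (𝓝 (charFun (multivariateGaussian 0 A) t)) := by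
    intro t
    rw [charFun_multivariateGaussian_zero hAp]
    have hcont : Continuous fun M : Matrix ι ι ℝ =>
        Complex.exp (-((t : ι → ℝ) ⬝ᵥ M.mulVec t) / 2 : ℝ) := by fun_prop
    exact (hcont.tendsto A).comp hA
  let γ : ProbabilityMeasure (EuclideanSpace ℝ ι) := ⟨multivariateGaussian 0 A, inferInstance⟩
  have h1 : Tendsto (fun k => ∫ z, g z ∂(ν (ns (φ k)))) atTop
      (𝓝 (∫ z, g z ∂(multivariateGaussian 0 A))) := by
    have := ProbabilityMeasure.tendsto_of_tendsto_charFun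
      (μ := fun k => (⟨ν (ns (φ k)), inferInstance⟩ : ProbabilityMeasure (EuclideanSpace ℝ ι)))
      (μ₀ := γ) fun t => by simpa [γ] using ((h t).comp hφt).add (hlim t)
    exact (ProbabilityMeasure.tendsto_iff_forall_integral_tendsto.1 this) g
  have h2 : Tendsto (fun k => ∫ z, g z ∂(multivariateGaussian 0 (C (ns (φ k))))) atTop
      (𝓝 (∫ z, g z ∂(multivariateGaussian 0 A))) := by
    have := ProbabilityMeasure.tendsto_of_tendsto_charFun
      (μ := fun k => (⟨multivariateGaussian 0 (C (ns (φ k))), inferInstance⟩ :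
        ProbabilityMeasure (EuclideanSpace ℝ ι)))
      (μ₀ := γ) fun t => by
        refine (hlim t).congr' ?_
        filter_upwards [hpsd] with k hk
        exact (charFun_multivariateGaussian_zero hk t).symm
    exact (ProbabilityMeasure.tendsto_iff_forall_integral_tendsto.1 this) g
  exact ⟨φ, by simpa using h1.sub h2⟩

/-- The characteristic function of the marginal at `t` is that of the joint law at `(t, 0)`, which
sees only the upper left block. -/
theorem map_thetaPart_multivariateGaussian {p : ℕ} {S : Matrix (Fin p ⊕ Unit) (Fin p ⊕ Unit) ℝ}
    (hS : S.PosSemidef) :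
    (multivariateGaussian 0 S).map thetaPart = multivariateGaussian 0 S.toBlocks₁₁ := by
  have hS' : S.toBlocks₁₁.PosSemidef := hS.submatrix _
  have hc : Continuous (thetaPart (p := p)) := by unfold thetaPart; fun_prop
  have := Measure.isProbabilityMeasure_map (μ := multivariateGaussian 0 S) hc.aemeasurable
  refine Measure.ext_of_charFun (funext fun t => ?_)
  rw [charFun_apply, integral_map hc.aemeasurable (by fun_prop)]
  have e : ∀ z : EuclideanSpace ℝ (Fin p ⊕ Unit),
      inner ℝ (thetaPart z) t = inner ℝ z (joint t 0) := by
    intro z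
    simp [PiLp.inner_apply, thetaPart, joint]
  simp_rw [e]
  rw [← charFun_apply, charFun_multivariateGaussian_zero hS, charFun_multivariateGaussian_zero hS']
  congr 3
  simp [joint, dotProduct, Matrix.mulVec, Matrix.toBlocks₁₁]

end Weak

/-! ### Uniform integrability on average -/

/-- The averages of `m_i²` are uniformly integrable. -/
def AvgUnifInt (m : ℕ → ℝ) : Prop :=
  ∀ ε > 0, ∃ T : ℝ, ∀ᶠ n : ℕ in atTop, ∑ i ∈ Finset.range n with T < m i, m i ^ 2 ≤ ε * n

/-- The squares of the nonnegative random variables `R_i` are uniformly integrable. -/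
structure UnifSqInt {Ω : Type*} [MeasurableSpace Ω] (μ : Measure Ω) (R : ℕ → Ω → ℝ) : Prop where
  nonneg : ∀ i ω, 0 ≤ R i ω
  meas : ∀ i, Measurable (R i)
  memLp : ∀ i, MemLp (R i) 2 μ
  tail : ∀ ε > 0, ∃ L : ℝ, ∀ i, ∫ ω in {ω | L < R i ω}, R i ω ^ 2 ∂μ ≤ ε

theorem AvgUnifInt.exists_nonneg {m : ℕ → ℝ} (h : AvgUnifInt m) {ε : ℝ} (hε : 0 < ε) :
    ∃ T : ℝ, 0 ≤ T ∧ ∀ᶠ n : ℕ in atTop, ∑ i ∈ Finset.range n with T < m i, m i ^ 2 ≤ ε * n := by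
  obtain ⟨T, hT⟩ := h ε hε
  refine ⟨max T 0, le_max_right _ _, ?_⟩
  filter_upwards [hT] with n hn
  refine le_trans (Finset.sum_le_sum_of_subset_of_nonneg (fun i hi => ?_)
    fun i _ _ => sq_nonneg _) hn
  simp only [Finset.mem_filter] at hi ⊢
  exact ⟨hi.1, lt_of_le_of_lt (le_max_left _ _) hi.2⟩

theorem AvgUnifInt.exists_sum_le {m : ℕ → ℝ} (h : AvgUnifInt m) (hm : ∀ i, 0 ≤ m i) :
    ∃ C : ℝ, 0 < C ∧ ∀ᶠ n : ℕ in atTop, ∑ i ∈ Finset.range n, m i ^ 2 ≤ C * n := by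
  obtain ⟨T, hT0, hT⟩ := h.exists_nonneg one_pos
  refine ⟨1 + T ^ 2, by positivity, ?_⟩
  filter_upwards [hT] with n hn
  rw [← Finset.sum_filter_add_sum_filter_not (Finset.range n) (fun i => T < m i)]
  have : ∑ i ∈ Finset.range n with ¬ T < m i, m i ^ 2 ≤ n * T ^ 2 := by
    calc _ ≤ ∑ i ∈ Finset.range n with ¬ T < m i, T ^ 2 := by
          refine Finset.sum_le_sum fun i hi => ?_
          simp only [Finset.mem_filter, not_lt] at hi
          have := hm i
          gcongr
          exact hi.2
      _ ≤ ∑ i ∈ Finset.range n, T ^ 2 :=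
          Finset.sum_le_sum_of_subset_of_nonneg (Finset.filter_subset _ _)
            fun _ _ _ => sq_nonneg _
      _ = n * T ^ 2 := by simp
  linarith

section

variable {Ω : Type*} [MeasurableSpace Ω] {μ : Measure Ω} [IsProbabilityMeasure μ]

theorem UnifSqInt.exists_integral_le {R : ℕ → Ω → ℝ} (h : UnifSqInt μ R) :
    ∃ C : ℝ, 0 < C ∧ ∀ i, ∫ ω, R i ω ^ 2 ∂μ ≤ C := by
  obtain ⟨L, hL⟩ := h.tail 1 one_pos
  refine ⟨1 + L ^ 2, by positivity, fun i => ?_⟩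
  have hS : MeasurableSet {ω | L < R i ω} := measurableSet_lt measurable_const (h.meas i)
  have hsq := (h.memLp i).integrable_sq
  rw [← integral_add_compl hS hsq]
  gcongr
  · exact hL i
  calc ∫ ω in {ω | L < R i ω}ᶜ, R i ω ^ 2 ∂μ ≤ ∫ ω in {ω | L < R i ω}ᶜ, L ^ 2 ∂μ := by
        refine setIntegral_mono_on hsq.integrableOn (integrable_const _).integrableOn hS.compl
          fun ω hω => ?_
        simp only [Set.mem_compl_iff, Set.mem_ofPred_eq, not_lt] at hω
        have := h.nonneg i ω
        gcongr
    _ ≤ L ^ 2 := by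
        rw [setIntegral_const, smul_eq_mul]
        exact mul_le_of_le_one_left (sq_nonneg _) measureReal_le_one

theorem UnifSqInt.integrable {R : ℕ → Ω → ℝ} (h : UnifSqInt μ R) (i : ℕ) : Integrable (R i) μ :=
  (h.memLp i).integrable (by norm_num)

theorem UnifSqInt.exists_integral_le' {R : ℕ → Ω → ℝ} (h : UnifSqInt μ R) :
    ∃ C : ℝ, 0 < C ∧ (∀ i, ∫ ω, R i ω ^ 2 ∂μ ≤ C) ∧ ∀ i, ∫ ω, R i ω ∂μ ≤ C := by
  obtain ⟨C, hC0, hC⟩ := h.exists_integral_le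
  refine ⟨C + 1, by positivity, fun i => (hC i).trans (by linarith), fun i => ?_⟩
  calc ∫ ω, R i ω ∂μ ≤ ∫ ω, (R i ω ^ 2 + 1) ∂μ := by
        refine integral_mono (h.integrable i) ((h.memLp i).integrable_sq.add (integrable_const _))
          fun ω => ?_
        dsimp only
        nlinarith [sq_nonneg (R i ω - 1), h.nonneg i ω]
    _ = ∫ ω, R i ω ^ 2 ∂μ + 1 := by
        rw [integral_add (h.memLp i).integrable_sq (integrable_const _)]
        simp
    _ ≤ C + 1 := by gcongr; exact hC i

/-- The two kinds of uniform integrability share the work. Indices with `m_i > T` carry little total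
weight. For the others the event `m_i R_i > ε√n` forces `R_i > L` as soon as `ε√n ≥ T|L|`, and the
tail of `R_i²` beyond `L` is uniformly small. -/
theorem tendsto_lindeberg_of_unifSqInt {R : ℕ → Ω → ℝ} {m : ℕ → ℝ} (hm0 : ∀ i, 0 ≤ m i)
    (hm : AvgUnifInt m) (hR : UnifSqInt μ R) {ε : ℝ} (hε : 0 < ε) :
    Tendsto (fun n : ℕ => (n : ℝ)⁻¹ * ∑ i ∈ Finset.range n,
      m i ^ 2 * ∫ ω in {ω | ε * √n < m i * R i ω}, R i ω ^ 2 ∂μ) atTop (𝓝 0) := by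
  obtain ⟨C₁, hC₁, hmC⟩ := hm.exists_sum_le hm0
  obtain ⟨C₂, hC₂, hRC⟩ := hR.exists_integral_le
  refine Metric.tendsto_nhds.2 fun τ hτ => ?_
  obtain ⟨T, hT0, hT⟩ := hm.exists_nonneg (ε := τ / (4 * C₂)) (by positivity)
  obtain ⟨L, hL⟩ := hR.tail (τ / (4 * C₁)) (by positivity)
  have hsqrt : Tendsto (fun n : ℕ => ε * √n) atTop atTop :=
    (Real.tendsto_sqrt_atTop.comp tendsto_natCast_atTop_atTop).const_mul_atTop hε
  filter_upwards [hT, hmC, hsqrt.eventually_ge_atTop (T * |L|), eventually_gt_atTop 0]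
    with n hTn hCn hsn hn
  have hn' : (0 : ℝ) < n := by exact_mod_cast hn
  have hnn : ∀ (i : ℕ) (S : Set Ω), 0 ≤ ∫ ω in S, R i ω ^ 2 ∂μ := fun i S =>
    integral_nonneg fun ω => sq_nonneg _
  have hsum0 : 0 ≤ ∑ i ∈ Finset.range n,
      m i ^ 2 * ∫ ω in {ω | ε * √n < m i * R i ω}, R i ω ^ 2 ∂μ :=
    Finset.sum_nonneg fun i _ => mul_nonneg (sq_nonneg _) (hnn _ _)
  rw [dist_zero_right, Real.norm_of_nonneg (by positivity), inv_mul_lt_iff₀ hn']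
  have hterm : ∀ i, m i ^ 2 * ∫ ω in {ω | ε * √n < m i * R i ω}, R i ω ^ 2 ∂μ
      ≤ (if T < m i then m i ^ 2 else 0) * C₂ + m i ^ 2 * (τ / (4 * C₁)) := by
    intro i
    split_ifs with h
    · have h1 : ∫ ω in {ω | ε * √n < m i * R i ω}, R i ω ^ 2 ∂μ ≤ C₂ :=
        (setIntegral_le_integral (hR.memLp i).integrable_sq (ae_of_all _ fun ω => sq_nonneg _)).trans
          (hRC i)
      have h2 : 0 ≤ m i ^ 2 * (τ / (4 * C₁)) := by positivity
      have := mul_le_mul_of_nonneg_left h1 (sq_nonneg (m i))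
      linarith
    · rw [zero_mul, zero_add]
      refine mul_le_mul_of_nonneg_left (le_trans ?_ (hL i)) (sq_nonneg _)
      refine setIntegral_mono_set (hR.memLp i).integrable_sq.integrableOn
        (ae_of_all _ fun ω => sq_nonneg _) (LE.le.eventuallyLE fun ω hω => ?_)
      simp only [Set.mem_ofPred_eq] at hω ⊢
      by_contra hc
      push Not at hc h
      have h3 : m i * R i ω ≤ T * |L| :=
        mul_le_mul h (hc.trans (le_abs_self L)) (hR.nonneg i ω) hT0
      linarith
  calc _ ≤ ∑ i ∈ Finset.range n,
          ((if T < m i then m i ^ 2 else 0) * C₂ + m i ^ 2 * (τ / (4 * C₁))) :=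
        Finset.sum_le_sum fun i _ => hterm i
    _ = (∑ i ∈ Finset.range n with T < m i, m i ^ 2) * C₂
          + (∑ i ∈ Finset.range n, m i ^ 2) * (τ / (4 * C₁)) := by
        rw [Finset.sum_add_distrib, Finset.sum_mul, Finset.sum_mul, Finset.sum_filter]
        congr 1
        exact Finset.sum_congr rfl fun i _ => by split_ifs <;> simp
    _ ≤ (τ / (4 * C₂) * n) * C₂ + (C₁ * n) * (τ / (4 * C₁)) := by gcongr
    _ = n * τ / 2 := by field_simp; ring
    _ < n * τ := by nlinarith [mul_pos hn' hτ]

/-- A weak law of large numbers (in mean) for independent terms bounded by `m_i² R_i`. -/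
theorem tendsto_inv_mul_integral_abs_sum_sub {R : ℕ → Ω → ℝ} {m : ℕ → ℝ} (hm0 : ∀ i, 0 ≤ m i)
    (hm : AvgUnifInt m) (hR : UnifSqInt μ R) {d : ℕ → Ω → ℝ} (hd : ∀ i, Measurable (d i))
    (hind : iIndepFun d μ) (hdR : ∀ i ω, |d i ω| ≤ m i ^ 2 * R i ω) :
    Tendsto (fun n : ℕ => (n : ℝ)⁻¹ * ∫ ω, |∑ i ∈ Finset.range n, (d i ω - ∫ ω', d i ω' ∂μ)| ∂μ)
      atTop (𝓝 0) := by
  obtain ⟨C, hC0, hC2, hC1⟩ := hR.exists_integral_le'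
  have hdL : ∀ i, MemLp (d i) 2 μ := fun i =>
    ((hR.memLp i).const_mul (m i ^ 2)).mono (hd i).aestronglyMeasurable
      (ae_of_all _ fun ω => by
        rw [Real.norm_eq_abs, Real.norm_eq_abs]
        exact (hdR i ω).trans (le_abs_self _))
  have hdi : ∀ i, Integrable (d i) μ := fun i => (hdL i).integrable (by norm_num)
  have habs : ∀ i, ∫ ω, |d i ω| ∂μ ≤ m i ^ 2 * C := fun i => by
    calc _ ≤ ∫ ω, m i ^ 2 * R i ω ∂μ :=
          integral_mono (hdi i).abs ((hR.integrable i).const_mul _) (hdR i)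
      _ = m i ^ 2 * ∫ ω, R i ω ∂μ := integral_const_mul _ _
      _ ≤ _ := by gcongr; exact hC1 i
  have hci : ∀ i, Integrable (fun ω => d i ω - ∫ ω', d i ω' ∂μ) μ := fun i =>
    (hdi i).sub (integrable_const _)
  have hcL : ∀ i, MemLp (fun ω => d i ω - ∫ ω', d i ω' ∂μ) 2 μ := fun i =>
    (hdL i).sub (memLp_const _)
  have hvar : ∀ i, variance (d i) μ ≤ m i ^ 4 * C := fun i => by
    calc variance (d i) μ ≤ ∫ ω, d i ω ^ 2 ∂μ := variance_le_expectation_sq (hd i).aestronglyMeasurable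
      _ ≤ ∫ ω, m i ^ 4 * R i ω ^ 2 ∂μ := by
          refine integral_mono (hdL i).integrable_sq ((hR.memLp i).integrable_sq.const_mul _)
            fun ω => ?_
          dsimp only
          rw [← sq_abs]
          calc |d i ω| ^ 2 ≤ (m i ^ 2 * R i ω) ^ 2 := by gcongr; exact hdR i ω
            _ = _ := by ring
      _ = m i ^ 4 * ∫ ω, R i ω ^ 2 ∂μ := integral_const_mul _ _
      _ ≤ _ := by gcongr; exact hC2 i
  refine Metric.tendsto_nhds.2 fun τ hτ => ?_
  obtain ⟨T, hT0, hT⟩ := hm.exists_nonneg (ε := τ / (8 * C)) (by positivity)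
  have hlim : Tendsto (fun n : ℕ => T ^ 4 * C / τ * (n : ℝ)⁻¹) atTop (𝓝 0) := by
    simpa using (tendsto_inv_atTop_nhds_zero_nat (𝕜 := ℝ)).const_mul (T ^ 4 * C / τ)
  filter_upwards [hT, hlim.eventually (gt_mem_nhds (show (0 : ℝ) < τ / 8 by positivity)),
    eventually_gt_atTop 0] with n hTn hln hn
  have hn' : (0 : ℝ) < n := by exact_mod_cast hn
  have hI0 : 0 ≤ ∫ ω, |∑ i ∈ Finset.range n, (d i ω - ∫ ω', d i ω' ∂μ)| ∂μ :=
    integral_nonneg fun ω => abs_nonneg _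
  rw [dist_zero_right, Real.norm_of_nonneg (by positivity), inv_mul_lt_iff₀ hn']
  set s₁ := (Finset.range n).filter fun i => ¬ T < m i
  set s₂ := (Finset.range n).filter fun i => T < m i
  -- Terms with `m_i ≤ T` have variance at most `T⁴ C`, so their sum is treated in mean square; the
  -- inequality `|s| ≤ s²/(τn) + τn/4` passes from the square to the first moment. The remaining
  -- terms have small total weight and are bounded by their absolute means.
  have hsplit : ∀ ω, |∑ i ∈ Finset.range n, (d i ω - ∫ ω', d i ω' ∂μ)|
      ≤ ((∑ i ∈ s₁, (d i ω - ∫ ω', d i ω' ∂μ)) ^ 2 / (τ * n) + τ * n / 4)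
        + ∑ i ∈ s₂, |d i ω - ∫ ω', d i ω' ∂μ| := by
    intro ω
    rw [← Finset.sum_filter_not_add_sum_filter (Finset.range n) (fun i => T < m i)]
    refine (abs_add_le _ _).trans (add_le_add ?_ (Finset.abs_sum_le_sum_abs _ _))
    have hp : 0 < τ * n := by positivity
    rw [← sub_nonneg]
    have e : (∑ i ∈ s₁, (d i ω - ∫ ω', d i ω' ∂μ)) ^ 2 / (τ * n) + τ * n / 4
        - |∑ i ∈ s₁, (d i ω - ∫ ω', d i ω' ∂μ)|
        = (|∑ i ∈ s₁, (d i ω - ∫ ω', d i ω' ∂μ)| - τ * n / 2) ^ 2 / (τ * n) := by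
      rw [← sq_abs]
      field_simp
      ring
    rw [e]
    positivity
  have hv1 : ∫ ω, (∑ i ∈ s₁, (d i ω - ∫ ω', d i ω' ∂μ)) ^ 2 ∂μ ≤ n * (T ^ 4 * C) := by
    have h1 : ∫ ω, (∑ i ∈ s₁, (d i ω - ∫ ω', d i ω' ∂μ)) ^ 2 ∂μ = variance (∑ i ∈ s₁, d i) μ := by
      rw [variance_eq_integral (Finset.aemeasurable_sum _ fun i _ => (hd i).aemeasurable)]
      congr 1 with ω
      simp only [Finset.sum_apply]
      rw [integral_finsetSum _ fun i _ => hdi i, Finset.sum_sub_distrib]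
    rw [h1, IndepFun.variance_sum (fun i _ => hdL i) fun i _ j _ hij => hind.indepFun hij]
    calc _ ≤ ∑ i ∈ s₁, T ^ 4 * C := by
          refine Finset.sum_le_sum fun i hi => (hvar i).trans ?_
          simp only [s₁, Finset.mem_filter, not_lt] at hi
          have := hm0 i
          gcongr
          exact hi.2
      _ ≤ ∑ i ∈ Finset.range n, T ^ 4 * C :=
          Finset.sum_le_sum_of_subset_of_nonneg (Finset.filter_subset _ _)
            fun _ _ _ => by positivity
      _ = _ := by simp
  have hv2 : ∫ ω, ∑ i ∈ s₂, |d i ω - ∫ ω', d i ω' ∂μ| ∂μ ≤ n * τ / 4 := by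
    rw [integral_finsetSum _ fun i _ => (hci i).abs]
    calc _ ≤ ∑ i ∈ s₂, m i ^ 2 * (2 * C) := by
          refine Finset.sum_le_sum fun i _ => ?_
          calc ∫ ω, |d i ω - ∫ ω', d i ω' ∂μ| ∂μ ≤ ∫ ω, (|d i ω| + ∫ ω', |d i ω'| ∂μ) ∂μ := by
                refine integral_mono (hci i).abs ((hdi i).abs.add (integrable_const _)) fun ω => ?_
                refine (abs_sub _ _).trans ?_
                gcongr
                exact abs_integral_le_integral_abs
            _ = 2 * ∫ ω, |d i ω| ∂μ := by
                rw [integral_add (hdi i).abs (integrable_const _)]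
                simp
                ring
            _ ≤ _ := by have := habs i; linarith
      _ = (∑ i ∈ s₂, m i ^ 2) * (2 * C) := (Finset.sum_mul _ _ _).symm
      _ ≤ (τ / (8 * C) * n) * (2 * C) := by gcongr
      _ = _ := by field_simp; ring
  have hi1 : Integrable (fun ω => (∑ i ∈ s₁, (d i ω - ∫ ω', d i ω' ∂μ)) ^ 2 / (τ * n)) μ :=
    (memLp_finsetSum _ fun i _ => hcL i).integrable_sq.div_const _
  have hi2 : Integrable (fun ω => (∑ i ∈ s₁, (d i ω - ∫ ω', d i ω' ∂μ)) ^ 2 / (τ * n)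
      + τ * n / 4) μ := hi1.add (integrable_const _)
  have hi3 : Integrable (fun ω => ∑ i ∈ s₂, |d i ω - ∫ ω', d i ω' ∂μ|) μ :=
    integrable_finsetSum _ fun i _ => (hci i).abs
  calc _ ≤ ∫ ω, (((∑ i ∈ s₁, (d i ω - ∫ ω', d i ω' ∂μ)) ^ 2 / (τ * n) + τ * n / 4)
        + ∑ i ∈ s₂, |d i ω - ∫ ω', d i ω' ∂μ|) ∂μ :=
        integral_mono (integrable_finsetSum _ fun i _ => hci i).abs (hi2.add hi3) hsplit
    _ = (∫ ω, (∑ i ∈ s₁, (d i ω - ∫ ω', d i ω' ∂μ)) ^ 2 ∂μ) / (τ * n) + τ * n / 4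
        + ∫ ω, ∑ i ∈ s₂, |d i ω - ∫ ω', d i ω' ∂μ| ∂μ := by
        rw [integral_add hi2 hi3, integral_add hi1 (integrable_const _), integral_div]
        simp
    _ ≤ n * (T ^ 4 * C) / (τ * n) + τ * n / 4 + n * τ / 4 := by gcongr
    _ = n * (T ^ 4 * C / τ * (n : ℝ)⁻¹) + n * τ / 2 := by field_simp; ring
    _ ≤ n * (τ / 8) + n * τ / 2 := by gcongr
    _ < n * τ := by nlinarith [mul_pos hn' hτ]

end

/-! ### Roots of estimating equations: the deterministic part -/

section Roots

variable {E : Type*} [NormedAddCommGroup E] [NormedSpace ℝ E]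

/-- On the ball `G + B` has derivative of norm at most `ε`, hence is `ε`-Lipschitz. Between a root
and `θ₀` its increment is exactly `B(θ - θ₀) - G(θ₀)`. With `ε ≤ c/2` the error is absorbed into the
lower bound for `B`, which also bounds the distance of the root from `θ₀`. -/
theorem norm_apply_sub_le_of_root {G : E → E} {G' : E → E →L[ℝ] E} {B : E →L[ℝ] E} {θ₀ θ : E}
    {ρ ε c : ℝ} (hG : ∀ u ∈ Metric.ball θ₀ ρ, HasFDerivAt G (G' u) u)
    (hGB : ∀ u ∈ Metric.ball θ₀ ρ, ‖G' u + B‖ ≤ ε) (hB : ∀ v, c * ‖v‖ ≤ ‖B v‖) (hc : 0 < c)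
    (hε : ε ≤ c / 2) (hθ : θ ∈ Metric.ball θ₀ ρ) (hroot : G θ = 0) :
    ‖B (θ - θ₀) - G θ₀‖ ≤ ε * ‖θ - θ₀‖ ∧ ‖θ - θ₀‖ ≤ 2 / c * ‖G θ₀‖ := by
  have hρ : 0 < ρ := Metric.nonempty_ball.1 ⟨θ, hθ⟩
  have h1 : ‖(G θ + B θ) - (G θ₀ + B θ₀)‖ ≤ ε * ‖θ - θ₀‖ :=
    (convex_ball θ₀ ρ).norm_image_sub_le_of_norm_hasFDerivWithin_le
      (f := fun u => G u + B u) (f' := fun u => G' u + B)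
      (fun u hu => ((hG u hu).add B.hasFDerivAt).hasFDerivWithinAt) hGB
      (Metric.mem_ball_self hρ) hθ
  have h2 : (G θ + B θ) - (G θ₀ + B θ₀) = B (θ - θ₀) - G θ₀ := by
    rw [hroot, map_sub]; abel
  rw [h2] at h1
  refine ⟨h1, ?_⟩
  have h3 : ‖B (θ - θ₀)‖ ≤ ‖B (θ - θ₀) - G θ₀‖ + ‖G θ₀‖ := by
    simpa using norm_add_le (B (θ - θ₀) - G θ₀) (G θ₀)
  have h4 := hB (θ - θ₀)
  have h5 : ε * ‖θ - θ₀‖ ≤ c / 2 * ‖θ - θ₀‖ := by gcongr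
  rw [div_mul_eq_mul_div, le_div_iff₀ hc]
  linarith

theorem norm_sub_inverse_le_of_root {G : E → E} {G' : E → E →L[ℝ] E} {B Bi : E →L[ℝ] E}
    {θ₀ θ : E} {ρ ε c : ℝ} (hG : ∀ u ∈ Metric.ball θ₀ ρ, HasFDerivAt G (G' u) u)
    (hGB : ∀ u ∈ Metric.ball θ₀ ρ, ‖G' u + B‖ ≤ ε) (hB : ∀ v, c * ‖v‖ ≤ ‖B v‖) (hc : 0 < c)
    (hε : ε ≤ c / 2) (hBi : ∀ v, B (Bi v) = v) (hθ : θ ∈ Metric.ball θ₀ ρ) (hroot : G θ = 0) :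
    ‖θ - θ₀ - Bi (G θ₀)‖ ≤ 2 * ε / c ^ 2 * ‖G θ₀‖ := by
  obtain ⟨h1, h2⟩ := norm_apply_sub_le_of_root hG hGB hB hc hε hθ hroot
  have hε0 : 0 ≤ ε := (norm_nonneg _).trans (hGB θ hθ)
  have h3 := hB (θ - θ₀ - Bi (G θ₀))
  rw [map_sub, hBi] at h3
  have h4 : ε * ‖θ - θ₀‖ ≤ ε * (2 / c * ‖G θ₀‖) := by gcongr
  have e : 2 * ε / c ^ 2 * ‖G θ₀‖ = ε * (2 / c * ‖G θ₀‖) / c := by field_simp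
  rw [e, le_div_iff₀ hc]
  linarith

/-- The Newton map with frozen derivative equals `B⁻¹(G + B)`, a 1/2-contraction because `G + B` is
`c/2`-Lipschitz and `B⁻¹` has norm at most `1/c`. Smallness of `G(θ₀)` keeps the ball invariant.
Convergence of the iterates started at `θ₀` is recorded along with the root because measurability of
the root will be read off from it. -/
theorem exists_tendsto_iterate_root [CompleteSpace E] {G : E → E} {G' : E → E →L[ℝ] E}
    {B Bi : E →L[ℝ] E} {θ₀ : E} {ρ ε c : ℝ} (hρ : 0 ≤ ρ)
    (hG : ∀ u ∈ Metric.closedBall θ₀ ρ, HasFDerivAt G (G' u) u)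
    (hGB : ∀ u ∈ Metric.closedBall θ₀ ρ, ‖G' u + B‖ ≤ ε) (hB : ∀ v, c * ‖v‖ ≤ ‖B v‖)
    (hc : 0 < c) (hε : ε ≤ c / 2) (hBi : ∀ v, B (Bi v) = v) (hBi' : ∀ v, Bi (B v) = v)
    (h0 : ‖G θ₀‖ ≤ c * ρ / 2) :
    Set.MapsTo (fun u => u + Bi (G u)) (Metric.closedBall θ₀ ρ) (Metric.closedBall θ₀ ρ) ∧
    ∃ θ ∈ Metric.closedBall θ₀ ρ, G θ = 0 ∧
      Tendsto (fun k => (fun u => u + Bi (G u))^[k] θ₀) atTop (𝓝 θ) := by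
  have hBin : ∀ v, ‖Bi v‖ ≤ c⁻¹ * ‖v‖ := fun v => by
    have := hB (Bi v)
    rw [hBi] at this
    rwa [← div_eq_inv_mul, le_div_iff₀ hc, mul_comm]
  have hlip : ∀ u ∈ Metric.closedBall θ₀ ρ, ∀ v ∈ Metric.closedBall θ₀ ρ,
      ‖(u + Bi (G u)) - (v + Bi (G v))‖ ≤ 1 / 2 * ‖u - v‖ := by
    intro u hu v hv
    have h1 : ‖(G u + B u) - (G v + B v)‖ ≤ ε * ‖u - v‖ :=
      (convex_closedBall θ₀ ρ).norm_image_sub_le_of_norm_hasFDerivWithin_le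
        (f := fun u => G u + B u) (f' := fun u => G' u + B)
        (fun w hw => ((hG w hw).add B.hasFDerivAt).hasFDerivWithinAt) hGB hv hu
    have e : (u + Bi (G u)) - (v + Bi (G v)) = Bi ((G u + B u) - (G v + B v)) := by
      simp only [map_sub, map_add, hBi']; abel
    rw [e]
    calc _ ≤ c⁻¹ * (ε * ‖u - v‖) := (hBin _).trans (by gcongr)
      _ ≤ c⁻¹ * (c / 2 * ‖u - v‖) := by gcongr
      _ = _ := by field_simp
  have hmem0 : θ₀ ∈ Metric.closedBall θ₀ ρ := Metric.mem_closedBall_self hρ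
  have hmaps : Set.MapsTo (fun u => u + Bi (G u)) (Metric.closedBall θ₀ ρ)
      (Metric.closedBall θ₀ ρ) := by
    intro u hu
    rw [mem_closedBall_iff_norm] at hu ⊢
    have h1 := hlip u (mem_closedBall_iff_norm.2 hu) θ₀ hmem0
    have h2 : ‖Bi (G θ₀)‖ ≤ ρ / 2 := by
      refine (hBin _).trans ?_
      calc c⁻¹ * ‖G θ₀‖ ≤ c⁻¹ * (c * ρ / 2) := by gcongr
        _ = _ := by field_simp
    have e : u + Bi (G u) - θ₀ = ((u + Bi (G u)) - (θ₀ + Bi (G θ₀))) + Bi (G θ₀) := by abel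
    dsimp only
    rw [e]
    refine (norm_add_le _ _).trans ?_
    linarith
  refine ⟨hmaps, ?_⟩
  have hcontr : ContractingWith (1 / 2) (hmaps.restrict _ _ _) := by
    refine ⟨by norm_num, LipschitzWith.of_dist_le_mul fun u v => ?_⟩
    simpa [Subtype.dist_eq, dist_eq_norm] using hlip u u.2 v v.2
  obtain ⟨θ, hθ, hfix, hlim, -⟩ := hcontr.exists_fixedPoint'
    (Metric.isClosed_closedBall.isComplete) hmaps hmem0 (edist_ne_top _ _)
  refine ⟨θ, hθ, ?_, hlim⟩
  have h1 : Bi (G θ) = 0 := by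
    have : θ + Bi (G θ) = θ := hfix
    simpa using this
  rw [← hBi (G θ), h1, map_zero]

variable {Ω : Type*} [MeasurableSpace Ω] [MeasurableSpace E] [BorelSpace E]

/-- A root of a random equation, obtained as the limit of Newton-type iterations with a fixed
matrix, can be chosen measurably. -/
theorem exists_measurable_root [FiniteDimensional ℝ E] {G : Ω → E → E} {G' : Ω → E → E →L[ℝ] E}
    {B Bi : E →L[ℝ] E} {θ₀ : E} {ρ ε c : ℝ} (hρ : 0 ≤ ρ)
    (hmeas : ∀ u ∈ Metric.closedBall θ₀ ρ, Measurable fun ω => G ω u)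
    (hG : ∀ ω, ∀ u ∈ Metric.closedBall θ₀ ρ, HasFDerivAt (G ω) (G' ω u) u)
    (hB : ∀ v, c * ‖v‖ ≤ ‖B v‖) (hc : 0 < c) (hε : ε ≤ c / 2) (hBi : ∀ v, B (Bi v) = v)
    (hBi' : ∀ v, Bi (B v) = v) :
    ∃ est : Ω → E, Measurable est ∧ ∀ ω, (∀ u ∈ Metric.closedBall θ₀ ρ, ‖G' ω u + B‖ ≤ ε) →
      ‖G ω θ₀‖ ≤ c * ρ / 2 → est ω ∈ Metric.closedBall θ₀ ρ ∧ G ω (est ω) = 0 := by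
  classical
  have := FiniteDimensional.complete ℝ E
  have := FiniteDimensional.proper ℝ E
  let K := Metric.closedBall θ₀ ρ
  let z : K := ⟨θ₀, Metric.mem_closedBall_self hρ⟩
  -- The iteration is run for every `ω`, including those where the map is no contraction. Points
  -- leaving the ball are sent back to `θ₀`, which keeps all iterates measurable and changes nothing
  -- on the good event.
  let ret : E → K := fun u => ⟨if u ∈ K then u else θ₀, by
    split_ifs with h
    exacts [h, z.2]⟩
  have hret : Measurable ret := Measurable.subtype_mk
    (Measurable.ite Metric.isClosed_closedBall.measurableSet measurable_id measurable_const)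
  -- Carathéodory: continuity in the parameter and measurability in `ω` give joint measurability.
  have hunc : Measurable (Function.uncurry fun (u : K) ω => G ω u) := by
    refine measurable_uncurry_of_continuous_of_measurable (fun ω => ?_) fun u => hmeas u u.2
    refine continuous_iff_continuousAt.2 fun u => ?_
    exact ContinuousAt.comp (g := G ω) (hG ω u u.2).continuousAt continuous_subtype_val.continuousAt
  obtain ⟨it, it_zero, it_succ⟩ : ∃ it : ℕ → Ω → K, (∀ ω, it 0 ω = z) ∧
      ∀ k ω, it (k + 1) ω = ret (it k ω + Bi (G ω (it k ω))) :=
    ⟨fun k => Nat.rec (fun _ => z) (fun _ q ω => ret (q ω + Bi (G ω (q ω)))) k,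
      fun _ => rfl, fun _ _ => rfl⟩
  have hit : ∀ k, Measurable (it k) := by
    intro k
    induction k with
    | zero => rw [show it 0 = fun _ => z from funext it_zero]; exact measurable_const
    | succ k ih =>
      have h1 : Measurable fun ω => G ω (it k ω : E) := hunc.comp (ih.prodMk measurable_id)
      rw [funext (it_succ k)]
      exact hret.comp (ih.subtype_val.add (Bi.continuous.measurable.comp h1))
  have : Nonempty E := ⟨θ₀⟩
  -- `limUnder` is measurable whether or not the iterates converge; off the good event its value is
  -- irrelevant.
  refine ⟨fun ω => limUnder atTop fun k => (it k ω : E), (StronglyMeasurable.limUnder fun k =>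
    (hit k).subtype_val.stronglyMeasurable).measurable, fun ω h1 h2 => ?_⟩
  obtain ⟨hmaps, θ, hθ, hroot, ht⟩ :=
    exists_tendsto_iterate_root hρ (hG ω) h1 hB hc hε hBi hBi' h2
  have hiter : ∀ k, (it k ω : E) = (fun u => u + Bi (G ω u))^[k] θ₀ := by
    intro k
    induction k with
    | zero => rw [it_zero]; rfl
    | succ k ih =>
      have hm : (it k ω : E) + Bi (G ω (it k ω)) ∈ K := hmaps (it k ω).2
      rw [Function.iterate_succ_apply', ← ih, it_succ]
      simp only [ret, hm, if_true]
  have hl : (limUnder atTop fun k => (it k ω : E)) = θ :=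
    Tendsto.limUnder_eq (by simpa only [hiter] using ht)
  dsimp only
  rw [hl]
  exact ⟨hθ, hroot⟩

end Roots

/-! ### Estimating equations given by sums of independent terms -/

section Aux

variable {Ω : Type*} [MeasurableSpace Ω] {μ : Measure Ω}

theorem tendsto_measure_zero_of_subset_union {S A B : ℕ → Set Ω}
    (hA : Tendsto (fun n => μ (A n)) atTop (𝓝 0)) (hB : Tendsto (fun n => μ (B n)) atTop (𝓝 0))
    (h : ∀ᶠ n in atTop, S n ⊆ A n ∪ B n) : Tendsto (fun n => μ (S n)) atTop (𝓝 0) := by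
  have hAB : Tendsto (fun n => μ (A n) + μ (B n)) atTop (𝓝 0) := by simpa using hA.add hB
  refine tendsto_of_tendsto_of_tendsto_of_le_of_le' tendsto_const_nhds hAB
    (Eventually.of_forall fun n => zero_le) ?_
  filter_upwards [h] with n hn using (measure_mono hn).trans (measure_union_le _ _)

theorem tendsto_measure_zero_of_subset {S A : ℕ → Set Ω}
    (hA : Tendsto (fun n => μ (A n)) atTop (𝓝 0)) (h : ∀ᶠ n in atTop, S n ⊆ A n) :
    Tendsto (fun n => μ (S n)) atTop (𝓝 0) :=
  tendsto_measure_zero_of_subset_union hA hA (h.mono fun _ hn => by simpa using hn)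

theorem measure_ge_le_ofReal_integral_div [IsFiniteMeasure μ] {X : Ω → ℝ} (h0 : ∀ ω, 0 ≤ X ω)
    (hi : Integrable X μ) {ε : ℝ} (hε : 0 < ε) :
    μ {ω | ε ≤ X ω} ≤ ENNReal.ofReal ((∫ ω, X ω ∂μ) / ε) := by
  rw [← ofReal_measureReal]
  refine ENNReal.ofReal_le_ofReal ?_
  rw [le_div_iff₀ hε, mul_comm]
  exact mul_meas_ge_le_integral_of_nonneg (ae_of_all _ h0) hi ε

theorem tendsto_measure_ge_of_tendsto_integral [IsFiniteMeasure μ] {X : ℕ → Ω → ℝ}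
    (h0 : ∀ n ω, 0 ≤ X n ω) (hi : ∀ n, Integrable (X n) μ)
    (h : Tendsto (fun n => ∫ ω, X n ω ∂μ) atTop (𝓝 0)) {ε : ℝ} (hε : 0 < ε) :
    Tendsto (fun n => μ {ω | ε ≤ X n ω}) atTop (𝓝 0) := by
  have h1 : Tendsto (fun n => ENNReal.ofReal ((∫ ω, X n ω ∂μ) / ε)) atTop (𝓝 0) := by
    have := ENNReal.tendsto_ofReal (h.div_const ε)
    simpa using this
  exact tendsto_of_tendsto_of_tendsto_of_le_of_le tendsto_const_nhds h1 (fun n => zero_le)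
    fun n => measure_ge_le_ofReal_integral_div (h0 n) (hi n) hε

end Aux

/-! ### Coordinates of Euclidean vectors, operators and matrices. -/

section Euclid

variable {ι : Type*} [Fintype ι] [DecidableEq ι]

theorem euclidean_eq_sum_single (v : EuclideanSpace ℝ ι) :
    v = ∑ b, v b • EuclideanSpace.single b (1 : ℝ) := by
  ext a
  simp [Finset.sum_apply, Pi.single_apply]

theorem norm_euclidean_le_sum (v : EuclideanSpace ℝ ι) : ‖v‖ ≤ ∑ a, |v a| := by
  calc ‖v‖ = ‖∑ b, v b • EuclideanSpace.single b (1 : ℝ)‖ := by rw [← euclidean_eq_sum_single]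
    _ ≤ ∑ b, ‖v b • EuclideanSpace.single b (1 : ℝ)‖ := norm_sum_le _ _
    _ = ∑ a, |v a| := by simp [norm_smul]

theorem abs_apply_le_norm (v : EuclideanSpace ℝ ι) (a : ι) : |v a| ≤ ‖v‖ := by
  simpa using PiLp.norm_apply_le v a

theorem norm_clm_le_sum_entries (M : EuclideanSpace ℝ ι →L[ℝ] EuclideanSpace ℝ ι) :
    ‖M‖ ≤ ∑ b, ∑ a, |M (EuclideanSpace.single b 1) a| := by
  refine M.opNorm_le_bound (by positivity) fun v => ?_
  calc ‖M v‖ = ‖∑ b, v b • M (EuclideanSpace.single b (1 : ℝ))‖ := by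
        conv_lhs => rw [euclidean_eq_sum_single v]
        simp
    _ ≤ ∑ b, ‖v b • M (EuclideanSpace.single b (1 : ℝ))‖ := norm_sum_le _ _
    _ ≤ ∑ b, (∑ a, |M (EuclideanSpace.single b 1) a|) * ‖v‖ := by
        refine Finset.sum_le_sum fun b _ => ?_
        rw [norm_smul, mul_comm, Real.norm_eq_abs]
        gcongr
        · exact norm_euclidean_le_sum _
        · exact abs_apply_le_norm v b
    _ = _ := (Finset.sum_mul _ _ _).symm

theorem toEuclideanCLM_single (A : Matrix ι ι ℝ) (a b : ι) :
    Matrix.toEuclideanCLM (𝕜 := ℝ) A (EuclideanSpace.single b 1) a = A a b := by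
  simp [Matrix.ofLp_toEuclideanCLM]

theorem toEuclideanCLM_of_entries (M : EuclideanSpace ℝ ι →L[ℝ] EuclideanSpace ℝ ι) :
    Matrix.toEuclideanCLM (𝕜 := ℝ) (Matrix.of fun a b => M (EuclideanSpace.single b 1) a) = M := by
  refine ContinuousLinearMap.ext fun v => ?_
  rw [euclidean_eq_sum_single v]
  simp only [map_sum, map_smul]
  refine Finset.sum_congr rfl fun b _ => ?_
  congr 1
  ext a
  rw [toEuclideanCLM_single, Matrix.of_apply]

theorem norm_single_one (b : ι) : ‖(EuclideanSpace.single b (1 : ℝ) : EuclideanSpace ℝ ι)‖ = 1 := by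
  simp

end Euclid

/-- Regularity of the terms `ψ_i(y, θ)` of an estimating equation near the true parameter `θ₀`:
they have derivatives `D_i(y, θ)`, the terms are centred and independent, `-E D_i = A_i` is
symmetric and positive definite on average, and all is dominated by `m_i R_i`, `m_i² R_i`, where the
averages of `m_i²` and the random variables `R_i²` are uniformly integrable. -/
structure RegularScore {Ω : Type*} [MeasurableSpace Ω] {ι : Type*} [Fintype ι] [DecidableEq ι]
    (μ : Measure Ω) (Y : ℕ → Ω → ℝ) (ψ : ℕ → ℝ → EuclideanSpace ℝ ι → EuclideanSpace ℝ ι)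
    (D : ℕ → ℝ → EuclideanSpace ℝ ι → EuclideanSpace ℝ ι →L[ℝ] EuclideanSpace ℝ ι)
    (A : ℕ → Matrix ι ι ℝ) (R : ℕ → ℝ → ℝ) (m : ℕ → ℝ) (θ₀ : EuclideanSpace ℝ ι) (r : ℝ) :
    Prop where
  r_pos : 0 < r
  meas : ∀ i, Measurable (Y i)
  indep : iIndepFun Y μ
  hasFDerivAt : ∀ i y, ∀ θ ∈ Metric.ball θ₀ r, HasFDerivAt (ψ i y) (D i y θ) θ
  meas_score : ∀ i, ∀ θ ∈ Metric.ball θ₀ r, Measurable fun y => ψ i y θ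
  meas_dom : ∀ i, Measurable (R i)
  meas_deriv : ∀ i v, Measurable fun y => D i y θ₀ v
  m_nonneg : ∀ i, 0 ≤ m i
  avg : AvgUnifInt m
  unif : UnifSqInt μ fun i ω => R i (Y i ω)
  score_le : ∀ i y, ‖ψ i y θ₀‖ ≤ m i * R i y
  deriv_le : ∀ i y, ‖D i y θ₀‖ ≤ m i ^ 2 * R i y
  equicont : ∀ ε > 0, ∃ ρ > 0, ∃ w : ℕ → ℝ, (∀ i, 0 ≤ w i ∧ w i ≤ m i ^ 2) ∧
    (∀ i y, ∀ θ ∈ Metric.ball θ₀ ρ, ‖D i y θ - D i y θ₀‖ ≤ w i * R i y) ∧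
    ∀ᶠ n : ℕ in atTop, ∑ i ∈ Finset.range n, w i ≤ ε * n
  mean_score : ∀ i, ∫ ω, ψ i (Y i ω) θ₀ ∂μ = 0
  mean_deriv : ∀ i a b, ∫ ω, D i (Y i ω) θ₀ (EuclideanSpace.single b 1) a ∂μ = -A i a b
  symm : ∀ i, (A i).transpose = A i
  pos : ∃ c > 0, ∀ᶠ n : ℕ in atTop, ∀ v : EuclideanSpace ℝ ι,
    c * n * ‖v‖ ^ 2 ≤ ∑ i ∈ Finset.range n, v ⬝ᵥ (A i).mulVec v

/-- `H_n` is `n^{-1/2}` times the sum of the terms `ψ_i`, near `θ₀`. -/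
def IsScoreSum {Ω : Type*} {ι : Type*} [Fintype ι]
    (Y : ℕ → Ω → ℝ) (ψ : ℕ → ℝ → EuclideanSpace ℝ ι → EuclideanSpace ℝ ι)
    (θ₀ : EuclideanSpace ℝ ι) (r : ℝ) (H : ℕ → Ω → EuclideanSpace ℝ ι → EuclideanSpace ℝ ι) :
    Prop :=
  ∀ n ω, ∀ θ ∈ Metric.ball θ₀ r, H n ω θ = (√n)⁻¹ • ∑ i ∈ Finset.range n, ψ i (Y i ω) θ

/-- The average `n⁻¹ ∑ A_i`. -/
def avgInfo {ι : Type*} (A : ℕ → Matrix ι ι ℝ) (n : ℕ) : Matrix ι ι ℝ :=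
  (n : ℝ)⁻¹ • ∑ i ∈ Finset.range n, A i

namespace RegularScore

variable {Ω : Type*} [MeasurableSpace Ω] {ι : Type*} [Fintype ι] [DecidableEq ι]
  {μ : Measure Ω} [IsProbabilityMeasure μ] {Y : ℕ → Ω → ℝ}
  {ψ : ℕ → ℝ → EuclideanSpace ℝ ι → EuclideanSpace ℝ ι}
  {D : ℕ → ℝ → EuclideanSpace ℝ ι → EuclideanSpace ℝ ι →L[ℝ] EuclideanSpace ℝ ι}
  {A : ℕ → Matrix ι ι ℝ} {R : ℕ → ℝ → ℝ} {m : ℕ → ℝ} {θ₀ : EuclideanSpace ℝ ι} {r : ℝ}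
  {H : ℕ → Ω → EuclideanSpace ℝ ι → EuclideanSpace ℝ ι}

/-! ### Measurability and moments of the terms and their derivatives. -/

section Moments

theorem measurable_score (h : RegularScore μ Y ψ D A R m θ₀ r) (i : ℕ) :
    Measurable fun ω => ψ i (Y i ω) θ₀ :=
  (h.meas_score i θ₀ (Metric.mem_ball_self h.r_pos)).comp (h.meas i)

theorem measurable_deriv_entry (h : RegularScore μ Y ψ D A R m θ₀ r) (i : ℕ) (a b : ι) :
    Measurable fun y => D i y θ₀ (EuclideanSpace.single b 1) a := by
  have h1 : Measurable fun v : EuclideanSpace ℝ ι => v a := by fun_prop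
  exact h1.comp (h.meas_deriv i _)

theorem memLp_score (h : RegularScore μ Y ψ D A R m θ₀ r) (i : ℕ) :
    MemLp (fun ω => ψ i (Y i ω) θ₀) 2 μ :=
  ((h.unif.memLp i).const_mul (m i)).mono (h.measurable_score i).aestronglyMeasurable
    (ae_of_all _ fun _ => (h.score_le i _).trans (le_abs_self _))

theorem memLp_score_apply (h : RegularScore μ Y ψ D A R m θ₀ r) (i : ℕ) (a : ι) :
    MemLp (fun ω => ψ i (Y i ω) θ₀ a) 2 μ :=
  (h.memLp_score i).mono ((by fun_prop : Measurable fun v : EuclideanSpace ℝ ι => v a).comp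
    (h.measurable_score i)).aestronglyMeasurable (ae_of_all _ fun _ => PiLp.norm_apply_le _ _)

theorem memLp_inner_score (h : RegularScore μ Y ψ D A R m θ₀ r) (i : ℕ)
    (t : EuclideanSpace ℝ ι) : MemLp (fun ω => inner ℝ (ψ i (Y i ω) θ₀) t) 2 μ :=
  (h.memLp_score i).inner_const t

theorem abs_deriv_entry_le (h : RegularScore μ Y ψ D A R m θ₀ r) (i : ℕ) (y : ℝ) (a b : ι) :
    |D i y θ₀ (EuclideanSpace.single b 1) a| ≤ m i ^ 2 * R i y := by
  refine (abs_apply_le_norm _ a).trans (((D i y θ₀).le_opNorm _).trans ?_)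
  rw [norm_single_one, mul_one]
  exact h.deriv_le i y

theorem integrable_deriv_entry (h : RegularScore μ Y ψ D A R m θ₀ r) (i : ℕ) (a b : ι) :
    Integrable (fun ω => D i (Y i ω) θ₀ (EuclideanSpace.single b 1) a) μ :=
  ((h.unif.integrable i).const_mul (m i ^ 2)).mono
    ((h.measurable_deriv_entry i a b).comp (h.meas i)).aestronglyMeasurable
    (ae_of_all _ fun ω => by
      rw [Real.norm_eq_abs, Real.norm_eq_abs]
      exact (h.abs_deriv_entry_le i _ a b).trans (le_abs_self _))

theorem integral_inner_score (h : RegularScore μ Y ψ D A R m θ₀ r) (i : ℕ)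
    (t : EuclideanSpace ℝ ι) : ∫ ω, inner ℝ (ψ i (Y i ω) θ₀) t ∂μ = 0 := by
  have hi : Integrable (fun ω => ψ i (Y i ω) θ₀) μ := (h.memLp_score i).integrable (by norm_num)
  simp_rw [real_inner_comm t]
  rw [integral_inner hi, h.mean_score, inner_zero_right]

end Moments

/-! ### Jacobian, expected Jacobian and covariance of the estimating function. -/

section Deriv

theorem hasFDerivAt_sum (h : RegularScore μ Y ψ D A R m θ₀ r) (n : ℕ) (ω : Ω)
    {θ : EuclideanSpace ℝ ι} (hθ : θ ∈ Metric.ball θ₀ r) :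
    HasFDerivAt (fun u => ∑ i ∈ Finset.range n, ψ i (Y i ω) u)
      (∑ i ∈ Finset.range n, D i (Y i ω) θ) θ :=
  HasFDerivAt.fun_sum fun i _ => h.hasFDerivAt i _ θ hθ

theorem hasFDerivAt_scoreSum (h : RegularScore μ Y ψ D A R m θ₀ r)
    (hH : IsScoreSum Y ψ θ₀ r H) (n : ℕ) (ω : Ω) :
    HasFDerivAt (H n ω) ((√n)⁻¹ • ∑ i ∈ Finset.range n, D i (Y i ω) θ₀) θ₀ := by
  refine ((h.hasFDerivAt_sum n ω (Metric.mem_ball_self h.r_pos)).const_smul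
    (√n)⁻¹).congr_of_eventuallyEq ?_
  filter_upwards [Metric.ball_mem_nhds θ₀ h.r_pos] with θ hθ using hH n ω θ hθ

theorem jac_scoreSum (h : RegularScore μ Y ψ D A R m θ₀ r) (hH : IsScoreSum Y ψ θ₀ r H) (n : ℕ)
    (ω : Ω) (a b : ι) : jac (H n ω) θ₀ a b =
      (√n)⁻¹ * ∑ i ∈ Finset.range n, D i (Y i ω) θ₀ (EuclideanSpace.single b 1) a := by
  rw [jac, Matrix.of_apply, (h.hasFDerivAt_scoreSum hH n ω).fderiv]
  simp

theorem integrable_jac (h : RegularScore μ Y ψ D A R m θ₀ r) (hH : IsScoreSum Y ψ θ₀ r H) (n : ℕ)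
    (a b : ι) : Integrable (fun ω => jac (H n ω) θ₀ a b) μ := by
  simp_rw [h.jac_scoreSum hH]
  exact (integrable_finsetSum _ fun i _ => h.integrable_deriv_entry i a b).const_mul _

theorem meanNegJac_eq (h : RegularScore μ Y ψ D A R m θ₀ r) (hH : IsScoreSum Y ψ θ₀ r H) (n : ℕ) :
    meanNegJac μ (H n) θ₀ = (√n)⁻¹ • ∑ i ∈ Finset.range n, A i := by
  ext a b
  simp only [meanNegJac, meanMat, Matrix.of_apply, Matrix.neg_apply, h.jac_scoreSum hH]
  rw [integral_neg, integral_const_mul, integral_finsetSum _ fun i _ =>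
    h.integrable_deriv_entry i a b]
  simp [h.mean_deriv, Matrix.sum_apply]

theorem memLp_scoreSum (h : RegularScore μ Y ψ D A R m θ₀ r) (hH : IsScoreSum Y ψ θ₀ r H) (n : ℕ) :
    MemLp (fun ω => H n ω θ₀) 2 μ := by
  simp_rw [fun n ω => hH n ω θ₀ (Metric.mem_ball_self h.r_pos)]
  exact (memLp_finsetSum _ fun i _ => h.memLp_score i).const_smul ((√(n : ℝ))⁻¹)

theorem varMat_eq (h : RegularScore μ Y ψ D A R m θ₀ r) (hH : IsScoreSum Y ψ θ₀ r H) (n : ℕ) :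
    varMat μ (fun ω => H n ω θ₀)
      = (n : ℝ)⁻¹ • ∑ i ∈ Finset.range n, varMat μ fun ω => ψ i (Y i ω) θ₀ := by
  ext a b
  simp only [varMat, Matrix.of_apply, Matrix.smul_apply, Matrix.sum_apply, smul_eq_mul]
  simp_rw [fun n ω => hH n ω θ₀ (Metric.mem_ball_self h.r_pos)]
  have e : ∀ (ω : Ω) (a : ι), ((√n)⁻¹ • ∑ i ∈ Finset.range n, ψ i (Y i ω) θ₀) a
      = (√n)⁻¹ * ∑ i ∈ Finset.range n, ψ i (Y i ω) θ₀ a := by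
    intro ω a
    simp
  simp_rw [e]
  rw [covariance_const_mul_left, covariance_const_mul_right,
    covariance_fun_sum_fun_sum' (fun i _ => h.memLp_score_apply i a)
      (fun i _ => h.memLp_score_apply i b), ← mul_assoc, ← mul_inv,
    Real.mul_self_sqrt (Nat.cast_nonneg n)]
  congr 1
  refine Finset.sum_congr rfl fun i hi => ?_
  rw [Finset.sum_eq_single_of_mem i hi]
  intro j _ hij
  have hc : ∀ (i : ℕ) (a : ι), Measurable fun y => ψ i y θ₀ a := fun i a =>
    (by fun_prop : Measurable fun v : EuclideanSpace ℝ ι => v a).comp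
      (h.meas_score i θ₀ (Metric.mem_ball_self h.r_pos))
  have hind : IndepFun (fun ω => ψ i (Y i ω) θ₀ a) (fun ω => ψ j (Y j ω) θ₀ b) μ :=
    (h.indep.indepFun hij.symm).comp (hc i a) (hc j b)
  exact hind.covariance_eq_zero (h.memLp_score_apply i a) (h.memLp_score_apply j b)

end Deriv

/-! ### The average information and uniform closeness of the derivative to it. -/

section Info

/-- Cauchy–Schwarz turns coercivity of the quadratic form into a lower bound for the operator. This
is the form of invertibility that survives small perturbations with a uniform constant. -/
theorem exists_lower_bound (h : RegularScore μ Y ψ D A R m θ₀ r) :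
    ∃ c > 0, ∀ᶠ n : ℕ in atTop, ∀ v : EuclideanSpace ℝ ι,
      c * ‖v‖ ≤ ‖Matrix.toEuclideanCLM (𝕜 := ℝ) (avgInfo A n) v‖ := by
  obtain ⟨c, hc, h1⟩ := h.pos
  refine ⟨c, hc, ?_⟩
  filter_upwards [h1, eventually_gt_atTop 0] with n hn hn0 v
  have hn' : (0 : ℝ) < n := by exact_mod_cast hn0
  have h2 : inner ℝ v (Matrix.toEuclideanCLM (𝕜 := ℝ) (avgInfo A n) v)
      = (n : ℝ)⁻¹ * ∑ i ∈ Finset.range n, v ⬝ᵥ (A i).mulVec v := by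
    rw [Matrix.inner_toEuclideanCLM, avgInfo, Matrix.smul_mulVec, Matrix.sum_mulVec,
      dotProduct_smul, dotProduct_sum, smul_eq_mul]
  have h3 : c * ‖v‖ ^ 2 ≤ inner ℝ v (Matrix.toEuclideanCLM (𝕜 := ℝ) (avgInfo A n) v) := by
    rw [h2, ← div_eq_inv_mul, le_div_iff₀ hn']
    linarith [hn v]
  have h4 := h3.trans (real_inner_le_norm _ _)
  rcases (norm_nonneg v).eq_or_lt with h0 | h0
  · rw [← h0, mul_zero]; exact norm_nonneg _
  · refine le_of_mul_le_mul_left ?_ h0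
    linarith

theorem isUnit_det_of_lower_bound {M : Matrix ι ι ℝ} {c : ℝ} (hc : 0 < c)
    (h : ∀ v : EuclideanSpace ℝ ι, c * ‖v‖ ≤ ‖Matrix.toEuclideanCLM (𝕜 := ℝ) M v‖) :
    IsUnit M.det := by
  rw [isUnit_iff_ne_zero]
  intro h0
  obtain ⟨v, hv, hMv⟩ := Matrix.exists_mulVec_eq_zero_iff.2 h0
  have := h (WithLp.toLp 2 v)
  rw [Matrix.toEuclideanCLM_toLp, hMv, WithLp.toLp_zero, norm_zero] at this
  have h2 : ‖(WithLp.toLp 2 v : EuclideanSpace ℝ ι)‖ = 0 := by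
    refine le_antisymm ?_ (norm_nonneg _)
    by_contra h3
    push Not at h3
    have := mul_pos hc h3
    linarith
  rw [norm_eq_zero] at h2
  exact hv (by simpa using congrArg WithLp.ofLp h2)

theorem avgInfo_transpose (h : RegularScore μ Y ψ D A R m θ₀ r) (n : ℕ) :
    (avgInfo A n).transpose = avgInfo A n := by
  simp [avgInfo, Matrix.transpose_sum, h.symm]

/-- Near `θ₀` the derivative of the estimating equation is close to its expectation at `θ₀`,
uniformly, with probability tending to one. -/
theorem tendsto_measure_deriv_far (h : RegularScore μ Y ψ D A R m θ₀ r) {ε : ℝ} (hε : 0 < ε) :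
    ∃ ρ > 0, ρ ≤ r ∧ Tendsto (fun n : ℕ => μ {ω | ∃ u ∈ Metric.ball θ₀ ρ,
      ε < ‖(n : ℝ)⁻¹ • ∑ i ∈ Finset.range n, D i (Y i ω) u
        + Matrix.toEuclideanCLM (𝕜 := ℝ) (avgInfo A n)‖}) atTop (𝓝 0) := by
  obtain ⟨C, hC0, -, hC1⟩ := h.unif.exists_integral_le'
  -- As `E R_i ≤ C`, the average of `w_i E R_i` is then at most `ε/2`; the other half of `ε` is left
  -- for random fluctuations.
  obtain ⟨ρ, hρ, w, hw, hDw, hwn⟩ := h.equicont (ε / (2 * C)) (by positivity)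
  refine ⟨min ρ r, lt_min hρ h.r_pos, min_le_right _ _, ?_⟩
  have hwR : ∀ i, Integrable (fun ω => w i * R i (Y i ω)) μ := fun i =>
    (h.unif.integrable i).const_mul _
  -- The weak law is used twice: for the moduli `w_i R_i`, which it covers because `w_i ≤ m_i²`, and
  -- for each entry of the derivative at `θ₀`. The supremum over the ball is thereby dominated by
  -- finitely many averages.
  have hlim1 := tendsto_inv_mul_integral_abs_sum_sub h.m_nonneg h.avg h.unif
    (d := fun i ω => w i * R i (Y i ω)) (fun i => ((h.meas_dom i).comp (h.meas i)).const_mul _)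
    (h.indep.comp (fun i y => w i * R i y) fun i => (h.meas_dom i).const_mul _) fun i ω => by
      rw [abs_of_nonneg (mul_nonneg (hw i).1 (h.unif.nonneg i ω))]
      exact mul_le_mul_of_nonneg_right (hw i).2 (h.unif.nonneg i ω)
  have hlim2 := fun a b => tendsto_inv_mul_integral_abs_sum_sub h.m_nonneg h.avg h.unif
    (d := fun i ω => D i (Y i ω) θ₀ (EuclideanSpace.single b 1) a)
    (fun i => (h.measurable_deriv_entry i a b).comp (h.meas i))
    (h.indep.comp (fun i y => D i y θ₀ (EuclideanSpace.single b 1) a) fun i =>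
      h.measurable_deriv_entry i a b) fun i ω => h.abs_deriv_entry_le i _ a b
  let X₁ : ℕ → Ω → ℝ := fun n ω =>
    (n : ℝ)⁻¹ * |∑ i ∈ Finset.range n, (w i * R i (Y i ω) - ∫ ω', w i * R i (Y i ω') ∂μ)|
  let X₂ : ι → ι → ℕ → Ω → ℝ := fun a b n ω =>
    (n : ℝ)⁻¹ * |∑ i ∈ Finset.range n, (D i (Y i ω) θ₀ (EuclideanSpace.single b 1) a
        - ∫ ω', D i (Y i ω') θ₀ (EuclideanSpace.single b 1) a ∂μ)|
  have hX₁ : ∀ n, Integrable (X₁ n) μ := fun n =>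
    (integrable_finsetSum _ fun i _ => (hwR i).sub (integrable_const _)).abs.const_mul _
  have hX₂ : ∀ a b n, Integrable (X₂ a b n) μ := fun a b n =>
    (integrable_finsetSum _ fun i _ =>
      (h.integrable_deriv_entry i a b).sub (integrable_const _)).abs.const_mul _
  have hX₂' : ∀ n, Integrable (fun ω => ∑ b, ∑ a, X₂ a b n ω) μ := fun n =>
    integrable_finsetSum _ fun b _ => integrable_finsetSum _ fun a _ => hX₂ a b n
  have hX : Tendsto (fun n => ∫ ω, (X₁ n ω + ∑ b, ∑ a, X₂ a b n ω) ∂μ) atTop (𝓝 0) := by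
    have e : ∀ n, ∫ ω, (X₁ n ω + ∑ b, ∑ a, X₂ a b n ω) ∂μ
        = ∫ ω, X₁ n ω ∂μ + ∑ b, ∑ a, ∫ ω, X₂ a b n ω ∂μ := by
      intro n
      rw [integral_add (hX₁ n) (hX₂' n), integral_finsetSum _ fun b _ =>
        integrable_finsetSum _ fun a _ => hX₂ a b n]
      congr 1
      exact Finset.sum_congr rfl fun b _ => integral_finsetSum _ fun a _ => hX₂ a b n
    simp_rw [e]
    have h0 : (0 : ℝ) = 0 + ∑ _b : ι, ∑ _a : ι, (0 : ℝ) := by simp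
    rw [h0]
    refine Tendsto.add ?_ (tendsto_finsetSum _ fun b _ => tendsto_finsetSum _ fun a _ => ?_)
    · simpa only [X₁, integral_const_mul] using hlim1
    · simpa only [X₂, integral_const_mul] using hlim2 a b
  refine tendsto_measure_zero_of_subset (tendsto_measure_ge_of_tendsto_integral
    (fun n ω => add_nonneg (mul_nonneg (by positivity) (abs_nonneg _)) (Finset.sum_nonneg
      fun b _ => Finset.sum_nonneg fun a _ => mul_nonneg (by positivity) (abs_nonneg _))) (fun n => (hX₁ n).add (hX₂' n)) hX
    (half_pos hε)) ?_
  filter_upwards [hwn, eventually_gt_atTop 0] with n hn hn0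
  have hn' : (0 : ℝ) < n := by exact_mod_cast hn0
  rintro ω ⟨u, hu, hεu⟩
  have hu' : u ∈ Metric.ball θ₀ ρ := Metric.ball_subset_ball (min_le_left _ _) hu
  have h1 : ‖(n : ℝ)⁻¹ • ∑ i ∈ Finset.range n, (D i (Y i ω) u - D i (Y i ω) θ₀)‖
      ≤ X₁ n ω + ε / 2 := by
    rw [norm_smul, norm_inv, Real.norm_natCast]
    have h2 : ‖∑ i ∈ Finset.range n, (D i (Y i ω) u - D i (Y i ω) θ₀)‖
        ≤ |∑ i ∈ Finset.range n, (w i * R i (Y i ω) - ∫ ω', w i * R i (Y i ω') ∂μ)|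
          + n * (ε / 2) := by
      calc _ ≤ ∑ i ∈ Finset.range n, w i * R i (Y i ω) :=
            (norm_sum_le _ _).trans (Finset.sum_le_sum fun i _ => hDw i _ u hu')
        _ = ∑ i ∈ Finset.range n, (w i * R i (Y i ω) - ∫ ω', w i * R i (Y i ω') ∂μ)
            + ∑ i ∈ Finset.range n, w i * ∫ ω', R i (Y i ω') ∂μ := by
            rw [← Finset.sum_add_distrib]
            refine Finset.sum_congr rfl fun i _ => ?_
            rw [integral_const_mul]
            ring
        _ ≤ _ := by
            gcongr
            · exact le_abs_self _
            calc _ ≤ ∑ i ∈ Finset.range n, w i * C :=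
                  Finset.sum_le_sum fun i _ => mul_le_mul_of_nonneg_left (hC1 i) (hw i).1
              _ = (∑ i ∈ Finset.range n, w i) * C := (Finset.sum_mul _ _ _).symm
              _ ≤ ε / (2 * C) * n * C := by gcongr
              _ = _ := by field_simp
    calc _ ≤ (n : ℝ)⁻¹ * (|∑ i ∈ Finset.range n,
          (w i * R i (Y i ω) - ∫ ω', w i * R i (Y i ω') ∂μ)| + n * (ε / 2)) := by gcongr
      _ = _ := by simp only [X₁]; field_simp
  have h3 : ‖(n : ℝ)⁻¹ • ∑ i ∈ Finset.range n, D i (Y i ω) θ₀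
      + Matrix.toEuclideanCLM (𝕜 := ℝ) (avgInfo A n)‖ ≤ ∑ b, ∑ a, X₂ a b n ω := by
    refine (norm_clm_le_sum_entries _).trans (le_of_eq ?_)
    refine Finset.sum_congr rfl fun b _ => Finset.sum_congr rfl fun a _ => ?_
    have e : ((n : ℝ)⁻¹ • ∑ i ∈ Finset.range n, D i (Y i ω) θ₀
        + Matrix.toEuclideanCLM (𝕜 := ℝ) (avgInfo A n)) (EuclideanSpace.single b 1) a
        = (n : ℝ)⁻¹ * ∑ i ∈ Finset.range n, (D i (Y i ω) θ₀ (EuclideanSpace.single b 1) a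
          - ∫ ω', D i (Y i ω') θ₀ (EuclideanSpace.single b 1) a ∂μ) := by
      rw [_root_.add_apply, PiLp.add_apply, toEuclideanCLM_single]
      simp only [h.mean_deriv, avgInfo, Matrix.smul_apply, Matrix.sum_apply, smul_eq_mul,
        sub_neg_eq_add, Finset.sum_add_distrib, mul_add]
      simp
    rw [e, abs_mul, abs_of_pos (inv_pos.2 hn')]
  have e : (n : ℝ)⁻¹ • ∑ i ∈ Finset.range n, D i (Y i ω) u
      + Matrix.toEuclideanCLM (𝕜 := ℝ) (avgInfo A n)
      = (n : ℝ)⁻¹ • ∑ i ∈ Finset.range n, (D i (Y i ω) u - D i (Y i ω) θ₀)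
        + ((n : ℝ)⁻¹ • ∑ i ∈ Finset.range n, D i (Y i ω) θ₀
          + Matrix.toEuclideanCLM (𝕜 := ℝ) (avgInfo A n)) := by
    rw [Finset.sum_sub_distrib, smul_sub]
    abel
  rw [e] at hεu
  have h4 := norm_add_le ((n : ℝ)⁻¹ • ∑ i ∈ Finset.range n, (D i (Y i ω) u - D i (Y i ω) θ₀))
    ((n : ℝ)⁻¹ • ∑ i ∈ Finset.range n, D i (Y i ω) θ₀
      + Matrix.toEuclideanCLM (𝕜 := ℝ) (avgInfo A n))
  show ε / 2 ≤ X₁ n ω + ∑ b, ∑ a, X₂ a b n ω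
  linarith

/-- The second moments of `H_n(θ₀)` are bounded. -/
theorem exists_integral_sq_le (h : RegularScore μ Y ψ D A R m θ₀ r) (hH : IsScoreSum Y ψ θ₀ r H) :
    ∃ K > 0, ∀ᶠ n : ℕ in atTop, ∫ ω, ‖H n ω θ₀‖ ^ 2 ∂μ ≤ K := by
  obtain ⟨C₁, hC₁, hm⟩ := h.avg.exists_sum_le h.m_nonneg
  obtain ⟨C₂, hC₂, hR⟩ := h.unif.exists_integral_le
  -- The summand 1 keeps the constant positive when the index type is empty.
  refine ⟨(Fintype.card ι + 1) * (C₁ * C₂), by positivity, ?_⟩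
  filter_upwards [hm, eventually_gt_atTop 0] with n hn hn0
  have hn' : (0 : ℝ) < n := by exact_mod_cast hn0
  have hvar : ∀ a i, varMat μ (fun ω => ψ i (Y i ω) θ₀) a a ≤ m i ^ 2 * C₂ := by
    intro a i
    have hm' := (h.memLp_score_apply i a)
    rw [varMat, Matrix.of_apply, covariance_self hm'.aestronglyMeasurable.aemeasurable]
    calc _ ≤ ∫ ω, ψ i (Y i ω) θ₀ a ^ 2 ∂μ :=
          variance_le_expectation_sq hm'.aestronglyMeasurable
      _ ≤ ∫ ω, m i ^ 2 * R i (Y i ω) ^ 2 ∂μ := by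
          refine integral_mono hm'.integrable_sq ((h.unif.memLp i).integrable_sq.const_mul _)
            fun ω => ?_
          dsimp only
          rw [← sq_abs, ← mul_pow]
          have := (abs_apply_le_norm (ψ i (Y i ω) θ₀) a).trans (h.score_le i (Y i ω))
          gcongr
      _ ≤ _ := by
          rw [integral_const_mul]
          gcongr
          exact hR i
  have hHa : ∀ a, MemLp (fun ω => H n ω θ₀ a) 2 μ := fun a => by
    have hm' := h.memLp_scoreSum hH n
    exact hm'.mono ((by fun_prop : Measurable fun v : EuclideanSpace ℝ ι => v a).comp_aemeasurable
      hm'.aestronglyMeasurable.aemeasurable).aestronglyMeasurable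
      (ae_of_all _ fun _ => PiLp.norm_apply_le _ _)
  have hmean : ∀ a, ∫ ω, H n ω θ₀ a ∂μ = 0 := by
    intro a
    simp_rw [fun n ω => hH n ω θ₀ (Metric.mem_ball_self h.r_pos)]
    have e : ∀ ω, ((√n)⁻¹ • ∑ i ∈ Finset.range n, ψ i (Y i ω) θ₀) a
        = (√n)⁻¹ * ∑ i ∈ Finset.range n,
          inner ℝ (ψ i (Y i ω) θ₀) (EuclideanSpace.single a (1 : ℝ)) := by
      intro ω
      simp [EuclideanSpace.inner_single_right]
    simp_rw [e]
    rw [integral_const_mul, integral_finsetSum _ fun i _ =>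
      (h.memLp_inner_score i _).integrable (by norm_num)]
    simp [h.integral_inner_score]
  have hsum : ∫ ω, ‖H n ω θ₀‖ ^ 2 ∂μ = ∑ a, varMat μ (fun ω => H n ω θ₀) a a := by
    simp_rw [EuclideanSpace.real_norm_sq_eq]
    rw [integral_finsetSum _ fun a _ => (hHa a).integrable_sq]
    refine Finset.sum_congr rfl fun a _ => ?_
    rw [varMat, Matrix.of_apply, covariance_self (hHa a).aestronglyMeasurable.aemeasurable,
      variance_of_integral_eq_zero (hHa a).aestronglyMeasurable.aemeasurable (hmean a)]
  rw [hsum, h.varMat_eq hH]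
  calc _ ≤ ∑ a : ι, C₁ * C₂ := by
        refine Finset.sum_le_sum fun a _ => ?_
        rw [Matrix.smul_apply, Matrix.sum_apply, smul_eq_mul, ← div_eq_inv_mul, div_le_iff₀ hn']
        calc _ ≤ ∑ i ∈ Finset.range n, m i ^ 2 * C₂ := Finset.sum_le_sum fun i _ => hvar a i
          _ = (∑ i ∈ Finset.range n, m i ^ 2) * C₂ := (Finset.sum_mul _ _ _).symm
          _ ≤ C₁ * n * C₂ := by gcongr
          _ = _ := by ring
    _ = Fintype.card ι * (C₁ * C₂) := by simp
    _ ≤ _ := by gcongr; linarith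

end Info

end RegularScore

namespace RegularScore

variable {Ω : Type*} [MeasurableSpace Ω] {ι : Type*} [Fintype ι] [DecidableEq ι]
  {μ : Measure Ω} [IsProbabilityMeasure μ] {Y : ℕ → Ω → ℝ}
  {ψ : ℕ → ℝ → EuclideanSpace ℝ ι → EuclideanSpace ℝ ι}
  {D : ℕ → ℝ → EuclideanSpace ℝ ι → EuclideanSpace ℝ ι →L[ℝ] EuclideanSpace ℝ ι}
  {A : ℕ → Matrix ι ι ℝ} {R : ℕ → ℝ → ℝ} {m : ℕ → ℝ} {θ₀ : EuclideanSpace ℝ ι} {r : ℝ}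
  {H : ℕ → Ω → EuclideanSpace ℝ ι → EuclideanSpace ℝ ι}
  {est : ℕ → Ω → EuclideanSpace ℝ ι}

/-! ### Linearization, existence and consistency of roots. -/

section Expansion

/-- The rule `o_p(1) · O_p(1) = o_p(1)`: since `H_n(θ₀)` has bounded second moments, Chebyshev
bounds the probability of `1 ≤ kε‖H_n(θ₀)‖` by a multiple of `ε²`. An event coverable by such a set
and a vanishing one, for every small `ε`, is itself negligible. -/
theorem tendsto_measure_zero_of_score_bound (h : RegularScore μ Y ψ D A R m θ₀ r)
    (hH : IsScoreSum Y ψ θ₀ r H) {S : ℕ → Set Ω} {k ε₀ : ℝ} (hk : 0 < k) (hε₀ : 0 < ε₀)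
    (hS : ∀ ε, 0 < ε → ε ≤ ε₀ → ∃ F : ℕ → Set Ω, Tendsto (fun n => μ (F n)) atTop (𝓝 0) ∧
      ∀ᶠ n in atTop, S n ⊆ F n ∪ {ω | 1 ≤ k * ε * ‖H n ω θ₀‖}) :
    Tendsto (fun n => μ (S n)) atTop (𝓝 0) := by
  obtain ⟨K, hK, hKn⟩ := h.exists_integral_sq_le hH
  refine ENNReal.tendsto_nhds_zero.2 fun η hη => ?_
  obtain ⟨δ, hδ0, hδ⟩ : ∃ δ : ℝ, 0 < δ ∧ ENNReal.ofReal δ ≤ η / 2 := by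
    rcases eq_or_ne η ⊤ with rfl | hη'
    · exact ⟨1, one_pos, by simp [ENNReal.top_div_of_ne_top]⟩
    · refine ⟨(η / 2).toReal, ENNReal.toReal_pos (by simpa using hη.ne') (by finiteness), ?_⟩
      exact ENNReal.ofReal_toReal_le
  obtain ⟨ε, hε0, hε1, hεδ⟩ : ∃ ε, 0 < ε ∧ ε ≤ ε₀ ∧ (k * ε) ^ 2 * K ≤ δ := by
    have hcont : Tendsto (fun ε : ℝ => (k * ε) ^ 2 * K) (𝓝[>] 0) (𝓝 0) := by
      have : Continuous fun ε : ℝ => (k * ε) ^ 2 * K := by fun_prop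
      simpa using (this.tendsto 0).mono_left nhdsWithin_le_nhds
    obtain ⟨ε, h1, h2, h3⟩ := ((hcont.eventually (ge_mem_nhds hδ0)).and
      (Ioo_mem_nhdsGT hε₀)).exists
    exact ⟨ε, h2, h3.le, h1⟩
  obtain ⟨F, hF, hSF⟩ := hS ε hε0 hε1
  have hη2 : 0 < η / 2 := by simpa using hη.ne'
  filter_upwards [hSF, hKn, ENNReal.tendsto_nhds_zero.1 hF _ hη2] with n h1 h2 h3
  have h4 : {ω | 1 ≤ k * ε * ‖H n ω θ₀‖} ⊆ {ω | 1 ≤ (k * ε) ^ 2 * ‖H n ω θ₀‖ ^ 2} := by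
    intro ω hω
    simp only [Set.mem_ofPred_eq] at hω ⊢
    rw [← mul_pow]
    exact one_le_pow₀ hω
  have h5 : μ {ω | 1 ≤ k * ε * ‖H n ω θ₀‖} ≤ η / 2 := by
    refine (measure_mono h4).trans ((measure_ge_le_ofReal_integral_div
      (fun ω => by positivity) ((h.memLp_scoreSum hH n).norm.integrable_sq.const_mul _)
      one_pos).trans (le_trans (ENNReal.ofReal_le_ofReal ?_) hδ))
    rw [div_one, integral_const_mul]
    exact le_trans (by gcongr) hεδ
  calc μ (S n) ≤ μ (F n ∪ {ω | 1 ≤ k * ε * ‖H n ω θ₀‖}) := measure_mono h1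
    _ ≤ η / 2 + η / 2 := (measure_union_le _ _).trans (add_le_add h3 h5)
    _ = η := ENNReal.add_halves η

theorem inv_natCast_smul_sum (hH : IsScoreSum Y ψ θ₀ r H) (n : ℕ) (ω : Ω) {θ : EuclideanSpace ℝ ι}
    (hθ : θ ∈ Metric.ball θ₀ r) :
    (n : ℝ)⁻¹ • ∑ i ∈ Finset.range n, ψ i (Y i ω) θ = (√n)⁻¹ • H n ω θ := by
  rw [hH n ω θ hθ, smul_smul, ← mul_inv, Real.mul_self_sqrt (Nat.cast_nonneg n)]

theorem tendsto_measure_score_large (h : RegularScore μ Y ψ D A R m θ₀ r)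
    (hH : IsScoreSum Y ψ θ₀ r H) {τ : ℝ} (hτ : 0 < τ) :
    Tendsto (fun n : ℕ => μ {ω | τ ≤ ‖(n : ℝ)⁻¹ • ∑ i ∈ Finset.range n, ψ i (Y i ω) θ₀‖})
      atTop (𝓝 0) := by
  refine h.tendsto_measure_zero_of_score_bound hH (k := τ⁻¹) (ε₀ := 1) (by positivity) one_pos
    fun ε hε0 _ => ⟨fun _ => ∅, by simp, ?_⟩
  have hs : Tendsto (fun n : ℕ => (√n)⁻¹) atTop (𝓝 0) :=
    (Real.tendsto_sqrt_atTop.comp tendsto_natCast_atTop_atTop).inv_tendsto_atTop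
  filter_upwards [hs.eventually (ge_mem_nhds hε0)] with n hn ω hω
  refine Or.inr ?_
  simp only [Set.mem_ofPred_eq] at hω ⊢
  rw [inv_natCast_smul_sum hH n ω (Metric.mem_ball_self h.r_pos), norm_smul, norm_inv,
    Real.norm_of_nonneg (Real.sqrt_nonneg _)] at hω
  have : τ ≤ ε * ‖H n ω θ₀‖ := hω.trans (by gcongr)
  rw [mul_assoc, ← div_eq_inv_mul, le_div_iff₀ hτ, one_mul]
  exact this

/-- A consistent root lies, with probability tending to one, where the derivative of the estimating
equation is close to its expectation at `θ₀`. -/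
theorem exists_good_event (h : RegularScore μ Y ψ D A R m θ₀ r)
    (hH : IsScoreSum Y ψ θ₀ r H) (hest : IsConsistentRoot μ H θ₀ est) {ε : ℝ} (hε : 0 < ε) :
    ∃ (ρ : ℝ) (F : ℕ → Set Ω), 0 < ρ ∧ ρ ≤ r ∧ Tendsto (fun n => μ (F n)) atTop (𝓝 0) ∧
      ∀ n ω, ω ∉ F n → est n ω ∈ Metric.ball θ₀ ρ ∧
        (n : ℝ)⁻¹ • ∑ i ∈ Finset.range n, ψ i (Y i ω) (est n ω) = 0 ∧
        ∀ u ∈ Metric.ball θ₀ ρ, ‖(n : ℝ)⁻¹ • ∑ i ∈ Finset.range n, D i (Y i ω) u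
          + Matrix.toEuclideanCLM (𝕜 := ℝ) (avgInfo A n)‖ ≤ ε := by
  obtain ⟨-, hroot, hcons⟩ := hest
  obtain ⟨ρ, hρ, hρr, hfar⟩ := h.tendsto_measure_deriv_far hε
  rw [tendstoInMeasure_iff_norm] at hcons
  refine ⟨ρ, fun n => {ω | ∃ u ∈ Metric.ball θ₀ ρ,
      ε < ‖(n : ℝ)⁻¹ • ∑ i ∈ Finset.range n, D i (Y i ω) u
        + Matrix.toEuclideanCLM (𝕜 := ℝ) (avgInfo A n)‖} ∪
      ({ω | H n ω (est n ω) ≠ 0} ∪ {ω | ρ ≤ ‖est n ω - θ₀‖}), hρ, hρr, ?_, ?_⟩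
  · exact tendsto_measure_zero_of_subset_union hfar
      (tendsto_measure_zero_of_subset_union hroot (hcons ρ hρ)
        (Eventually.of_forall fun _ => subset_rfl)) (Eventually.of_forall fun _ => subset_rfl)
  · intro n ω hω
    simp only [Set.mem_union, Set.mem_ofPred_eq, not_or, not_exists, not_and, not_lt, not_le,
      not_not] at hω
    obtain ⟨h1, h2, h3⟩ := hω
    have hmem : est n ω ∈ Metric.ball θ₀ ρ := mem_ball_iff_norm.2 h3
    refine ⟨hmem, ?_, h1⟩
    rw [inv_natCast_smul_sum hH n ω (Metric.ball_subset_ball hρr hmem), h2, smul_zero]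

theorem hasFDerivAt_avg (h : RegularScore μ Y ψ D A R m θ₀ r) (n : ℕ) (ω : Ω)
    {θ : EuclideanSpace ℝ ι} (hθ : θ ∈ Metric.ball θ₀ r) :
    HasFDerivAt (fun u => (n : ℝ)⁻¹ • ∑ i ∈ Finset.range n, ψ i (Y i ω) u)
      ((n : ℝ)⁻¹ • ∑ i ∈ Finset.range n, D i (Y i ω) θ) θ :=
  (h.hasFDerivAt_sum n ω hθ).fun_const_smul _

theorem toEuclideanCLM_mul_inv_apply {M : Matrix ι ι ℝ} (hM : IsUnit M.det)
    (v : EuclideanSpace ℝ ι) :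
    Matrix.toEuclideanCLM (𝕜 := ℝ) M (Matrix.toEuclideanCLM (𝕜 := ℝ) M⁻¹ v) = v := by
  rw [← _root_.mul_apply_eq_comp, ← map_mul, Matrix.mul_nonsing_inv _ hM, map_one,
    _root_.one_apply_eq_self]

theorem toEuclideanCLM_inv_mul_apply {M : Matrix ι ι ℝ} (hM : IsUnit M.det)
    (v : EuclideanSpace ℝ ι) :
    Matrix.toEuclideanCLM (𝕜 := ℝ) M⁻¹ (Matrix.toEuclideanCLM (𝕜 := ℝ) M v) = v := by
  rw [← _root_.mul_apply_eq_comp, ← map_mul, Matrix.nonsing_inv_mul _ hM, map_one,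
    _root_.one_apply_eq_self]

/-- Linearization of a consistent root, for any matrices `M_n` that approximate `n⁻¹ ∑ A_i` in
probability. -/
theorem tendsto_measure_expansion (h : RegularScore μ Y ψ D A R m θ₀ r)
    (hH : IsScoreSum Y ψ θ₀ r H) (hest : IsConsistentRoot μ H θ₀ est) {M : ℕ → Ω → Matrix ι ι ℝ}
    (hM : ∀ (n : ℕ) ω ε, ‖(n : ℝ)⁻¹ • ∑ i ∈ Finset.range n, D i (Y i ω) θ₀
          + Matrix.toEuclideanCLM (𝕜 := ℝ) (avgInfo A n)‖ ≤ ε →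
      ‖Matrix.toEuclideanCLM (𝕜 := ℝ) (M n ω) - Matrix.toEuclideanCLM (𝕜 := ℝ) (avgInfo A n)‖ ≤ ε)
    {τ : ℝ} (hτ : 0 < τ) :
    Tendsto (fun n : ℕ => μ {ω | τ ≤ ‖√n • (est n ω - θ₀
      - Matrix.toEuclideanCLM (𝕜 := ℝ) (M n ω)⁻¹ ((√n)⁻¹ • H n ω θ₀))‖}) atTop (𝓝 0) := by
  obtain ⟨c, hc, hlow⟩ := h.exists_lower_bound
  -- The deterministic bound will be applied with `c/2` and `2ε` in place of `c` and `ε`, giving the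
  -- factor `2·2ε/(c/2)² = 16ε/c²`. The restriction `ε ≤ c/8` provides both the lower bound `c/2`
  -- for `M_n` and the required `2ε ≤ (c/2)/2`.
  refine h.tendsto_measure_zero_of_score_bound hH (k := 16 / (c ^ 2 * τ)) (ε₀ := c / 8)
    (by positivity) (by positivity) fun ε hε0 hε1 => ?_
  obtain ⟨ρ, F, hρ, hρr, hF, hgood⟩ := h.exists_good_event hH hest hε0
  refine ⟨F, hF, ?_⟩
  filter_upwards [hlow, eventually_gt_atTop 0] with n hn hn0 ω hω
  have hn' : (0 : ℝ) < √n := Real.sqrt_pos.2 (by exact_mod_cast hn0)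
  by_cases hωF : ω ∈ F n
  · exact Or.inl hωF
  refine Or.inr ?_
  obtain ⟨hmem, hroot, hder⟩ := hgood n ω hωF
  have hM1 := hM n ω ε (hder θ₀ (Metric.mem_ball_self hρ))
  have hlowM : ∀ v, c / 2 * ‖v‖ ≤ ‖Matrix.toEuclideanCLM (𝕜 := ℝ) (M n ω) v‖ := by
    intro v
    have h1 := hn v
    have h2 : ‖Matrix.toEuclideanCLM (𝕜 := ℝ) (avgInfo A n) v‖
        ≤ ‖Matrix.toEuclideanCLM (𝕜 := ℝ) (M n ω) v‖ + ε * ‖v‖ := by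
      have h3 := norm_sub_norm_le (Matrix.toEuclideanCLM (𝕜 := ℝ) (avgInfo A n) v)
        (Matrix.toEuclideanCLM (𝕜 := ℝ) (M n ω) v)
      have h4 := ((Matrix.toEuclideanCLM (𝕜 := ℝ) (M n ω)
        - Matrix.toEuclideanCLM (𝕜 := ℝ) (avgInfo A n)).le_opNorm v).trans
        (mul_le_mul_of_nonneg_right hM1 (norm_nonneg v))
      rw [_root_.sub_apply, norm_sub_rev] at h4
      linarith
    have h3 : ε * ‖v‖ ≤ c / 8 * ‖v‖ := by gcongr
    nlinarith [norm_nonneg v]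
  have hdet := isUnit_det_of_lower_bound (half_pos hc) hlowM
  -- One `ε` is the distance from the derivative to minus the average information, the other that
  -- from the information to `M_n`.
  have key := norm_sub_inverse_le_of_root (c := c / 2) (ε := 2 * ε)
    (fun u hu => h.hasFDerivAt_avg n ω (Metric.ball_subset_ball hρr hu))
    (B := Matrix.toEuclideanCLM (𝕜 := ℝ) (M n ω))
    (Bi := Matrix.toEuclideanCLM (𝕜 := ℝ) (M n ω)⁻¹) (fun u hu => by
      have e : (n : ℝ)⁻¹ • ∑ i ∈ Finset.range n, D i (Y i ω) u
          + Matrix.toEuclideanCLM (𝕜 := ℝ) (M n ω)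
          = ((n : ℝ)⁻¹ • ∑ i ∈ Finset.range n, D i (Y i ω) u
          + Matrix.toEuclideanCLM (𝕜 := ℝ) (avgInfo A n))
          + (Matrix.toEuclideanCLM (𝕜 := ℝ) (M n ω)
            - Matrix.toEuclideanCLM (𝕜 := ℝ) (avgInfo A n)) := by abel
      rw [e]
      exact (norm_add_le _ _).trans (by linarith [hder u hu])) hlowM (half_pos hc) (by linarith)
    (toEuclideanCLM_mul_inv_apply hdet) hmem hroot
  rw [inv_natCast_smul_sum hH n ω (Metric.mem_ball_self h.r_pos)] at key
  simp only [Set.mem_ofPred_eq] at hω ⊢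
  rw [norm_smul, Real.norm_of_nonneg hn'.le] at hω
  have h5 : τ ≤ √n * (2 * (2 * ε) / (c / 2) ^ 2 * ‖(√n)⁻¹ • H n ω θ₀‖) :=
    hω.trans (by gcongr)
  rw [norm_smul, norm_inv, Real.norm_of_nonneg hn'.le] at h5
  have e : √n * (2 * (2 * ε) / (c / 2) ^ 2 * ((√n)⁻¹ * ‖H n ω θ₀‖))
      = τ * (16 / (c ^ 2 * τ) * ε * ‖H n ω θ₀‖) := by
    field_simp
    ring
  rw [e] at h5
  exact le_of_mul_le_mul_left (by linarith) hτ

/-- The choice `M_n = n^{-1/2}(-H_n'(θ₀))` is minus the averaged derivative at `θ₀`, so its distance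
to the average information is exactly the quantity already controlled. The powers of `√n` then
cancel. -/
theorem linearExpansion (h : RegularScore μ Y ψ D A R m θ₀ r)
    (hH : IsScoreSum Y ψ θ₀ r H) (hest : IsConsistentRoot μ H θ₀ est) :
    LinearExpansion μ H θ₀ est := by
  rw [LinearExpansion, tendstoInMeasure_iff_norm]
  intro τ hτ
  have hMat : ∀ (n : ℕ) ω, Matrix.toEuclideanCLM (𝕜 := ℝ) ((√n)⁻¹ • -jac (H n ω) θ₀)
      = -((n : ℝ)⁻¹ • ∑ i ∈ Finset.range n, D i (Y i ω) θ₀) := by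
    intro n ω
    rw [← toEuclideanCLM_of_entries (-((n : ℝ)⁻¹ • ∑ i ∈ Finset.range n, D i (Y i ω) θ₀))]
    congr 1
    ext a b
    simp only [Matrix.smul_apply, Matrix.neg_apply, h.jac_scoreSum hH, Matrix.of_apply,
      smul_eq_mul, mul_neg, ← mul_assoc, ← mul_inv, Real.mul_self_sqrt (Nat.cast_nonneg n)]
    simp
  refine (h.tendsto_measure_expansion hH hest (M := fun n ω => (√n)⁻¹ • -jac (H n ω) θ₀)
    (fun n ω ε hε => ?_) hτ).congr' ?_
  · rw [hMat, ← neg_add', norm_neg]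
    exact hε
  · filter_upwards [eventually_gt_atTop 0] with n hn
    have hn' : (0 : ℝ) < √n := Real.sqrt_pos.2 (by exact_mod_cast hn)
    have e : ∀ ω, Matrix.toEuclideanCLM (𝕜 := ℝ) ((√n)⁻¹ • -jac (H n ω) θ₀)⁻¹
        ((√n)⁻¹ • H n ω θ₀) = Matrix.toEuclideanCLM (𝕜 := ℝ) (-jac (H n ω) θ₀)⁻¹ (H n ω θ₀) := by
      intro ω
      by_cases hdet : IsUnit (-jac (H n ω) θ₀).det
      · have := Matrix.inv_smul' (-jac (H n ω) θ₀) (Units.mk0 ((√n)⁻¹) (by positivity)) hdet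
        simp only [Units.smul_def, Units.val_mk0, Units.val_inv_eq_inv_val, inv_inv] at this
        rw [this, map_smul, map_smul, _root_.smul_apply, smul_smul,
          inv_mul_cancel₀ hn'.ne', one_smul]
      -- For a singular Jacobian both matrix inverses are zero by convention, so the identity holds
      -- for every `ω`.
      · have hdet' : ¬ IsUnit ((√n)⁻¹ • -jac (H n ω) θ₀).det := by
          rw [Matrix.det_smul]
          intro hu
          exact hdet (isUnit_of_mul_isUnit_right hu)
        rw [Matrix.nonsing_inv_apply_not_isUnit _ hdet, Matrix.nonsing_inv_apply_not_isUnit _ hdet']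
        simp
    simp only [e, sub_zero]

/-- One fixed radius is enough for existence. Consistency does not come from shrinking the ball but
from the a priori bound `‖θ - θ₀‖ ≤ (2/c)‖G_n(θ₀)‖`, whose right side tends to zero in probability.
-/
theorem exists_consistentRoot (h : RegularScore μ Y ψ D A R m θ₀ r)
    (hH : IsScoreSum Y ψ θ₀ r H) :
    ∃ est : ℕ → Ω → EuclideanSpace ℝ ι, (∀ n, Measurable (est n)) ∧
      IsConsistentRoot μ H θ₀ est := by
  obtain ⟨c, hc, hlow⟩ := h.exists_lower_bound
  obtain ⟨ρ, hρ, hρr, hfar⟩ := h.tendsto_measure_deriv_far (half_pos hc)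
  have hsub : Metric.closedBall θ₀ (ρ / 2) ⊆ Metric.ball θ₀ ρ :=
    Metric.closedBall_subset_ball (by linarith)
  have hex : ∀ n : ℕ, ∃ e : Ω → EuclideanSpace ℝ ι, Measurable e ∧
      ((∀ v : EuclideanSpace ℝ ι,
        c * ‖v‖ ≤ ‖Matrix.toEuclideanCLM (𝕜 := ℝ) (avgInfo A n) v‖) → ∀ ω,
        (∀ u ∈ Metric.closedBall θ₀ (ρ / 2), ‖(n : ℝ)⁻¹ • ∑ i ∈ Finset.range n, D i (Y i ω) u
          + Matrix.toEuclideanCLM (𝕜 := ℝ) (avgInfo A n)‖ ≤ c / 2) →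
        ‖(n : ℝ)⁻¹ • ∑ i ∈ Finset.range n, ψ i (Y i ω) θ₀‖ ≤ c * (ρ / 2) / 2 →
        e ω ∈ Metric.closedBall θ₀ (ρ / 2) ∧
          (n : ℝ)⁻¹ • ∑ i ∈ Finset.range n, ψ i (Y i ω) (e ω) = 0) := by
    intro n
    by_cases hn : ∀ v : EuclideanSpace ℝ ι,
        c * ‖v‖ ≤ ‖Matrix.toEuclideanCLM (𝕜 := ℝ) (avgInfo A n) v‖
    · have hdet := isUnit_det_of_lower_bound hc hn
      obtain ⟨e, he, hp⟩ := exists_measurable_root (E := EuclideanSpace ℝ ι)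
        (G := fun ω θ => (n : ℝ)⁻¹ • ∑ i ∈ Finset.range n, ψ i (Y i ω) θ)
        (G' := fun ω θ => (n : ℝ)⁻¹ • ∑ i ∈ Finset.range n, D i (Y i ω) θ) (θ₀ := θ₀)
        (ρ := ρ / 2) (by positivity)
        (fun u hu => (Finset.measurable_fun_sum (Finset.range n) fun i _ => (h.meas_score i u
          (Metric.ball_subset_ball hρr (hsub hu))).comp (h.meas i)).const_smul ((n : ℝ)⁻¹))
        (fun ω u hu => h.hasFDerivAt_avg n ω (Metric.ball_subset_ball hρr (hsub hu)))
        hn hc le_rfl (toEuclideanCLM_mul_inv_apply hdet) (toEuclideanCLM_inv_mul_apply hdet)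
      exact ⟨e, he, fun _ => hp⟩
    -- Only finitely many `n` lack the lower bound; any measurable value serves there.
    · exact ⟨fun _ => θ₀, measurable_const, fun h' => absurd h' hn⟩
  choose est hmeas hprop using hex
  refine ⟨est, hmeas, fun n => (hmeas n).aemeasurable, ?_, ?_⟩
  · refine tendsto_measure_zero_of_subset_union hfar
      (h.tendsto_measure_score_large hH (τ := c * (ρ / 2) / 2) (by positivity)) ?_
    filter_upwards [hlow, eventually_gt_atTop 0] with n hn hn0 ω hω
    have hn' : (0 : ℝ) < n := by exact_mod_cast hn0
    by_contra hc'
    simp only [Set.mem_union, Set.mem_ofPred_eq, not_or, not_exists, not_and, not_lt, not_le]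
      at hc' hω
    obtain ⟨hmem, hroot⟩ := hprop n hn ω (fun u hu => hc'.1 u (hsub hu)) hc'.2.le
    apply hω
    rw [hH n ω _ (Metric.ball_subset_ball hρr (hsub hmem))]
    rw [smul_eq_zero_iff_right (by positivity)] at hroot
    rw [hroot, smul_zero]
  · rw [tendstoInMeasure_iff_norm]
    intro τ hτ
    refine tendsto_measure_zero_of_subset_union hfar
      (h.tendsto_measure_score_large hH (τ := min (c * (ρ / 2) / 2) (c / 2 * τ))
        (by positivity)) ?_
    filter_upwards [hlow] with n hn ω hω
    by_contra hc'
    simp only [Set.mem_union, Set.mem_ofPred_eq, not_or, not_exists, not_and, not_lt, not_le]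
      at hc' hω
    obtain ⟨hc1, hc2⟩ := hc'
    obtain ⟨hc3, hc4⟩ := lt_min_iff.1 hc2
    obtain ⟨hmem, hroot⟩ := hprop n hn ω (fun u hu => hc1 u (hsub hu)) hc3.le
    have key := (norm_apply_sub_le_of_root
      (fun u hu => h.hasFDerivAt_avg n ω (Metric.ball_subset_ball hρr hu)) hc1 hn hc le_rfl
      (hsub hmem) hroot).2
    have : 2 / c * ‖(n : ℝ)⁻¹ • ∑ i ∈ Finset.range n, ψ i (Y i ω) θ₀‖ < 2 / c * (c / 2 * τ) := by
      gcongr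
    have e : 2 / c * (c / 2 * τ) = τ := by field_simp
    linarith

theorem meanNegJac_eq_smul_avgInfo (h : RegularScore μ Y ψ D A R m θ₀ r)
    (hH : IsScoreSum Y ψ θ₀ r H) {n : ℕ} (hn : 0 < n) :
    meanNegJac μ (H n) θ₀ = √n • avgInfo A n := by
  have hn' : (0 : ℝ) < √n := Real.sqrt_pos.2 (by exact_mod_cast hn)
  rw [h.meanNegJac_eq hH, avgInfo, smul_smul]
  congr 1
  rw [← Real.mul_self_sqrt (Nat.cast_nonneg n), mul_inv, ← mul_assoc,
    Real.mul_self_sqrt (Nat.cast_nonneg n), mul_inv_cancel₀ hn'.ne', one_mul]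

theorem sandwichWellDefined (h : RegularScore μ Y ψ D A R m θ₀ r)
    (hH : IsScoreSum Y ψ θ₀ r H) : SandwichWellDefined μ H θ₀ := by
  refine ⟨fun n ω => (h.hasFDerivAt_scoreSum hH n ω).differentiableAt,
    fun n a b => h.integrable_jac hH n a b, fun n => h.memLp_scoreSum hH n, ?_⟩
  obtain ⟨c, hc, hlow⟩ := h.exists_lower_bound
  filter_upwards [hlow, eventually_gt_atTop 0] with n hn hn0
  rw [h.meanNegJac_eq_smul_avgInfo hH hn0, Matrix.det_smul]
  have hn' : (0 : ℝ) < √n := Real.sqrt_pos.2 (by exact_mod_cast hn0)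
  exact ((isUnit_iff_ne_zero.2 hn'.ne').pow _).mul (isUnit_det_of_lower_bound hc hn)

end Expansion

end RegularScore

/-! ### Covariance matrices, and stability of characteristic functions under small perturbations. -/

section Var

variable {Ω : Type*} [MeasurableSpace Ω] {ι : Type*} [Fintype ι] [DecidableEq ι]
  {μ : Measure Ω} [IsProbabilityMeasure μ]

theorem memLp_apply {Z : Ω → EuclideanSpace ℝ ι} (hZ : MemLp Z 2 μ) (a : ι) :
    MemLp (fun ω => Z ω a) 2 μ :=
  hZ.mono ((by fun_prop : Measurable fun v : EuclideanSpace ℝ ι => v a).comp_aemeasurable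
    hZ.aestronglyMeasurable.aemeasurable).aestronglyMeasurable
    (ae_of_all _ fun _ => PiLp.norm_apply_le _ _)

theorem dotProduct_varMat_mulVec {Z : Ω → EuclideanSpace ℝ ι} (hZ : MemLp Z 2 μ)
    (v : EuclideanSpace ℝ ι) :
    v ⬝ᵥ (varMat μ Z).mulVec v = variance (fun ω => inner ℝ (Z ω) v) μ := by
  have hi : MemLp (fun ω => inner ℝ (Z ω) v) 2 μ := hZ.inner_const v
  have e : (fun ω => inner ℝ (Z ω) v) = fun ω => ∑ a, v a * Z ω a := by
    ext ω
    simp [PiLp.inner_apply]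
  rw [← covariance_self hi.aestronglyMeasurable.aemeasurable, e,
    covariance_fun_sum_fun_sum (fun a => (memLp_apply hZ a).const_mul _)
      fun a => (memLp_apply hZ a).const_mul _]
  simp only [dotProduct, Matrix.mulVec, Finset.mul_sum, varMat, Matrix.of_apply]
  refine Finset.sum_congr rfl fun a _ => Finset.sum_congr rfl fun b _ => ?_
  rw [covariance_const_mul_left, covariance_const_mul_right]
  ring

theorem posSemidef_varMat {Z : Ω → EuclideanSpace ℝ ι} (hZ : MemLp Z 2 μ) :
    (varMat μ Z).PosSemidef := by
  refine Matrix.PosSemidef.of_dotProduct_mulVec_nonneg ?_ fun v => ?_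
  · ext a b
    simp only [varMat, Matrix.conjTranspose_apply, Matrix.of_apply, star_trivial]
    exact covariance_comm _ _
  · have := dotProduct_varMat_mulVec hZ (WithLp.toLp 2 v)
    rw [star_trivial]
    exact this ▸ variance_nonneg _ _

/-- The quadratic form is nonnegative at `e_a + e_b` and at `e_a - e_b`. Bounding the entries of the
sandwich matrix thus reduces to bounding variances on its diagonal. -/
theorem abs_entry_le_of_posSemidef {M : Matrix ι ι ℝ} (hM : M.PosSemidef) (a b : ι) :
    |M a b| ≤ (M a a + M b b) / 2 := by
  have hsym : M b a = M a b := by simpa using hM.1.apply a b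
  have key : ∀ s : ℝ, 0 ≤ M a a + s * (2 * M a b) + s ^ 2 * M b b := by
    intro s
    have := hM.dotProduct_mulVec_nonneg (Pi.single a 1 + s • Pi.single b 1)
    simp only [star_trivial, Matrix.mulVec_add, Matrix.mulVec_smul, dotProduct_add, add_dotProduct,
      smul_dotProduct, dotProduct_smul, Matrix.mulVec_single_one, single_one_dotProduct,
      Matrix.col_apply, smul_eq_mul, hsym] at this
    linarith
  have h1 := key 1
  have h2 := key (-1)
  rw [abs_le]
  constructor <;> linarith

theorem norm_cexp_sub_cexp_le (a b : ℝ) :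
    ‖Complex.exp (a * Complex.I) - Complex.exp (b * Complex.I)‖ ≤ |a - b| := by
  have e : Complex.exp (a * Complex.I) - Complex.exp (b * Complex.I)
      = Complex.exp (b * Complex.I) * (Complex.exp (Complex.I * (a - b : ℝ)) - 1) := by
    rw [mul_sub, mul_one, ← Complex.exp_add]
    congr 2
    push_cast
    ring
  rw [e, norm_mul, Complex.norm_exp_ofReal_mul_I, one_mul]
  exact Real.norm_exp_I_mul_ofReal_sub_one_le

/-- Characteristic functions do not distinguish, in the limit, random vectors whose difference
tends to zero in probability. -/
theorem tendsto_integral_cexp_sub_of_tendsto_measure {Z W : ℕ → Ω → EuclideanSpace ℝ ι}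
    (hZ : ∀ n, AEMeasurable (Z n) μ) (hW : ∀ n, AEMeasurable (W n) μ)
    (h : ∀ τ > 0, Tendsto (fun n => μ {ω | τ ≤ ‖Z n ω - W n ω‖}) atTop (𝓝 0))
    (t : EuclideanSpace ℝ ι) :
    Tendsto (fun n => ∫ ω, Complex.exp ((inner ℝ (Z n ω) t : ℝ) * Complex.I) ∂μ
      - ∫ ω, Complex.exp ((inner ℝ (W n ω) t : ℝ) * Complex.I) ∂μ) atTop (𝓝 0) := by
  have hint : ∀ {U : Ω → EuclideanSpace ℝ ι}, AEMeasurable U μ →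
      Integrable (fun ω => Complex.exp ((inner ℝ (U ω) t : ℝ) * Complex.I)) μ := by
    intro U hU
    have hm : AEMeasurable (fun ω => inner ℝ (U ω) t) μ := hU.inner_const
    refine Integrable.of_bound (by fun_prop) 1 (ae_of_all _ fun ω => ?_)
    rw [Complex.norm_exp_ofReal_mul_I]
  rw [tendsto_zero_iff_norm_tendsto_zero]
  refine Metric.tendsto_nhds.2 fun η hη => ?_
  have hτ : 0 < η / (4 * (‖t‖ + 1)) := by positivity
  have h1 := (ENNReal.tendsto_toReal ENNReal.zero_ne_top).comp (h _ hτ)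
  filter_upwards [h1.eventually (gt_mem_nhds (show (ENNReal.toReal 0 : ℝ) < η / 4 by simpa using hη))]
    with n hn
  set S := {ω | η / (4 * (‖t‖ + 1)) ≤ ‖Z n ω - W n ω‖}
  -- The vectors are only a.e. measurable, so `S` need not be measurable; its measurable hull has
  -- the same measure.
  set S' := toMeasurable μ S
  have hS' : MeasurableSet S' := measurableSet_toMeasurable μ S
  have hμS : μ.real S' < η / 4 := by
    rw [measureReal_def, measure_toMeasurable]
    exact hn
  rw [dist_zero_right, norm_norm, ← integral_sub (hint (hZ n)) (hint (hW n))]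
  have hb : ∀ ω, ‖Complex.exp ((inner ℝ (Z n ω) t : ℝ) * Complex.I)
      - Complex.exp ((inner ℝ (W n ω) t : ℝ) * Complex.I)‖
      ≤ η / 4 + S'.indicator (fun _ => (2 : ℝ)) ω := by
    intro ω
    by_cases hω : ω ∈ S'
    · rw [Set.indicator_of_mem hω]
      refine (norm_sub_le _ _).trans ?_
      rw [Complex.norm_exp_ofReal_mul_I, Complex.norm_exp_ofReal_mul_I]
      linarith
    · rw [Set.indicator_of_notMem hω, add_zero]
      have h2 : ‖Z n ω - W n ω‖ < η / (4 * (‖t‖ + 1)) := by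
        by_contra hc
        exact hω (subset_toMeasurable μ S (not_lt.1 hc))
      refine (norm_cexp_sub_cexp_le _ _).trans ?_
      rw [← inner_sub_left]
      refine (abs_real_inner_le_norm _ _).trans ?_
      calc _ ≤ η / (4 * (‖t‖ + 1)) * (‖t‖ + 1) := by gcongr; linarith
        _ = η / 4 := by field_simp
  calc _ ≤ ∫ ω, (η / 4 + S'.indicator (fun _ => (2 : ℝ)) ω) ∂μ :=
        norm_integral_le_of_norm_le
          ((integrable_const _).add ((integrable_const _).indicator hS')) (ae_of_all _ hb)
    _ = η / 4 + μ.real S' * 2 := by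
        rw [integral_add (integrable_const _) ((integrable_const _).indicator hS'),
          integral_indicator_const _ hS']
        simp
    _ < η := by linarith

end Var

namespace RegularScore

variable {Ω : Type*} [MeasurableSpace Ω] {ι : Type*} [Fintype ι] [DecidableEq ι]
  {μ : Measure Ω} [IsProbabilityMeasure μ] {Y : ℕ → Ω → ℝ}
  {ψ : ℕ → ℝ → EuclideanSpace ℝ ι → EuclideanSpace ℝ ι}
  {D : ℕ → ℝ → EuclideanSpace ℝ ι → EuclideanSpace ℝ ι →L[ℝ] EuclideanSpace ℝ ι}
  {A : ℕ → Matrix ι ι ℝ} {R : ℕ → ℝ → ℝ} {m : ℕ → ℝ} {θ₀ : EuclideanSpace ℝ ι} {r : ℝ}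
  {H : ℕ → Ω → EuclideanSpace ℝ ι → EuclideanSpace ℝ ι}
  {est : ℕ → Ω → EuclideanSpace ℝ ι}

/-! ### Asymptotic normality of consistent roots. -/

section Normality

/-- The expected negative Jacobian is `√n` times the average information, so its two inverses absorb
the factor `n`. What remains has bounded ingredients. -/
theorem smul_sandwich_eq (h : RegularScore μ Y ψ D A R m θ₀ r) (hH : IsScoreSum Y ψ θ₀ r H)
    {n : ℕ} (hn : 0 < n) (hdet : IsUnit (avgInfo A n).det) :
    (n : ℝ) • sandwich μ (H n) θ₀
      = (avgInfo A n)⁻¹ * varMat μ (fun ω => H n ω θ₀) * (avgInfo A n)⁻¹ := by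
  have hn' : (0 : ℝ) < √n := Real.sqrt_pos.2 (by exact_mod_cast hn)
  have hinv := Matrix.inv_smul' (avgInfo A n) (Units.mk0 (√n) hn'.ne') hdet
  simp only [Units.smul_def, Units.val_mk0, Units.val_inv_eq_inv_val] at hinv
  rw [sandwich, h.meanNegJac_eq_smul_avgInfo hH hn, hinv]
  simp only [Matrix.smul_mul, Matrix.mul_smul, smul_smul]
  rw [← mul_inv, Real.mul_self_sqrt (Nat.cast_nonneg n), mul_inv_cancel₀ (by positivity), one_smul]

/-- Symmetry of the information lets one inverse move onto the other argument `t`. The sandwich form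
is then the variance of a linear functional of `H_n(θ₀)`, which is what the central limit theorem
sees. -/
theorem dotProduct_smul_sandwich (h : RegularScore μ Y ψ D A R m θ₀ r)
    (hH : IsScoreSum Y ψ θ₀ r H) {n : ℕ} (hn : 0 < n) (hdet : IsUnit (avgInfo A n).det)
    (t : EuclideanSpace ℝ ι) :
    t ⬝ᵥ ((n : ℝ) • sandwich μ (H n) θ₀).mulVec t
      = variance (fun ω => inner ℝ (H n ω θ₀)
          (Matrix.toEuclideanCLM (𝕜 := ℝ) (avgInfo A n)⁻¹ t)) μ := by
  rw [← dotProduct_varMat_mulVec (h.memLp_scoreSum hH n), h.smul_sandwich_eq hH hn hdet]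
  have hs : ((avgInfo A n)⁻¹).transpose = (avgInfo A n)⁻¹ := by
    rw [Matrix.transpose_nonsing_inv, h.avgInfo_transpose]
  rw [Matrix.ofLp_toEuclideanCLM, Matrix.mul_assoc, ← Matrix.mulVec_mulVec, ← Matrix.mulVec_mulVec,
    Matrix.dotProduct_mulVec, ← Matrix.mulVec_transpose, hs]

theorem posSemidef_smul_sandwich (h : RegularScore μ Y ψ D A R m θ₀ r)
    (hH : IsScoreSum Y ψ θ₀ r H) {n : ℕ} (hn : 0 < n) (hdet : IsUnit (avgInfo A n).det) :
    ((n : ℝ) • sandwich μ (H n) θ₀).PosSemidef := by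
  have hs : ((avgInfo A n)⁻¹).conjTranspose = (avgInfo A n)⁻¹ := by
    rw [Matrix.conjTranspose_eq_transpose_of_trivial, Matrix.transpose_nonsing_inv,
      h.avgInfo_transpose]
  have := (posSemidef_varMat (h.memLp_scoreSum hH n)).mul_mul_conjTranspose_same (avgInfo A n)⁻¹
  rwa [hs, ← h.smul_sandwich_eq hH hn hdet] at this

theorem integral_inner_sq (h : RegularScore μ Y ψ D A R m θ₀ r) (i : ℕ)
    (t : EuclideanSpace ℝ ι) : variance (fun ω => inner ℝ (ψ i (Y i ω) θ₀) t) μ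
      = ∫ ω, inner ℝ (ψ i (Y i ω) θ₀) t ^ 2 ∂μ :=
  variance_of_integral_eq_zero (h.memLp_inner_score i t).aestronglyMeasurable.aemeasurable
    (h.integral_inner_score i t)

theorem variance_inner_scoreSum (h : RegularScore μ Y ψ D A R m θ₀ r)
    (hH : IsScoreSum Y ψ θ₀ r H) (n : ℕ) (t : EuclideanSpace ℝ ι) :
    variance (fun ω => inner ℝ (H n ω θ₀) t) μ
      = (n : ℝ)⁻¹ * ∑ i ∈ Finset.range n, ∫ ω, inner ℝ (ψ i (Y i ω) θ₀) t ^ 2 ∂μ := by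
  rw [← dotProduct_varMat_mulVec (h.memLp_scoreSum hH n), h.varMat_eq hH, Matrix.smul_mulVec,
    Matrix.sum_mulVec, dotProduct_smul, dotProduct_sum, smul_eq_mul]
  congr 1
  refine Finset.sum_congr rfl fun i _ => ?_
  rw [dotProduct_varMat_mulVec (h.memLp_score i), h.integral_inner_sq]

theorem norm_inverse_apply_le {M : Matrix ι ι ℝ} {c : ℝ} (hc : 0 < c)
    (hM : ∀ v : EuclideanSpace ℝ ι, c * ‖v‖ ≤ ‖Matrix.toEuclideanCLM (𝕜 := ℝ) M v‖)
    (v : EuclideanSpace ℝ ι) : ‖Matrix.toEuclideanCLM (𝕜 := ℝ) M⁻¹ v‖ ≤ c⁻¹ * ‖v‖ := by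
  have := hM (Matrix.toEuclideanCLM (𝕜 := ℝ) M⁻¹ v)
  rw [toEuclideanCLM_mul_inv_apply (isUnit_det_of_lower_bound hc hM)] at this
  rwa [← div_eq_inv_mul, le_div_iff₀ hc, mul_comm]

theorem integral_inner_sq_le (h : RegularScore μ Y ψ D A R m θ₀ r)
    {C : ℝ} (hC : ∀ i, ∫ ω, R i (Y i ω) ^ 2 ∂μ ≤ C) (i : ℕ) (t : EuclideanSpace ℝ ι) :
    ∫ ω, inner ℝ (ψ i (Y i ω) θ₀) t ^ 2 ∂μ ≤ ‖t‖ ^ 2 * (m i ^ 2 * C) := by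
  calc _ ≤ ∫ ω, ‖t‖ ^ 2 * (m i ^ 2 * R i (Y i ω) ^ 2) ∂μ := by
        refine integral_mono (h.memLp_inner_score i t).integrable_sq
          (((h.unif.memLp i).integrable_sq.const_mul _).const_mul _) fun ω => ?_
        dsimp only
        rw [← sq_abs, ← mul_pow, ← mul_pow]
        have h1 := abs_real_inner_le_norm (ψ i (Y i ω) θ₀) t
        have h2 : ‖ψ i (Y i ω) θ₀‖ * ‖t‖ ≤ m i * R i (Y i ω) * ‖t‖ := by
          gcongr
          exact h.score_le i _
        gcongr
        linarith
    _ = ‖t‖ ^ 2 * (m i ^ 2 * ∫ ω, R i (Y i ω) ^ 2 ∂μ) := by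
        rw [integral_const_mul, integral_const_mul]
    _ ≤ _ := by
        gcongr
        exact hC i

/-- The characteristic function of `H_n(θ₀)`, along bounded arguments, approaches that of the
normal law with the same covariance matrix. -/
theorem tendsto_charFun_scoreSum (h : RegularScore μ Y ψ D A R m θ₀ r)
    (hH : IsScoreSum Y ψ θ₀ r H) {t : ℕ → EuclideanSpace ℝ ι} {K : ℝ} (hK : 0 < K)
    (ht : ∀ n, ‖t n‖ ≤ K) :
    Tendsto (fun n : ℕ => ∫ ω, Complex.exp ((inner ℝ (H n ω θ₀) (t n) : ℝ) * Complex.I) ∂μ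
      - Complex.exp (-(variance (fun ω => inner ℝ (H n ω θ₀) (t n)) μ) / 2 : ℝ)) atTop (𝓝 0) := by
  obtain ⟨C₁, hC₁, hm⟩ := h.avg.exists_sum_le h.m_nonneg
  obtain ⟨C₂, hC₂, hR⟩ := h.unif.exists_integral_le
  -- A genuine triangular array: the direction `t n` changes with the row, since it will be `B_n⁻¹
  -- t`.
  let X : ℕ → ℕ → Ω → ℝ := fun n i ω => (√n)⁻¹ * inner ℝ (ψ i (Y i ω) θ₀) (t n)
  have hinner : ∀ n i : ℕ, Measurable fun y => (√(n : ℝ))⁻¹ * inner ℝ (ψ i y θ₀) (t n) := fun n i =>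
    ((h.meas_score i θ₀ (Metric.mem_ball_self h.r_pos)).inner_const).const_mul _
  have hXm : ∀ n i, Measurable (X n i) := fun n i => (hinner n i).comp (h.meas i)
  have hXL : ∀ n i, MemLp (X n i) 2 μ := fun n i => (h.memLp_inner_score i (t n)).const_mul _
  have hXsq : ∀ n i, ∫ ω, X n i ω ^ 2 ∂μ
      = (n : ℝ)⁻¹ * ∫ ω, inner ℝ (ψ i (Y i ω) θ₀) (t n) ^ 2 ∂μ := by
    intro n i
    simp only [X, mul_pow, inv_pow, Real.sq_sqrt (Nat.cast_nonneg n)]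
    rw [integral_const_mul]
  have hXsum : ∀ n : ℕ, ∑ i ∈ Finset.range n, ∫ ω, X n i ω ^ 2 ∂μ
      = variance (fun ω => inner ℝ (H n ω θ₀) (t n)) μ := by
    intro n
    rw [h.variance_inner_scoreSum hH, Finset.mul_sum]
    exact Finset.sum_congr rfl fun i _ => hXsq n i
  have key := tendsto_integral_cexp_sub_of_lindeberg hXm hXL (fun n i => by
      simp only [X]
      rw [integral_const_mul, h.integral_inner_score, mul_zero])
    (fun n => h.indep.comp _ (hinner n)) (C := K ^ 2 * (C₁ * C₂)) ?_ ?_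
  · refine key.congr fun n => ?_
    rw [hXsum n]
    congr 1
    refine integral_congr_ae (ae_of_all _ fun ω => ?_)
    dsimp only [X]
    rw [hH n ω θ₀ (Metric.mem_ball_self h.r_pos), real_inner_smul_left, sum_inner, Finset.mul_sum]
  · filter_upwards [hm, eventually_gt_atTop 0] with n hn hn0
    have hn' : (0 : ℝ) < n := by exact_mod_cast hn0
    calc ∑ i ∈ Finset.range n, ∫ ω, X n i ω ^ 2 ∂μ
        ≤ ∑ i ∈ Finset.range n, (n : ℝ)⁻¹ * (K ^ 2 * (m i ^ 2 * C₂)) := by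
          refine Finset.sum_le_sum fun i _ => ?_
          rw [hXsq]
          have h1 := h.integral_inner_sq_le hR i (t n)
          have h2 : ‖t n‖ ^ 2 * (m i ^ 2 * C₂) ≤ K ^ 2 * (m i ^ 2 * C₂) := by
            gcongr
            exact ht n
          gcongr
          linarith
      _ = (n : ℝ)⁻¹ * (K ^ 2 * ((∑ i ∈ Finset.range n, m i ^ 2) * C₂)) := by
          rw [Finset.sum_mul, Finset.mul_sum, Finset.mul_sum]
      _ ≤ (n : ℝ)⁻¹ * (K ^ 2 * (C₁ * n * C₂)) := by gcongr
      _ = _ := by field_simp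
  · intro ε hε
    -- From `|X_{n,i}| ≤ n^{-1/2} K m_i R_i`, the event `|X_{n,i}| > ε` lies in `m_i R_i > (ε/K)√n`.
    have hlim := (tendsto_lindeberg_of_unifSqInt h.m_nonneg h.avg h.unif
      (ε := ε / K) (by positivity)).const_mul (K ^ 2)
    rw [mul_zero] at hlim
    refine tendsto_of_tendsto_of_tendsto_of_le_of_le' tendsto_const_nhds hlim
      (Eventually.of_forall fun n => Finset.sum_nonneg fun i _ =>
        integral_nonneg fun ω => sq_nonneg _) ?_
    filter_upwards [eventually_gt_atTop 0] with n hn0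
    have hn' : (0 : ℝ) < n := by exact_mod_cast hn0
    have hs : (0 : ℝ) < √n := Real.sqrt_pos.2 hn'
    have hXle : ∀ i ω, |X n i ω| ≤ (√n)⁻¹ * (K * (m i * R i (Y i ω))) := by
      intro i ω
      simp only [X]
      rw [abs_mul, abs_of_pos (inv_pos.2 hs)]
      gcongr
      calc _ ≤ ‖ψ i (Y i ω) θ₀‖ * ‖t n‖ := abs_real_inner_le_norm _ _
        _ ≤ m i * R i (Y i ω) * K :=
            mul_le_mul (h.score_le i _) (ht n) (norm_nonneg _)
              ((norm_nonneg _).trans (h.score_le i _))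
        _ = _ := by ring
    rw [Finset.mul_sum, Finset.mul_sum]
    refine Finset.sum_le_sum fun i _ => ?_
    have hRi := (h.unif.memLp i).integrable_sq
    calc ∫ ω in {ω | ε < |X n i ω|}, X n i ω ^ 2 ∂μ
        ≤ ∫ ω in {ω | ε < |X n i ω|}, (n : ℝ)⁻¹ * K ^ 2 * m i ^ 2 * R i (Y i ω) ^ 2 ∂μ := by
          refine integral_mono (hXL n i).integrable_sq.integrableOn
            (hRi.const_mul _).integrableOn fun ω => ?_
          dsimp only
          rw [← sq_abs]
          calc |X n i ω| ^ 2 ≤ ((√n)⁻¹ * (K * (m i * R i (Y i ω)))) ^ 2 := by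
                gcongr
                exact hXle i ω
            _ = _ := by
                rw [mul_pow, inv_pow, Real.sq_sqrt hn'.le]
                ring
      _ ≤ ∫ ω in {ω | ε / K * √n < m i * R i (Y i ω)},
            (n : ℝ)⁻¹ * K ^ 2 * m i ^ 2 * R i (Y i ω) ^ 2 ∂μ := by
          refine setIntegral_mono_set (hRi.const_mul _).integrableOn
            (ae_of_all _ fun ω => by positivity) (LE.le.eventuallyLE fun ω hω => ?_)
          have h1 : ε < (√n)⁻¹ * (K * (m i * R i (Y i ω))) := lt_of_lt_of_le hω (hXle i ω)
          rw [← div_eq_inv_mul, lt_div_iff₀ hs] at h1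
          show ε / K * √n < m i * R i (Y i ω)
          rw [div_mul_eq_mul_div, div_lt_iff₀ hK]
          linarith
      _ = _ := by
          rw [integral_const_mul]
          ring

/-- Linearizing with the nonrandom matrix `M_n = avgInfo` makes the leading term a fixed linear
image of `H_n(θ₀)`. Its characteristic function is handled by Lindeberg, and the remainder does not
matter in the limit. -/
theorem asympMVN (h : RegularScore μ Y ψ D A R m θ₀ r) (hH : IsScoreSum Y ψ θ₀ r H)
    (hest : IsConsistentRoot μ H θ₀ est) :
    AsympMVN μ (fun n ω => est n ω - θ₀) fun n => sandwich μ (H n) θ₀ := by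
  obtain ⟨c, hc, hlow⟩ := h.exists_lower_bound
  obtain ⟨K, hK, hKn⟩ := h.exists_integral_sq_le hH
  let Z : ℕ → Ω → EuclideanSpace ℝ ι := fun n ω => √n • (est n ω - θ₀)
  let W : ℕ → Ω → EuclideanSpace ℝ ι := fun n ω =>
    Matrix.toEuclideanCLM (𝕜 := ℝ) (avgInfo A n)⁻¹ (H n ω θ₀)
  have hZ : ∀ n, AEMeasurable (Z n) μ := fun n =>
    ((hest.1 n).sub aemeasurable_const).const_smul (√(n : ℝ))
  have hW : ∀ n, AEMeasurable (W n) μ := fun n =>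
    (Matrix.toEuclideanCLM (𝕜 := ℝ) (avgInfo A n)⁻¹).continuous.measurable.comp_aemeasurable
      (h.memLp_scoreSum hH n).aestronglyMeasurable.aemeasurable
  have hZW : ∀ τ > 0, Tendsto (fun n => μ {ω | τ ≤ ‖Z n ω - W n ω‖}) atTop (𝓝 0) := by
    intro τ hτ
    refine (h.tendsto_measure_expansion hH hest (M := fun n _ => avgInfo A n)
      (fun n ω ε hε => by simpa using (norm_nonneg _).trans hε) hτ).congr' ?_
    filter_upwards [eventually_gt_atTop 0] with n hn
    have hn' : (0 : ℝ) < √n := Real.sqrt_pos.2 (by exact_mod_cast hn)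
    have e : ∀ ω, √n • (est n ω - θ₀ - Matrix.toEuclideanCLM (𝕜 := ℝ) (avgInfo A n)⁻¹
        ((√n)⁻¹ • H n ω θ₀)) = Z n ω - W n ω := by
      intro ω
      simp only [Z, W]
      rw [smul_sub (√(n : ℝ)) (est n ω - θ₀), map_smul, smul_smul, mul_inv_cancel₀ hn'.ne', one_smul]
    simp only [e]
  have : ∀ n, IsProbabilityMeasure (μ.map (Z n)) := fun n =>
    Measure.isProbabilityMeasure_map (hZ n)
  intro g
  classical
  have hpsd : ∀ᶠ n : ℕ in atTop, ((n : ℝ) • sandwich μ (H n) θ₀).PosSemidef := by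
    filter_upwards [hlow, eventually_gt_atTop 0] with n hn hn0
    exact h.posSemidef_smul_sandwich hH hn0 (isUnit_det_of_lower_bound hc hn)
  -- A diagonal entry is the variance of `⟨H_n(θ₀), B_n⁻¹ e_a⟩`, at most `E‖H_n(θ₀)‖²` times `c⁻²`.
  have key := tendsto_integral_sub_multivariateGaussian (ν := fun n => μ.map (Z n))
    (C := fun n => (n : ℝ) • sandwich μ (H n) θ₀) (K := K * (c⁻¹) ^ 2) hpsd ?_ ?_ g
  · refine key.congr fun n => ?_
    rw [integral_map (hZ n) g.continuous.aestronglyMeasurable]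
  · filter_upwards [hlow, hpsd, hKn, eventually_gt_atTop 0] with n hn hp hKn' hn0 a b
    have hdiag : ∀ a, ((n : ℝ) • sandwich μ (H n) θ₀) a a ≤ K * (c⁻¹) ^ 2 := by
      intro a
      have h1 := h.dotProduct_smul_sandwich hH hn0 (isUnit_det_of_lower_bound hc hn)
        (EuclideanSpace.single a 1)
      have h2 : (EuclideanSpace.single a (1 : ℝ) : EuclideanSpace ℝ ι) ⬝ᵥ
          ((n : ℝ) • sandwich μ (H n) θ₀).mulVec (EuclideanSpace.single a (1 : ℝ))
          = ((n : ℝ) • sandwich μ (H n) θ₀) a a := by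
        simp
      rw [h2] at h1
      rw [h1]
      set s := Matrix.toEuclideanCLM (𝕜 := ℝ) (avgInfo A n)⁻¹ (EuclideanSpace.single a 1)
      have hs : ‖s‖ ≤ c⁻¹ := by
        simpa using norm_inverse_apply_le hc hn (EuclideanSpace.single a 1)
      have hHL := h.memLp_scoreSum hH n
      calc _ ≤ ∫ ω, inner ℝ (H n ω θ₀) s ^ 2 ∂μ :=
            variance_le_expectation_sq (hHL.inner_const s).aestronglyMeasurable
        _ ≤ ∫ ω, ‖H n ω θ₀‖ ^ 2 * (c⁻¹) ^ 2 ∂μ := by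
            refine integral_mono (hHL.inner_const s).integrable_sq
              (hHL.norm.integrable_sq.mul_const _) fun ω => ?_
            dsimp only
            rw [← sq_abs, ← mul_pow]
            have := abs_real_inner_le_norm (H n ω θ₀) s
            have h3 : ‖H n ω θ₀‖ * ‖s‖ ≤ ‖H n ω θ₀‖ * c⁻¹ := by gcongr
            gcongr
            linarith
        _ ≤ _ := by
            rw [integral_mul_const]
            gcongr
    refine (abs_entry_le_of_posSemidef hp a b).trans ?_
    linarith [hdiag a, hdiag b]
  · intro t
    have h1 := tendsto_integral_cexp_sub_of_tendsto_measure hZ hW hZW t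
    -- The value 0 where the lower bound fails keeps the directions bounded for all `n`, not only
    -- eventually.
    let s : ℕ → EuclideanSpace ℝ ι := fun n =>
      if ∀ v : EuclideanSpace ℝ ι, c * ‖v‖ ≤ ‖Matrix.toEuclideanCLM (𝕜 := ℝ) (avgInfo A n) v‖
      then Matrix.toEuclideanCLM (𝕜 := ℝ) (avgInfo A n)⁻¹ t else 0
    have hs : ∀ n, ‖s n‖ ≤ c⁻¹ * ‖t‖ + 1 := by
      intro n
      simp only [s]
      split_ifs with hn
      · linarith [norm_inverse_apply_le hc hn t]
      · rw [norm_zero]; positivity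
    have h2 := h.tendsto_charFun_scoreSum hH (t := s) (by positivity) hs
    have h3 := h1.add h2
    rw [add_zero] at h3
    refine h3.congr' ?_
    filter_upwards [hlow, eventually_gt_atTop 0] with n hn hn0
    have hdet := isUnit_det_of_lower_bound hc hn
    have hsn : s n = Matrix.toEuclideanCLM (𝕜 := ℝ) (avgInfo A n)⁻¹ t := if_pos hn
    have hWs : ∀ ω, inner ℝ (W n ω) t = inner ℝ (H n ω θ₀) (s n) := by
      intro ω
      rw [hsn, real_inner_comm]
      simp only [W]
      rw [Matrix.inner_toEuclideanCLM, Matrix.inner_toEuclideanCLM, Matrix.dotProduct_mulVec,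
        ← Matrix.mulVec_transpose, Matrix.transpose_nonsing_inv, h.avgInfo_transpose,
        dotProduct_comm]
    rw [charFun_apply, integral_map (hZ n) (by fun_prop), h.dotProduct_smul_sandwich hH hn0 hdet,
      ← hsn]
    simp only [hWs]
    ring

end Normality

end RegularScore

/-! ### The model near the true parameter -/

section Dominate

variable {Ω : Type*} [MeasurableSpace Ω] {μ : Measure Ω} [IsProbabilityMeasure μ]

/-- Random variables of order `1 + |e_i|^d`, where the `|e_i|^{2d}` are uniformly integrable, have
uniformly integrable squares. -/
theorem unifSqInt_of_uniformIntegrable {e R : ℕ → Ω → ℝ} {d q : ℕ} (hd : 0 < d) (hq : q = 2 * d) {C : ℝ} (hC : 0 < C)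
    (he : UniformIntegrable e (q : ENNReal) μ) (hem : ∀ i, Measurable (e i))
    (hRm : ∀ i, Measurable (R i)) (hR0 : ∀ i ω, 0 ≤ R i ω)
    (hR : ∀ i ω, R i ω ≤ C * (1 + |e i ω| ^ d)) : UnifSqInt μ R := by
  have hp0 : (q : ENNReal) ≠ 0 := by
    simp only [ne_eq, Nat.cast_eq_zero]
    omega
  have hpt : (q : ENNReal) ≠ ⊤ := ENNReal.natCast_ne_top _
  have heL : ∀ i, MemLp (e i) (q : ENNReal) μ := fun i => by
    obtain ⟨-, -, K, hK⟩ := he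
    exact ⟨(hem i).aestronglyMeasurable, (hK i).trans_lt ENNReal.coe_lt_top⟩
  have hint : ∀ i, Integrable (fun ω => |e i ω| ^ q) μ := fun i => by
    simpa only [Real.norm_eq_abs] using (heL i).integrable_norm_pow'
  have hpow : ∀ i ω, (|e i ω| ^ d) ^ 2 = |e i ω| ^ q := fun i ω => by
    rw [hq, mul_comm 2 d, pow_mul]
  refine ⟨hR0, hRm, fun i => ?_, fun ε hε => ?_⟩
  · have h1 : MemLp (fun ω => |e i ω| ^ d) 2 μ := by
      rw [memLp_two_iff_integrable_sq ((hem i).abs.pow_const d).aestronglyMeasurable]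
      simpa only [hpow] using hint i
    have h2 : MemLp (fun ω => C * (1 + |e i ω| ^ d)) 2 μ :=
      ((memLp_const (1 : ℝ)).add h1).const_mul C
    refine h2.mono (hRm i).aestronglyMeasurable (ae_of_all _ fun ω => ?_)
    rw [Real.norm_of_nonneg (hR0 i ω)]
    exact (hR i ω).trans (le_abs_self _)
  -- Uniform integrability bounds an `L^q` norm by `ε'`, hence the integral by `ε'^q`; with `ε' ≤ 1`
  -- this is at most `ε'`.
  · obtain ⟨ε', hε'0, hε'1, hε'⟩ : ∃ ε', 0 < ε' ∧ ε' ≤ 1 ∧ 4 * C ^ 2 * ε' ≤ ε := by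
      refine ⟨min 1 (ε / (4 * C ^ 2)), by positivity, min_le_left _ _, ?_⟩
      calc _ ≤ 4 * C ^ 2 * (ε / (4 * C ^ 2)) := by gcongr; exact min_le_right _ _
        _ = ε := by field_simp
    obtain ⟨c, hc⟩ := he.spec hp0 hpt hε'0
    have htail : ∀ i, ∫ ω in {ω | (c : ℝ) ≤ |e i ω|}, |e i ω| ^ q ∂μ ≤ ε' := by
      intro i
      have hS : MeasurableSet {ω | c ≤ ‖e i ω‖₊} :=
        measurableSet_le measurable_const (hem i).nnnorm
      have hSe : {ω | c ≤ ‖e i ω‖₊} = {ω | (c : ℝ) ≤ |e i ω|} := by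
        ext ω
        simp only [Set.mem_ofPred_eq]
        rw [← NNReal.coe_le_coe, coe_nnnorm, Real.norm_eq_abs]
      have h1 := hc i
      rw [((heL i).indicator hS).eLpNorm_eq_integral_rpow_norm hp0 hpt,
        ENNReal.ofReal_le_ofReal_iff hε'0.le] at h1
      have h2 : ∫ ω, ‖Set.indicator {ω | c ≤ ‖e i ω‖₊} (e i) ω‖ ^ (q : ENNReal).toReal ∂μ
          = ∫ ω in {ω | (c : ℝ) ≤ |e i ω|}, |e i ω| ^ q ∂μ := by
        rw [← hSe, ← integral_indicator hS]
        refine integral_congr_ae (ae_of_all _ fun ω => ?_)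
        simp only [ENNReal.toReal_natCast, Real.rpow_natCast, Set.indicator]
        split_ifs
        · rw [Real.norm_eq_abs]
        · rw [norm_zero, zero_pow (by omega)]
      rw [h2] at h1
      have hnn : 0 ≤ ∫ ω in {ω | (c : ℝ) ≤ |e i ω|}, |e i ω| ^ q ∂μ :=
        integral_nonneg fun ω => by positivity
      rw [ENNReal.toReal_natCast] at h1
      have h3 := pow_le_pow_left₀ (by positivity) h1 q
      rw [Real.rpow_inv_natCast_pow hnn (by omega)] at h3
      exact h3.trans (pow_le_of_le_one hε'0.le hε'1 (by omega))
    -- Above this level `|e|^d` exceeds both `c^d` and 1, so that `|e| ≥ c` and the dominating bound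
    -- simplifies to `2C|e|^d`.
    refine ⟨2 * C * (1 + (c : ℝ) ^ d), fun i => le_trans ?_ hε'⟩
    have hsub : ∀ ω, 2 * C * (1 + (c : ℝ) ^ d) < R i ω → (c : ℝ) ≤ |e i ω| ∧
        R i ω ^ 2 ≤ 4 * C ^ 2 * |e i ω| ^ q := by
      intro ω hω
      have h1 := hω.trans_le (hR i ω)
      have h2 : 2 * (1 + (c : ℝ) ^ d) < 1 + |e i ω| ^ d := by
        have : C * (2 * (1 + (c : ℝ) ^ d)) < C * (1 + |e i ω| ^ d) := by linarith
        exact lt_of_mul_lt_mul_left this hC.le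
      have hcd : (0 : ℝ) ≤ (c : ℝ) ^ d := by positivity
      constructor
      · by_contra hlt
        push Not at hlt
        have : |e i ω| ^ d ≤ (c : ℝ) ^ d := by gcongr
        linarith
      · rw [← hpow, show 4 * C ^ 2 * (|e i ω| ^ d) ^ 2 = (2 * C * |e i ω| ^ d) ^ 2 by ring]
        refine pow_le_pow_left₀ (hR0 i ω) ((hR i ω).trans ?_) 2
        have : C * 1 ≤ C * |e i ω| ^ d := by gcongr; linarith
        linarith
    have hRL : Integrable (fun ω => 4 * C ^ 2 * |e i ω| ^ q) μ := (hint i).const_mul _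
    have hSm : MeasurableSet {ω | 2 * C * (1 + (c : ℝ) ^ d) < R i ω} :=
      measurableSet_lt measurable_const (hRm i)
    calc _ ≤ ∫ ω in {ω | 2 * C * (1 + (c : ℝ) ^ d) < R i ω}, 4 * C ^ 2 * |e i ω| ^ q ∂μ := by
          refine integral_mono_of_nonneg (ae_of_all _ fun ω => sq_nonneg _) hRL.integrableOn ?_
          exact (ae_restrict_iff' hSm).2 (ae_of_all _ fun ω hω => (hsub ω hω).2)
      _ ≤ ∫ ω in {ω | (c : ℝ) ≤ |e i ω|}, 4 * C ^ 2 * |e i ω| ^ q ∂μ :=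
          setIntegral_mono_set hRL.integrableOn (ae_of_all _ fun ω => by positivity)
            (LE.le.eventuallyLE fun ω hω => (hsub ω hω).1)
      _ ≤ _ := by
          rw [integral_const_mul]
          gcongr
          exact htail i

theorem sum_abs_pow_le (d : ℕ) (e : ℝ) :
    ∑ k ∈ Finset.range (d + 1), |1 + e| ^ k ≤ (d + 1) * 2 ^ d * (1 + |e| ^ d) := by
  have h1 : |1 + e| ≤ 1 + |e| := (abs_add_le _ _).trans (by simp)
  have h2 : (1 + |e|) ^ d ≤ 2 ^ d * (1 + |e| ^ d) := by
    rcases le_total |e| 1 with h | h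
    · calc (1 + |e|) ^ d ≤ 2 ^ d := by gcongr; linarith
        _ ≤ _ := le_mul_of_one_le_right (by positivity) (by linarith [pow_nonneg (abs_nonneg e) d])
    · calc (1 + |e|) ^ d ≤ (2 * |e|) ^ d := by gcongr; linarith
        _ = 2 ^ d * |e| ^ d := mul_pow _ _ _
        _ ≤ _ := by gcongr; linarith
  calc ∑ k ∈ Finset.range (d + 1), |1 + e| ^ k ≤ ∑ k ∈ Finset.range (d + 1), 2 ^ d * (1 + |e| ^ d) := by
        refine Finset.sum_le_sum fun k hk => ?_
        have hk' : k ≤ d := Nat.lt_succ_iff.1 (Finset.mem_range.1 hk)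
        calc |1 + e| ^ k ≤ (1 + |e|) ^ k := by gcongr
          _ ≤ (1 + |e|) ^ d := pow_le_pow_right₀ (by linarith [abs_nonneg e]) hk'
          _ ≤ _ := h2
    _ = _ := by
        simp
        ring

end Dominate

/-- Weights at least one are convenient because `(1 + M)²` dominates constants, `M` and `M²` alike.
Where `1 + M > 2 + T` one has `M > 1`, so `(1 + M)² ≤ 4M²`. -/
theorem AvgUnifInt.one_add {M : ℕ → ℝ} (h : AvgUnifInt M) :
    AvgUnifInt fun i => 1 + M i := by
  intro ε hε
  obtain ⟨T, hT0, hT⟩ := h.exists_nonneg (ε := ε / 4) (by positivity)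
  refine ⟨2 + T, ?_⟩
  filter_upwards [hT] with n hn
  calc ∑ i ∈ Finset.range n with 2 + T < 1 + M i, (1 + M i) ^ 2
      ≤ ∑ i ∈ Finset.range n with T < M i, 4 * M i ^ 2 := by
        refine (Finset.sum_le_sum (g := fun i => 4 * M i ^ 2) fun i hi => ?_).trans
          (Finset.sum_le_sum_of_subset_of_nonneg (fun i hi => ?_) fun i _ _ => by positivity)
        · simp only [Finset.mem_filter] at hi
          nlinarith [hi.2]
        · simp only [Finset.mem_filter] at hi ⊢
          exact ⟨hi.1, by linarith [hi.2]⟩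
    _ = 4 * ∑ i ∈ Finset.range n with T < M i, M i ^ 2 := (Finset.mul_sum _ _ _).symm
    _ ≤ _ := by linarith

/-! ### The ratio of means, relative gradient and relative Hessian on a ball. -/

section Local

variable {𝓧 : Type*} {p : ℕ} {f : 𝓧 → EuclideanSpace ℝ (Fin p) → ℝ} {x : ℕ → 𝓧}
  {θ₀ : EuclideanSpace ℝ (Fin p)}

/-- The bounds on the mean function, on a ball around the true parameter. -/
structure DesignBounds (f : 𝓧 → EuclideanSpace ℝ (Fin p) → ℝ) (x : ℕ → 𝓧)
    (θ₀ : EuclideanSpace ℝ (Fin p)) (r κ : ℝ) (M : ℕ → ℝ) : Prop where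
  r_pos : 0 < r
  κ_pos : 0 < κ
  contDiffOn : ∀ i, ContDiffOn ℝ 2 (f (x i)) (Metric.ball θ₀ r)
  ne_zero : ∀ i, f (x i) θ₀ ≠ 0
  lower : ∀ i, ∀ θ ∈ Metric.ball θ₀ r, κ * |f (x i) θ₀| ≤ |f (x i) θ|
  bound : ∀ i, ∀ θ ∈ Metric.ball θ₀ r, ‖relGrad f (x i) θ‖ ≤ M i ∧ ‖relHess f (x i) θ‖ ≤ M i ^ 2
  avg : AvgUnifInt M

theorem hasFDerivAt_of_differentiableAt {g : EuclideanSpace ℝ (Fin p) → ℝ}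
    {θ : EuclideanSpace ℝ (Fin p)} (h : DifferentiableAt ℝ g θ) :
    HasFDerivAt g (innerSL ℝ (gradient g θ)) θ := by
  have e : innerSL ℝ (gradient g θ) = fderiv ℝ g θ := by
    ext v
    simp [inner_gradient_left]
  rw [e]
  exact h.hasFDerivAt

/-- The ratio of the true mean to the mean at `θ`. -/
def ratio (f : 𝓧 → EuclideanSpace ℝ (Fin p) → ℝ) (x : 𝓧) (θ₀ θ : EuclideanSpace ℝ (Fin p)) : ℝ :=
  f x θ₀ / f x θ

/-- Logarithmic differentiation: the ratio reproduces itself times `-J`, so bounds on `J` also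
control how fast the ratio varies. -/
theorem hasFDerivAt_ratio {x : 𝓧} {θ : EuclideanSpace ℝ (Fin p)}
    (h : DifferentiableAt ℝ (f x) θ) (hne : f x θ ≠ 0) :
    HasFDerivAt (ratio f x θ₀) (-(ratio f x θ₀ θ) • innerSL ℝ (relGrad f x θ)) θ := by
  have h1 := ((hasDerivAt_inv hne).comp_hasFDerivAt θ
    (hasFDerivAt_of_differentiableAt h)).const_mul (f x θ₀)
  have e : ratio f x θ₀ = fun u => f x θ₀ * (f x u)⁻¹ := by
    ext u
    exact div_eq_mul_inv _ _
  rw [e]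
  refine h1.congr_fderiv ?_
  ext v
  simp only [relGrad, _root_.smul_apply, innerSL_apply_apply, inner_smul_left, smul_eq_mul,
    RCLike.conj_to_real]
  field_simp

namespace DesignBounds

variable {r κ : ℝ} {M : ℕ → ℝ}

theorem ne_zero' (h : DesignBounds f x θ₀ r κ M) (i : ℕ) {θ : EuclideanSpace ℝ (Fin p)}
    (hθ : θ ∈ Metric.ball θ₀ r) : f (x i) θ ≠ 0 := by
  have h1 := h.lower i θ hθ
  have h2 : 0 < κ * |f (x i) θ₀| := mul_pos h.κ_pos (abs_pos.2 (h.ne_zero i))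
  exact abs_pos.1 (h2.trans_le h1)

theorem differentiableAt (h : DesignBounds f x θ₀ r κ M) (i : ℕ) {θ : EuclideanSpace ℝ (Fin p)}
    (hθ : θ ∈ Metric.ball θ₀ r) : DifferentiableAt ℝ (f (x i)) θ :=
  ((h.contDiffOn i).contDiffAt (Metric.isOpen_ball.mem_nhds hθ)).differentiableAt (by norm_num)

theorem differentiableAt_gradient (h : DesignBounds f x θ₀ r κ M) (i : ℕ)
    {θ : EuclideanSpace ℝ (Fin p)} (hθ : θ ∈ Metric.ball θ₀ r) :
    DifferentiableAt ℝ (gradient (f (x i))) θ := by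
  have h1 : DifferentiableAt ℝ (fderiv ℝ (f (x i))) θ :=
    (((h.contDiffOn i).contDiffAt (Metric.isOpen_ball.mem_nhds hθ)).fderiv_right
      (m := 1) (by norm_num)).differentiableAt (by norm_num)
  rw [differentiableAt_euclidean]
  intro a
  have e : (fun u => gradient (f (x i)) u a)
      = fun u => fderiv ℝ (f (x i)) u (EuclideanSpace.single a 1) := by
    ext u
    have := inner_gradient_left (𝕜 := ℝ) (f := f (x i)) (x := u) (y := EuclideanSpace.single a (1 : ℝ))
    rw [← this, EuclideanSpace.inner_single_right, one_mul]
    rfl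
  rw [e]
  exact h1.clm_apply (differentiableAt_const _)

/-- The quotient rule gives `K - J Jᵀ`, of norm at most `2M²`. The relative gradient is therefore
Lipschitz on the ball, and only `K` needs an equicontinuity hypothesis. -/
theorem hasFDerivAt_relGrad (h : DesignBounds f x θ₀ r κ M) (i : ℕ)
    {θ : EuclideanSpace ℝ (Fin p)} (hθ : θ ∈ Metric.ball θ₀ r) :
    HasFDerivAt (relGrad f (x i)) (relHess f (x i) θ
      - (innerSL ℝ (relGrad f (x i) θ)).smulRight (relGrad f (x i) θ)) θ := by
  have h1 := ((hasDerivAt_inv (h.ne_zero' i hθ)).comp_hasFDerivAt θ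
    (hasFDerivAt_of_differentiableAt (h.differentiableAt i hθ))).fun_smul (h.differentiableAt_gradient i hθ).hasFDerivAt
  refine h1.congr_fderiv ?_
  ext1 v
  simp only [relHess, relGrad, _root_.add_apply, _root_.sub_apply, _root_.smul_apply,
    ContinuousLinearMap.smulRight_apply, innerSL_apply_apply, inner_smul_left, smul_smul,
    RCLike.conj_to_real, smul_eq_mul, Function.comp_apply]
  rw [sub_eq_add_neg, ← neg_smul]
  congr 2
  field_simp

theorem abs_ratio_le (h : DesignBounds f x θ₀ r κ M) (i : ℕ)
    {θ : EuclideanSpace ℝ (Fin p)} (hθ : θ ∈ Metric.ball θ₀ r) :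
    |ratio f (x i) θ₀ θ| ≤ κ⁻¹ := by
  have h1 := h.lower i θ hθ
  have h2 := abs_pos.2 (h.ne_zero' i hθ)
  have := h.κ_pos
  rw [ratio, abs_div, div_le_iff₀ h2, ← div_eq_inv_mul, le_div_iff₀ this, mul_comm]
  exact h1

theorem M_nonneg (h : DesignBounds f x θ₀ r κ M) (i : ℕ) : 0 ≤ M i :=
  (norm_nonneg _).trans (h.bound i θ₀ (Metric.mem_ball_self h.r_pos)).1

theorem ratio_self (h : DesignBounds f x θ₀ r κ M) (i : ℕ) : ratio f (x i) θ₀ θ₀ = 1 :=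
  div_self (h.ne_zero i)

theorem abs_ratio_sub_one_le (h : DesignBounds f x θ₀ r κ M) (i : ℕ)
    {θ : EuclideanSpace ℝ (Fin p)} (hθ : θ ∈ Metric.ball θ₀ r) :
    |ratio f (x i) θ₀ θ - 1| ≤ κ⁻¹ * M i * ‖θ - θ₀‖ := by
  have := (convex_ball θ₀ r).norm_image_sub_le_of_norm_hasFDerivWithin_le (C := κ⁻¹ * M i)
    (f := ratio f (x i) θ₀)
    (fun u hu => (hasFDerivAt_ratio (h.differentiableAt i hu) (h.ne_zero' i hu)).hasFDerivWithinAt)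
    (fun u hu => by
      rw [norm_smul, norm_neg, innerSL_apply_norm]
      exact mul_le_mul (h.abs_ratio_le i hu) (h.bound i u hu).1 (norm_nonneg _)
        (inv_nonneg.2 h.κ_pos.le)) (Metric.mem_ball_self h.r_pos) hθ
  rwa [h.ratio_self, Real.norm_eq_abs] at this

theorem norm_relGrad_sub_le (h : DesignBounds f x θ₀ r κ M) (i : ℕ)
    {θ : EuclideanSpace ℝ (Fin p)} (hθ : θ ∈ Metric.ball θ₀ r) :
    ‖relGrad f (x i) θ - relGrad f (x i) θ₀‖ ≤ 2 * M i ^ 2 * ‖θ - θ₀‖ := by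
  refine (convex_ball θ₀ r).norm_image_sub_le_of_norm_hasFDerivWithin_le
    (fun u hu => (h.hasFDerivAt_relGrad i hu).hasFDerivWithinAt) (fun u hu => ?_)
    (Metric.mem_ball_self h.r_pos) hθ
  obtain ⟨h1, h2⟩ := h.bound i u hu
  refine (norm_sub_le _ _).trans ?_
  rw [ContinuousLinearMap.norm_smulRight_apply, innerSL_apply_norm]
  have : ‖relGrad f (x i) u‖ * ‖relGrad f (x i) u‖ ≤ M i * M i :=
    mul_le_mul h1 h1 (norm_nonneg _) (h.M_nonneg i)
  linarith

end DesignBounds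

end Local

/-! ### Equicontinuity on average -/

theorem norm_sum_pow_smul_sub_le {G : Type*} [SeminormedAddCommGroup G] [NormedSpace ℝ G]
    {N : ℕ} {z c : ℝ} {a b : ℕ → G} (h : ∀ k ∈ Finset.range N, ‖a k - b k‖ ≤ c) :
    ‖∑ k ∈ Finset.range N, z ^ k • a k - ∑ k ∈ Finset.range N, z ^ k • b k‖
      ≤ c * ∑ k ∈ Finset.range N, |z| ^ k := by
  rw [← Finset.sum_sub_distrib, Finset.mul_sum]
  refine (norm_sum_le _ _).trans (Finset.sum_le_sum fun k hk => ?_)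
  rw [← smul_sub, norm_smul, norm_pow, Real.norm_eq_abs, mul_comm]
  exact mul_le_mul_of_nonneg_right (h k hk) (by positivity)

/-- A family `∑ₖ z^k g_k(X_i(η))`, with continuous `g_k` and arguments `X_i` that are
equicontinuous on average, is itself equicontinuous on average. -/
theorem exists_equicontinuity_weights {E' F G : Type*} [SeminormedAddCommGroup E']
    [NormedAddCommGroup F] [ProperSpace F] [SeminormedAddCommGroup G] [NormedSpace ℝ G]
    {N : ℕ} {g : ℕ → F → G} {S : Set F} (hS : IsClosed S) (hg : ∀ k < N, ContinuousOn (g k) S)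
    {X : ℕ → E' → F} {m : ℕ → ℝ} (hm : AvgUnifInt m) (hm1 : ∀ i, 1 ≤ m i) {η₀ : E'} {r c C₁ C₀ : ℝ}
    (hr : 0 < r) (hXS : ∀ i, ∀ η ∈ Metric.ball η₀ r, X i η ∈ S)
    (hXb : ∀ i, ∀ η ∈ Metric.ball η₀ r, ‖X i η‖ ≤ c * m i ^ 2)
    (hc : 0 ≤ c) (hC₁ : 0 ≤ C₁)
    (hgb : ∀ k < N, ∀ i, ∀ η ∈ Metric.ball η₀ r, ‖g k (X i η)‖ ≤ C₁ * m i ^ 2)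
    (hC₀ : 2 * C₁ + 1 ≤ C₀)
    (hXc : ∀ ε > 0, ∃ ρ > 0, ∃ v : ℕ → ℝ,
      (∀ i, ∀ η ∈ Metric.ball η₀ ρ, ‖X i η - X i η₀‖ ≤ v i) ∧
      ∀ᶠ n : ℕ in atTop, ∑ i ∈ Finset.range n, v i ≤ ε * n) {ε : ℝ} (hε : 0 < ε) :
    ∃ ρ > 0, ∃ w : ℕ → ℝ, (∀ i, 0 ≤ w i ∧ w i ≤ m i ^ 2) ∧
      (∀ (i : ℕ) (z : ℝ), ∀ η ∈ Metric.ball η₀ ρ,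
        ‖∑ k ∈ Finset.range N, z ^ k • g k (X i η) - ∑ k ∈ Finset.range N, z ^ k • g k (X i η₀)‖
          ≤ w i * (C₀ * ∑ k ∈ Finset.range N, |z| ^ k)) ∧
      ∀ᶠ n : ℕ in atTop, ∑ i ∈ Finset.range n, w i ≤ ε * n := by
  obtain ⟨T, hT0, hT⟩ := hm.exists_nonneg (ε := ε / 3) (by positivity)
  have hε₁ : 0 < min 1 (ε / 3) := lt_min one_pos (by positivity)
  -- The cap 1 ensures that the small weight is below `m_i²`, as `m_i ≥ 1`.
  set ε₁ := min 1 (ε / 3) with hε₁d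
  have hcomp : IsCompact (S ∩ Metric.closedBall 0 (c * T ^ 2)) :=
    (isCompact_closedBall 0 _).inter_left hS
  have huc : ∀ k < N, ∃ δ > 0, ∀ a ∈ S ∩ Metric.closedBall 0 (c * T ^ 2),
      ∀ b ∈ S ∩ Metric.closedBall 0 (c * T ^ 2), dist a b < δ → dist (g k a) (g k b) < ε₁ :=
    fun k hk => Metric.uniformContinuousOn_iff.1
      (hcomp.uniformContinuousOn_of_continuous ((hg k hk).mono Set.inter_subset_left)) ε₁ hε₁
  obtain ⟨δ, hδ0, hδ⟩ : ∃ δ > 0, ∀ k < N, ∀ a ∈ S ∩ Metric.closedBall 0 (c * T ^ 2),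
      ∀ b ∈ S ∩ Metric.closedBall 0 (c * T ^ 2), dist a b < δ → dist (g k a) (g k b) < ε₁ := by
    choose! δ hδ0 hδ using huc
    have hfin : ∀ k ∈ Finset.range N, ∀ᶠ t in 𝓝[>] (0 : ℝ), t < δ k := fun k hk =>
      mem_nhdsWithin_of_mem_nhds (Iio_mem_nhds (hδ0 k (Finset.mem_range.1 hk)))
    obtain ⟨t, ht, ht0⟩ :=
      (((Finset.range N).eventually_all.2 hfin).and self_mem_nhdsWithin).exists
    exact ⟨t, ht0, fun k hk a ha b hb hab =>
      hδ k hk a ha b hb (hab.trans (ht k (Finset.mem_range.2 hk)))⟩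
  -- Chosen so that the average of `v_i`, multiplied by `T²/δ` in the Markov step below, is at most
  -- `ε/3`.
  obtain ⟨ρ, hρ0, v, hv, hvs⟩ := hXc (ε * δ / (3 * (T ^ 2 + 1))) (by positivity)
  have hv0 : ∀ i, 0 ≤ v i := fun i =>
    (norm_nonneg _).trans (hv i η₀ (Metric.mem_ball_self hρ0))
  have hm2 : ∀ i, 1 ≤ m i ^ 2 := fun i => one_le_pow₀ (hm1 i)
  classical
  -- Where `m_i ≤ T` the arguments stay in one compact set, and if moreover `v_i < δ` uniform
  -- continuity gives `ε₁`. Elsewhere the crude weight `m_i²` is used: it is rare for `m_i > T` by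
  -- uniform integrability, and for `v_i ≥ δ` by Markov, as `T² ≤ (T²/δ) v_i`.
  refine ⟨min ρ r, lt_min hρ0 hr, fun i => if m i ≤ T ∧ v i < δ then ε₁ else m i ^ 2,
    fun i => ?_, fun i z η hη => ?_, ?_⟩
  · dsimp only
    split_ifs
    · exact ⟨hε₁.le, (min_le_left _ _).trans (hm2 i)⟩
    · exact ⟨sq_nonneg _, le_rfl⟩
  · have hηr : η ∈ Metric.ball η₀ r := Metric.ball_subset_ball (min_le_right _ _) hη
    have hηρ : η ∈ Metric.ball η₀ ρ := Metric.ball_subset_ball (min_le_left _ _) hη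
    have h0r : η₀ ∈ Metric.ball η₀ r := Metric.mem_ball_self hr
    rw [← mul_assoc]
    refine norm_sum_pow_smul_sub_le fun k hk => ?_
    have hk' := Finset.mem_range.1 hk
    dsimp only
    split_ifs with hi
    · have hle : ∀ θ ∈ Metric.ball η₀ r, X i θ ∈ S ∩ Metric.closedBall 0 (c * T ^ 2) := by
        refine fun θ hθ => ⟨hXS i θ hθ, ?_⟩
        rw [mem_closedBall_zero_iff]
        refine (hXb i θ hθ).trans (mul_le_mul_of_nonneg_left ?_ hc)
        exact pow_le_pow_left₀ (zero_le_one.trans (hm1 i)) hi.1 2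
      have := hδ k hk' _ (hle η hηr) _ (hle η₀ h0r)
        (by rw [dist_eq_norm]; exact (hv i η hηρ).trans_lt hi.2)
      rw [dist_eq_norm] at this
      refine this.le.trans (le_mul_of_one_le_right hε₁.le ?_)
      linarith
    · refine (norm_sub_le _ _).trans ((add_le_add (hgb k hk' i η hηr) (hgb k hk' i η₀ h0r)).trans ?_)
      nlinarith [hm2 i]
  · filter_upwards [hT, hvs] with n hn1 hn2
    calc ∑ i ∈ Finset.range n, (if m i ≤ T ∧ v i < δ then ε₁ else m i ^ 2)
        ≤ ∑ i ∈ Finset.range n, (ε / 3 + (if T < m i then m i ^ 2 else 0) + T ^ 2 / δ * v i) := by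
          refine Finset.sum_le_sum fun i _ => ?_
          have h1 : 0 ≤ T ^ 2 / δ * v i := mul_nonneg (by positivity) (hv0 i)
          have h2 : ε₁ ≤ ε / 3 := min_le_right _ _
          rcases lt_or_ge T (m i) with hi | hi
          · rw [if_neg (fun h => absurd h.1 (not_le.2 hi)), if_pos hi]
            linarith
          · rw [if_neg (not_lt.2 hi)]
            by_cases hvi : v i < δ
            · rw [if_pos ⟨hi, hvi⟩]
              linarith
            · rw [if_neg (fun h => hvi h.2)]
              have h3 : m i ^ 2 ≤ T ^ 2 := pow_le_pow_left₀ (zero_le_one.trans (hm1 i)) hi 2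
              have h4 : T ^ 2 ≤ T ^ 2 / δ * v i := by
                rw [div_mul_eq_mul_div, le_div_iff₀ hδ0]
                exact mul_le_mul_of_nonneg_left (not_lt.1 hvi) (sq_nonneg _)
              linarith
      _ = ε / 3 * n + ∑ i ∈ Finset.range n with T < m i, m i ^ 2
          + T ^ 2 / δ * ∑ i ∈ Finset.range n, v i := by
          rw [Finset.sum_add_distrib, Finset.sum_add_distrib, ← Finset.mul_sum, ← Finset.sum_filter]
          simp [mul_comm]
      _ ≤ ε / 3 * n + ε / 3 * n + T ^ 2 / δ * (ε * δ / (3 * (T ^ 2 + 1)) * n) := by gcongr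
      _ = ε / 3 * n + ε / 3 * n + T ^ 2 / (T ^ 2 + 1) * (ε / 3 * n) := by field_simp
      _ ≤ ε / 3 * n + ε / 3 * n + 1 * (ε / 3 * n) := by
          gcongr
          rw [div_le_one (by positivity)]
          linarith
      _ = ε * n := by ring

/-! ### Bounds and equicontinuity of the local data of the model. -/

section Model

variable {𝓧 : Type*} {p : ℕ} {f : 𝓧 → EuclideanSpace ℝ (Fin p) → ℝ} {x : ℕ → 𝓧}
  {θ₀ : EuclideanSpace ℝ (Fin p)} {E' : Type*} [NormedAddCommGroup E'] [NormedSpace ℝ E']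

/-- The quantities on which the derivative of a score depends. -/
def localData (f : 𝓧 → EuclideanSpace ℝ (Fin p) → ℝ) (x : 𝓧) (θ₀ : EuclideanSpace ℝ (Fin p))
    (π : E' → EuclideanSpace ℝ (Fin p)) (η : E') :
    ℝ × EuclideanSpace ℝ (Fin p) × (EuclideanSpace ℝ (Fin p) →L[ℝ] EuclideanSpace ℝ (Fin p)) × E' :=
  (ratio f x θ₀ (π η), relGrad f x (π η), relHess f x (π η), η)

namespace DesignBounds

variable {r κ : ℝ} {M : ℕ → ℝ} {π : E' → EuclideanSpace ℝ (Fin p)} {η₀ : E'}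

theorem norm_localData_le (h : DesignBounds f x θ₀ r κ M) {r' : ℝ} (hr' : r' ≤ r)
    (hπ : ∀ η, ‖π η - θ₀‖ ≤ ‖η - η₀‖) (i : ℕ) {η : E'} (hη : η ∈ Metric.ball η₀ r') :
    ‖localData f (x i) θ₀ π η‖ ≤ (κ⁻¹ + 1 + (‖η₀‖ + r)) * (1 + M i) ^ 2 := by
  have hθ : π η ∈ Metric.ball θ₀ r := by
    rw [Metric.mem_ball, dist_eq_norm] at hη ⊢
    exact (hπ η).trans_lt (hη.trans_le hr')
  have hM := h.M_nonneg i
  have hκ : 0 < κ⁻¹ := inv_pos.2 h.κ_pos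
  have hr := h.r_pos
  have hη' : ‖η‖ ≤ ‖η₀‖ + r := by
    rw [Metric.mem_ball, dist_eq_norm] at hη
    linarith [norm_le_norm_add_norm_sub' η η₀]
  have h1 : (1 : ℝ) ≤ (1 + M i) ^ 2 := one_le_pow₀ (by linarith)
  have h2 : M i ≤ (1 + M i) ^ 2 := by nlinarith
  have h3 : M i ^ 2 ≤ (1 + M i) ^ 2 := by nlinarith
  have hη0 : 0 ≤ ‖η₀‖ + r := (norm_nonneg _).trans hη'
  have key : ∀ a b : ℝ, 0 ≤ b → b ≤ κ⁻¹ + 1 + (‖η₀‖ + r) → a ≤ b * (1 + M i) ^ 2 →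
      a ≤ (κ⁻¹ + 1 + (‖η₀‖ + r)) * (1 + M i) ^ 2 := fun a b _ hb ha =>
    ha.trans (mul_le_mul_of_nonneg_right hb (by positivity))
  rw [localData, Prod.norm_def, Prod.norm_def, Prod.norm_def]
  refine max_le (key _ κ⁻¹ hκ.le (by linarith) ?_) (max_le (key _ 1 zero_le_one (by linarith) ?_)
    (max_le (key _ 1 zero_le_one (by linarith) ?_) (key _ _ hη0 (by linarith) ?_)))
  · exact (h.abs_ratio_le i hθ).trans (le_mul_of_one_le_right hκ.le h1)
  · rw [one_mul]
    exact (h.bound i _ hθ).1.trans h2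
  · rw [one_mul]
    exact (h.bound i _ hθ).2.trans h3
  · exact hη'.trans (le_mul_of_one_le_right hη0 h1)

/-- The mean value inequality makes the ratio and `J` Lipschitz with constants of order `(1 +
M_i)²`, whose averages are bounded, so a small enough radius handles them. The Hessian is covered by
hypothesis, and the parameter itself is trivial. -/
theorem localData_equicontinuous (h : DesignBounds f x θ₀ r κ M)
    (hπ : ∀ η, ‖π η - θ₀‖ ≤ ‖η - η₀‖)
    (hK : ∀ ε > 0, ∃ δ > 0, ∃ w : ℕ → ℝ,
      (∀ i, ∀ θ ∈ Metric.ball θ₀ δ, ‖relHess f (x i) θ - relHess f (x i) θ₀‖ ≤ w i) ∧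
      ∀ᶠ n : ℕ in atTop, ∑ i ∈ Finset.range n, w i ≤ ε * n) :
    ∀ ε > 0, ∃ ρ > 0, ∃ v : ℕ → ℝ,
      (∀ i, ∀ η ∈ Metric.ball η₀ ρ,
        ‖localData f (x i) θ₀ π η - localData f (x i) θ₀ π η₀‖ ≤ v i) ∧
      ∀ᶠ n : ℕ in atTop, ∑ i ∈ Finset.range n, v i ≤ ε * n := by
  intro ε hε
  obtain ⟨δ, hδ0, w, hw, hws⟩ := hK (ε / 2) (by positivity)
  obtain ⟨B, -, hB⟩ := h.avg.one_add.exists_sum_le fun i => add_nonneg zero_le_one (h.M_nonneg i)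
  have hκ : 0 < κ⁻¹ := inv_pos.2 h.κ_pos
  have hπ0 : π η₀ = θ₀ := by
    have := hπ η₀
    rw [sub_self, norm_zero] at this
    exact sub_eq_zero.1 (norm_le_zero_iff.1 this)
  obtain ⟨ρ, hρ0, hρδ, hρr, hρ⟩ : ∃ ρ > 0, ρ ≤ δ ∧ ρ ≤ r ∧ (κ⁻¹ + 3) * ρ * (|B| + 1) ≤ ε / 2 := by
    refine ⟨min δ (min r (ε / 2 / ((κ⁻¹ + 3) * (|B| + 1)))), lt_min hδ0 (lt_min h.r_pos
      (by positivity)), min_le_left _ _, (min_le_right _ _).trans (min_le_left _ _), ?_⟩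
    calc _ ≤ (κ⁻¹ + 3) * (ε / 2 / ((κ⁻¹ + 3) * (|B| + 1))) * (|B| + 1) := by
          gcongr
          exact (min_le_right _ _).trans (min_le_right _ _)
      _ = ε / 2 := by
          have hA : 0 < κ⁻¹ + 3 := by positivity
          generalize κ⁻¹ + 3 = A at hA ⊢
          field_simp
  refine ⟨ρ, hρ0, fun i => (κ⁻¹ + 3) * ρ * (1 + M i) ^ 2 + w i, fun i η hη => ?_, ?_⟩
  · have hη' : ‖η - η₀‖ < ρ := by rwa [Metric.mem_ball, dist_eq_norm] at hη
    have hθn : ‖π η - θ₀‖ ≤ ρ := (hπ η).trans hη'.le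
    have hθ : π η ∈ Metric.ball θ₀ ρ := by
      rw [Metric.mem_ball, dist_eq_norm]
      exact (hπ η).trans_lt hη'
    have hθr := Metric.ball_subset_ball hρr hθ
    have hM := h.M_nonneg i
    have h1 : (1 : ℝ) ≤ (1 + M i) ^ 2 := one_le_pow₀ (by linarith)
    have h2 : M i ≤ (1 + M i) ^ 2 := by nlinarith
    have h3 : M i ^ 2 ≤ (1 + M i) ^ 2 := by nlinarith
    have hw0 : 0 ≤ w i := (norm_nonneg _).trans (hw i θ₀ (Metric.mem_ball_self hδ0))
    have key : ∀ a b : ℝ, b ≤ κ⁻¹ + 3 → a ≤ b * ρ * (1 + M i) ^ 2 →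
        a ≤ (κ⁻¹ + 3) * ρ * (1 + M i) ^ 2 + w i := fun a b hb ha =>
      ha.trans ((mul_le_mul_of_nonneg_right (mul_le_mul_of_nonneg_right hb hρ0.le)
        (by positivity)).trans (le_add_of_nonneg_right hw0))
    rw [localData, localData, Prod.mk_sub_mk, Prod.mk_sub_mk, Prod.mk_sub_mk, hπ0,
      Prod.norm_def, Prod.norm_def, Prod.norm_def]
    refine max_le (key _ κ⁻¹ (by linarith) ?_) (max_le (key _ 2 (by linarith) ?_)
      (max_le ?_ (key _ 1 (by linarith) ?_)))
    · dsimp only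
      rw [h.ratio_self, Real.norm_eq_abs]
      calc _ ≤ κ⁻¹ * M i * ‖π η - θ₀‖ := h.abs_ratio_sub_one_le i hθr
        _ ≤ κ⁻¹ * (1 + M i) ^ 2 * ρ := by gcongr
        _ = _ := by ring
    · calc _ ≤ 2 * M i ^ 2 * ‖π η - θ₀‖ := h.norm_relGrad_sub_le i hθr
        _ ≤ 2 * (1 + M i) ^ 2 * ρ := by gcongr
        _ = _ := by ring
    · refine (hw i _ (Metric.ball_subset_ball hρδ hθ)).trans (le_add_of_nonneg_left ?_)
      positivity
    · dsimp only
      nlinarith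
  · filter_upwards [hB, hws] with n hn1 hn2
    rw [Finset.sum_add_distrib, ← Finset.mul_sum]
    calc _ ≤ (κ⁻¹ + 3) * ρ * ((|B| + 1) * n) + ε / 2 * n := by
          gcongr
          refine hn1.trans (mul_le_mul_of_nonneg_right ?_ n.cast_nonneg)
          linarith [le_abs_self B]
      _ = (κ⁻¹ + 3) * ρ * (|B| + 1) * n + ε / 2 * n := by ring
      _ ≤ ε / 2 * n + ε / 2 * n := by gcongr
      _ = ε * n := by ring

end DesignBounds

end Model

/-! ### Scores that are polynomials in the relative responses -/

section Builder

variable {Ω : Type*} [MeasurableSpace Ω] {μ : Measure Ω} [IsProbabilityMeasure μ]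
  {𝓧 : Type*} {p : ℕ} {f : 𝓧 → EuclideanSpace ℝ (Fin p) → ℝ} {x : ℕ → 𝓧}
  {θ₀ : EuclideanSpace ℝ (Fin p)} {Y : ℕ → Ω → ℝ}
  {ι : Type*} [Fintype ι] [DecidableEq ι]

/-- The derivative of a score which is a polynomial of degree `d` in the relative response. -/
def polyDeriv (f : 𝓧 → EuclideanSpace ℝ (Fin p) → ℝ) (x : ℕ → 𝓧) (θ₀ : EuclideanSpace ℝ (Fin p))
    (π : EuclideanSpace ℝ ι → EuclideanSpace ℝ (Fin p)) (d : ℕ)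
    (g : ℕ → ℝ × EuclideanSpace ℝ (Fin p) ×
      (EuclideanSpace ℝ (Fin p) →L[ℝ] EuclideanSpace ℝ (Fin p)) × EuclideanSpace ℝ ι →
      EuclideanSpace ℝ ι →L[ℝ] EuclideanSpace ℝ ι) (i : ℕ) (y : ℝ) (η : EuclideanSpace ℝ ι) :
    EuclideanSpace ℝ ι →L[ℝ] EuclideanSpace ℝ ι :=
  ∑ k ∈ Finset.range (d + 1), (y / f (x i) θ₀) ^ k • g k (localData f (x i) θ₀ π η)

/-- The dominating function of order `d`. -/
def polyDom (f : 𝓧 → EuclideanSpace ℝ (Fin p) → ℝ) (x : ℕ → 𝓧) (θ₀ : EuclideanSpace ℝ (Fin p))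
    (d : ℕ) (C : ℝ) (i : ℕ) (y : ℝ) : ℝ :=
  C * ∑ k ∈ Finset.range (d + 1), |y / f (x i) θ₀| ^ k

theorem measurable_polyDom (d : ℕ) (C : ℝ) (i : ℕ) : Measurable (polyDom f x θ₀ d C i) := by
  unfold polyDom
  fun_prop

theorem unifSqInt_polyDom {d q : ℕ} (hd : 0 < d) (hq : q = 2 * d) {C : ℝ} (hC : 0 < C)
    (hne : ∀ i, f (x i) θ₀ ≠ 0) (hY : ∀ i, Measurable (Y i))
    (hui : UniformIntegrable (fun i ω => (Y i ω - f (x i) θ₀) / f (x i) θ₀) (q : ENNReal) μ) :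
    UnifSqInt μ fun i ω => polyDom f x θ₀ d C i (Y i ω) := by
  refine unifSqInt_of_uniformIntegrable hd hq (C := C * ((d + 1) * 2 ^ d)) (by positivity) hui
    (fun i => ((hY i).sub_const _).div_const _)
    (fun i => (measurable_polyDom d C i).comp (hY i)) (fun i ω => ?_) (fun i ω => ?_)
  · unfold polyDom
    positivity
  · unfold polyDom
    rw [mul_assoc]
    refine mul_le_mul_of_nonneg_left ?_ hC.le
    have e : Y i ω / f (x i) θ₀ = 1 + (Y i ω - f (x i) θ₀) / f (x i) θ₀ := by
      have := hne i
      field_simp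
      ring
    rw [e]
    exact sum_abs_pow_le d _

theorem integrable_relResponse_pow {d q : ℕ} (hd : 0 < d) (hq : q = 2 * d)
    (hne : ∀ i, f (x i) θ₀ ≠ 0) (hY : ∀ i, Measurable (Y i))
    (hui : UniformIntegrable (fun i ω => (Y i ω - f (x i) θ₀) / f (x i) θ₀) (q : ENNReal) μ)
    (i : ℕ) {k : ℕ} (hk : k ≤ d) : MemLp (fun ω => (Y i ω / f (x i) θ₀) ^ k) 2 μ := by
  refine ((unifSqInt_polyDom hd hq one_pos hne hY hui).memLp i).mono
    (((hY i).div_const _).pow_const k).aestronglyMeasurable (ae_of_all _ fun ω => ?_)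
  rw [Real.norm_eq_abs, abs_pow, Real.norm_eq_abs]
  refine le_trans ?_ (le_abs_self _)
  rw [polyDom, one_mul]
  exact Finset.single_le_sum (f := fun k => |Y i ω / f (x i) θ₀| ^ k)
    (fun j _ => by positivity) (Finset.mem_range.2 (Nat.lt_succ_of_le hk))

/-- The common reduction of QL and ML. A score of degree `d` in the relative response is dominated
by powers up to `d`, whose squares require moments of order `2d`; the weights are `1 + M_i`.
Continuity of the coefficients is asked only where the parameter lies in a closed ball, since those
of ML contain `1/σ`. -/
theorem DesignBounds.exists_regularScore {r κ : ℝ} {M : ℕ → ℝ} (h : DesignBounds f x θ₀ r κ M)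
    (hK : ∀ ε > 0, ∃ δ > 0, ∃ w : ℕ → ℝ,
      (∀ i, ∀ θ ∈ Metric.ball θ₀ δ, ‖relHess f (x i) θ - relHess f (x i) θ₀‖ ≤ w i) ∧
      ∀ᶠ n : ℕ in atTop, ∑ i ∈ Finset.range n, w i ≤ ε * n)
    {d q : ℕ} (hd : 0 < d) (hq : q = 2 * d) (hY : ∀ i, Measurable (Y i)) (hind : iIndepFun Y μ)
    (hui : UniformIntegrable (fun i ω => (Y i ω - f (x i) θ₀) / f (x i) θ₀) (q : ENNReal) μ)
    {π : EuclideanSpace ℝ ι → EuclideanSpace ℝ (Fin p)} {η₀ : EuclideanSpace ℝ ι}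
    (hπ : ∀ η, ‖π η - θ₀‖ ≤ ‖η - η₀‖) {r' : ℝ} (hr' : 0 < r') (hrr' : r' ≤ r)
    {g : ℕ → ℝ × EuclideanSpace ℝ (Fin p) ×
      (EuclideanSpace ℝ (Fin p) →L[ℝ] EuclideanSpace ℝ (Fin p)) × EuclideanSpace ℝ ι →
      EuclideanSpace ℝ ι →L[ℝ] EuclideanSpace ℝ ι}
    (hg : ∀ k < d + 1, ContinuousOn (g k) {X | X.2.2.2 ∈ Metric.closedBall η₀ r'})
    {C₁ : ℝ} (hC₁ : 0 ≤ C₁) (hgb : ∀ k < d + 1, ∀ i, ∀ η ∈ Metric.ball η₀ r',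
      ‖g k (localData f (x i) θ₀ π η)‖ ≤ C₁ * (1 + M i) ^ 2)
    {ψ : ℕ → ℝ → EuclideanSpace ℝ ι → EuclideanSpace ℝ ι}
    (hψ : ∀ i y, ∀ η ∈ Metric.ball η₀ r', HasFDerivAt (ψ i y) (polyDeriv f x θ₀ π d g i y η) η)
    (hψm : ∀ i, ∀ η ∈ Metric.ball η₀ r', Measurable fun y => ψ i y η)
    {C₂ : ℝ} (hC₂ : 0 ≤ C₂)
    (hψb : ∀ i y, ‖ψ i y η₀‖ ≤ C₂ * (1 + M i) *
      ∑ k ∈ Finset.range (d + 1), |y / f (x i) θ₀| ^ k)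
    (hmean : ∀ i, ∫ ω, ψ i (Y i ω) η₀ ∂μ = 0) {A : ℕ → Matrix ι ι ℝ}
    (hA : ∀ i a b, ∑ k ∈ Finset.range (d + 1), (∫ ω, (Y i ω / f (x i) θ₀) ^ k ∂μ) *
      g k (localData f (x i) θ₀ π η₀) (EuclideanSpace.single b 1) a = -A i a b)
    (hsymm : ∀ i, (A i).transpose = A i)
    (hpos : ∃ c > 0, ∀ᶠ n : ℕ in atTop, ∀ v : EuclideanSpace ℝ ι,
      c * n * ‖v‖ ^ 2 ≤ ∑ i ∈ Finset.range n, v ⬝ᵥ (A i).mulVec v) :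
    ∃ C : ℝ, RegularScore μ Y ψ (polyDeriv f x θ₀ π d g) A (polyDom f x θ₀ d C)
      (fun i => 1 + M i) η₀ r' := by
  have h0 : η₀ ∈ Metric.ball η₀ r' := Metric.mem_ball_self hr'
  have hS : ∀ i y, 0 ≤ ∑ k ∈ Finset.range (d + 1), |y / f (x i) θ₀| ^ k := fun i y => by positivity
  have hM1 : ∀ i, 1 ≤ 1 + M i := fun i => by linarith [h.M_nonneg i]
  have hκ : 0 < κ⁻¹ := inv_pos.2 h.κ_pos
  -- One constant for three bounds: `C₂` for the score, `C₁` for the derivative, `2C₁ + 1` for its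
  -- modulus of continuity.
  refine ⟨2 * C₁ + 1 + C₂, hr', hY, hind, hψ, hψm, measurable_polyDom d _, fun i v => ?_,
    fun i => zero_le_one.trans (hM1 i), h.avg.one_add,
    unifSqInt_polyDom hd hq (by positivity) h.ne_zero hY hui, fun i y => ?_, fun i y => ?_,
    fun ε hε => ?_, hmean, fun i a b => ?_, hsymm, hpos⟩
  · simp only [polyDeriv, _root_.sum_apply, _root_.smul_apply]
    fun_prop
  · refine (hψb i y).trans ?_
    rw [polyDom, mul_comm C₂, mul_assoc]
    have := hM1 i
    have := hS i y
    gcongr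
    linarith
  · refine (norm_sum_le _ _).trans ?_
    rw [polyDom, Finset.mul_sum, Finset.mul_sum]
    refine Finset.sum_le_sum fun k hk => ?_
    rw [norm_smul, norm_pow, Real.norm_eq_abs, mul_comm, ← mul_assoc]
    refine mul_le_mul_of_nonneg_right ((hgb k (Finset.mem_range.1 hk) i η₀ h0).trans ?_)
      (by positivity)
    nlinarith [sq_nonneg (1 + M i)]
  · exact exists_equicontinuity_weights (N := d + 1) (g := g)
      (S := {X | X.2.2.2 ∈ Metric.closedBall η₀ r'})
      (Metric.isClosed_closedBall.preimage (by fun_prop)) hg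
      (X := fun i => localData f (x i) θ₀ π) (m := fun i => 1 + M i) h.avg.one_add hM1 hr'
      (fun i η hη => Metric.ball_subset_closedBall hη)
      (fun i η hη => h.norm_localData_le hrr' hπ i hη)
      (by have := h.r_pos; positivity) hC₁ (fun k hk i η hη => hgb k hk i η hη) (by linarith)
      (h.localData_equicontinuous hπ hK) hε |>.imp fun ρ hρ => ⟨hρ.1, hρ.2.imp fun w hw =>
        ⟨hw.1, fun i y η hη => hw.2.1 i (y / f (x i) θ₀) η hη, hw.2.2⟩⟩
  · rw [← hA]
    have hi : ∀ k ∈ Finset.range (d + 1), Integrable (fun ω => (Y i ω / f (x i) θ₀) ^ k) μ :=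
      fun k hk => (integrable_relResponse_pow hd hq h.ne_zero hY hui i
        (Nat.lt_succ_iff.1 (Finset.mem_range.1 hk))).integrable one_le_two
    simp only [polyDeriv, _root_.sum_apply, _root_.smul_apply, WithLp.ofLp_sum,
      Finset.sum_apply, PiLp.smul_apply, smul_eq_mul]
    rw [integral_finsetSum _ fun k hk => (hi k hk).mul_const _]
    exact Finset.sum_congr rfl fun k hk => integral_mul_const _ _

end Builder

/-! ### Quasi-likelihood -/

theorem continuous_rankOne {X E F : Type*} [TopologicalSpace X] [NormedAddCommGroup E]
    [InnerProductSpace ℝ E] [NormedAddCommGroup F] [InnerProductSpace ℝ F] {u : X → E} {v : X → F}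
    (hu : Continuous u) (hv : Continuous v) :
    Continuous fun t => InnerProductSpace.rankOne ℝ (u t) (v t) :=
  ((InnerProductSpace.rankOne ℝ).continuous.comp hu).clm_apply hv

section QL

variable {Ω : Type*} [MeasurableSpace Ω] {μ : Measure Ω} [IsProbabilityMeasure μ]
  {𝓧 : Type*} {p : ℕ} {f : 𝓧 → EuclideanSpace ℝ (Fin p) → ℝ} {x : ℕ → 𝓧}
  {θ₀ : EuclideanSpace ℝ (Fin p)} {Y : ℕ → Ω → ℝ}

theorem RegularDesign.exists_bounds (h : RegularDesign f x θ₀) :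
    ∃ (r κ : ℝ) (M : ℕ → ℝ), DesignBounds f x θ₀ r κ M := by
  obtain ⟨⟨r, κ, M, h1, h2, h3, h4, h5, h6, h7⟩, -⟩ := h
  exact ⟨r, κ, M, h1, h2, h3, h4, h5, h6, h7⟩

theorem integrable_qlTerm {x : 𝓧} {Y : Ω → ℝ} (hY : Integrable Y μ) :
    Integrable (fun ω => qlTerm f x (Y ω) θ₀) μ :=
  ((hY.sub (integrable_const _)).div_const _).smul_const _

theorem integral_qlTerm {x : 𝓧} {Y : Ω → ℝ} (hY : Integrable Y μ)
    (hmean : ∫ ω, Y ω ∂μ = f x θ₀) : ∫ ω, qlTerm f x (Y ω) θ₀ ∂μ = 0 := by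
  simp only [qlTerm]
  rw [integral_smul_const, integral_div, integral_sub hY (integrable_const _), hmean]
  simp

theorem memLp_qlTerm {x : 𝓧} {Y : Ω → ℝ} (hY : MemLp Y 2 μ) :
    MemLp (fun ω => qlTerm f x (Y ω) θ₀) 2 μ := by
  have h1 : MemLp (fun ω => (Y ω - f x θ₀) / f x θ₀ ^ 2) 2 μ := by
    simp only [div_eq_mul_inv]
    exact (hY.sub (memLp_const _)).mul_const _
  refine (h1.mul_const ‖gradient (f x) θ₀‖).mono
    (h1.aestronglyMeasurable.smul_const _) (ae_of_all _ fun ω => ?_)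
  rw [qlTerm, norm_smul, norm_mul, norm_norm]

theorem integrable_qlEq (hY : ∀ i, Integrable (Y i) μ) (n : ℕ) :
    Integrable (fun ω => qlEq f x Y n ω θ₀) μ := by
  simp only [qlEq, qlH]
  exact (integrable_finsetSum _ fun i _ => integrable_qlTerm (hY i)).smul (√n)⁻¹

theorem integral_qlEq (hY : ∀ i, Integrable (Y i) μ) (hmean : ∀ i, ∫ ω, Y i ω ∂μ = f (x i) θ₀)
    (n : ℕ) : ∫ ω, qlEq f x Y n ω θ₀ ∂μ = 0 := by
  simp only [qlEq, qlH]
  rw [integral_smul, integral_finsetSum _ fun i _ => integrable_qlTerm (hY i)]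
  simp [integral_qlTerm (hY _) (hmean _)]

theorem qlTerm_eq (x : 𝓧) (y : ℝ) (θ : EuclideanSpace ℝ (Fin p)) :
    qlTerm f x y θ = (y / f x θ - 1) • relGrad f x θ := by
  rw [qlTerm, relGrad, smul_smul]
  congr 1
  -- With division by zero equal to zero, both sides vanish when the mean is zero.
  by_cases h : f x θ = 0
  · simp [h]
  · field_simp

theorem hasFDerivAt_qlTerm {r κ : ℝ} {M : ℕ → ℝ} (h : DesignBounds f x θ₀ r κ M) (i : ℕ) (y : ℝ)
    {θ : EuclideanSpace ℝ (Fin p)} (hθ : θ ∈ Metric.ball θ₀ r) :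
    HasFDerivAt (qlTerm f (x i) y) (-(relHess f (x i) θ) + InnerProductSpace.rankOne ℝ
      (relGrad f (x i) θ) (relGrad f (x i) θ) + (y / f (x i) θ) • (relHess f (x i) θ
        - (2 : ℝ) • InnerProductSpace.rankOne ℝ (relGrad f (x i) θ) (relGrad f (x i) θ))) θ := by
  have e : qlTerm f (x i) y = fun θ => (y / f (x i) θ₀ * ratio f (x i) θ₀ θ - 1)
      • relGrad f (x i) θ := by
    ext1 u
    rw [qlTerm_eq, ratio, div_mul_div_cancel₀ (h.ne_zero i)]
  rw [e]
  refine ((((hasFDerivAt_ratio (θ₀ := θ₀) (h.differentiableAt i hθ) (h.ne_zero' i hθ)).const_mul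
    (y / f (x i) θ₀)).sub_const 1).fun_smul (h.hasFDerivAt_relGrad i hθ)).congr_fderiv ?_
  ext1 v
  simp only [ratio, _root_.add_apply, _root_.sub_apply, _root_.smul_apply, _root_.neg_apply,
    ContinuousLinearMap.smulRight_apply, innerSL_apply_apply, smul_eq_mul,
    InnerProductSpace.rankOne_apply]
  have e2 : y / f (x i) θ₀ * (f (x i) θ₀ / f (x i) θ) = y / f (x i) θ :=
    div_mul_div_cancel₀ (h.ne_zero i)
  rw [← mul_assoc, mul_neg, e2]
  module

/-- The coefficients of the derivative of the QL terms. -/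
def qlCoef : ℕ → ℝ × EuclideanSpace ℝ (Fin p) ×
      (EuclideanSpace ℝ (Fin p) →L[ℝ] EuclideanSpace ℝ (Fin p)) × EuclideanSpace ℝ (Fin p) →
      EuclideanSpace ℝ (Fin p) →L[ℝ] EuclideanSpace ℝ (Fin p)
  | 0, X => -X.2.2.1 + InnerProductSpace.rankOne ℝ X.2.1 X.2.1
  | _ + 1, X => X.1 • (X.2.2.1 - (2 : ℝ) • InnerProductSpace.rankOne ℝ X.2.1 X.2.1)

theorem polyDeriv_qlCoef (hne : ∀ i, f (x i) θ₀ ≠ 0) (i : ℕ) (y : ℝ)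
    (θ : EuclideanSpace ℝ (Fin p)) :
    polyDeriv f x θ₀ id 1 qlCoef i y θ = -(relHess f (x i) θ) + InnerProductSpace.rankOne ℝ
      (relGrad f (x i) θ) (relGrad f (x i) θ) + (y / f (x i) θ) • (relHess f (x i) θ
        - (2 : ℝ) • InnerProductSpace.rankOne ℝ (relGrad f (x i) θ) (relGrad f (x i) θ)) := by
  simp only [polyDeriv, Finset.sum_range_succ, Finset.sum_range_zero, qlCoef, localData, id,
    pow_zero, one_smul, zero_add, pow_one, smul_smul, ratio]
  rw [div_mul_div_cancel₀ (hne i)]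

theorem dotProduct_outer_mulVec (u v : EuclideanSpace ℝ (Fin p)) :
    v ⬝ᵥ (outer u).mulVec v = inner ℝ u v ^ 2 := by
  have h1 : inner ℝ u v = ∑ a, u a * v a := by
    simp [PiLp.inner_apply, mul_comm]
  rw [h1, sq, Finset.sum_mul_sum]
  simp only [dotProduct, Matrix.mulVec, outer, Matrix.of_apply, Finset.mul_sum]
  exact Finset.sum_congr rfl fun a _ => Finset.sum_congr rfl fun b _ => by ring

theorem outer_transpose (u : EuclideanSpace ℝ (Fin p)) : (outer u).transpose = outer u := by
  ext a b
  simp [outer, mul_comm]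

theorem gram_eq_sum (n : ℕ) :
    gram f x θ₀ n = ∑ i ∈ Finset.range n, outer (relGrad f (x i) θ₀) := by
  ext a b
  simp [gram, designMatrix, outer, Matrix.mul_apply, Matrix.sum_apply, Finset.sum_range]

theorem integral_relResponse (hne : ∀ i, f (x i) θ₀ ≠ 0)
    (hmean : ∀ i, ∫ ω, Y i ω ∂μ = f (x i) θ₀) (i : ℕ) :
    ∫ ω, Y i ω / f (x i) θ₀ ∂μ = 1 := by
  rw [integral_div, hmean, div_self (hne i)]

/-- The derivative of a term is `-K + JJᵀ + w(K - 2JJᵀ)` with `w = y / f`. At `θ₀` the mean of `w`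
is 1, so `K` cancels and `-JJᵀ` is left; coercivity is then the assumption on the Gram matrix. -/
theorem exists_regularScore_ql (hY : ∀ i, Measurable (Y i)) (hint : ∀ i, Integrable (Y i) μ)
    (hmean : ∀ i, ∫ ω, Y i ω ∂μ = f (x i) θ₀) (h : RegularDesign f x θ₀) (hind : iIndepFun Y μ)
    (hui : UniformIntegrable (fun i ω => (Y i ω - f (x i) θ₀) / f (x i) θ₀) 2 μ) :
    ∃ (R : ℕ → ℝ → ℝ) (m : ℕ → ℝ) (r : ℝ), RegularScore μ Y (fun i y => qlTerm f (x i) y)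
      (polyDeriv f x θ₀ id 1 qlCoef) (fun i => outer (relGrad f (x i) θ₀)) R m θ₀ r := by
  obtain ⟨r, κ, M, hb⟩ := h.exists_bounds
  obtain ⟨-, hK, c, hc, hpos⟩ := h
  have hκ : 0 < κ⁻¹ := inv_pos.2 hb.κ_pos
  have hbd : ∀ i, ∀ θ ∈ Metric.ball θ₀ r, ‖relHess f (x i) θ‖ ≤ (1 + M i) ^ 2 ∧
      ‖InnerProductSpace.rankOne ℝ (relGrad f (x i) θ) (relGrad f (x i) θ)‖ ≤ (1 + M i) ^ 2 := by
    intro i θ hθ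
    obtain ⟨h1, h2⟩ := hb.bound i θ hθ
    have := hb.M_nonneg i
    rw [InnerProductSpace.norm_rankOne]
    constructor
    · nlinarith
    · nlinarith [norm_nonneg (relGrad f (x i) θ)]
  have hone : ∀ i ω, ∑ k ∈ Finset.range (1 + 1), |Y i ω / f (x i) θ₀| ^ k
      = 1 + |Y i ω / f (x i) θ₀| := fun i ω => by simp [Finset.sum_range_succ]
  refine (hb.exists_regularScore (μ := μ) (Y := Y) hK (d := 1) (q := 2) one_pos rfl hY
    hind (by exact_mod_cast hui) (π := id) (η₀ := θ₀) (fun η => le_rfl) hb.r_pos le_rfl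
    (g := qlCoef) (fun k _ => ?_) (C₁ := 2 + 3 * κ⁻¹) (by positivity) (fun k hk i θ hθ => ?_)
    (ψ := fun i y => qlTerm f (x i) y) (fun i y θ hθ => ?_) (fun i θ _ => ?_) (C₂ := 1) zero_le_one
    (fun i y => ?_) (fun i => integral_qlTerm (hint i) (hmean i))
    (A := fun i => outer (relGrad f (x i) θ₀)) (fun i a b => ?_)
    (fun i => outer_transpose _) ⟨c, hc, ?_⟩).elim
    fun C hC => ⟨_, _, _, hC⟩
  · refine Continuous.continuousOn ?_
    rcases k with _ | k
    · rw [show qlCoef (p := p) 0 = fun X => -X.2.2.1 + InnerProductSpace.rankOne ℝ X.2.1 X.2.1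
        from rfl]
      exact continuous_snd.snd.fst.neg.add (continuous_rankOne continuous_snd.fst continuous_snd.fst)
    · rw [show qlCoef (p := p) (k + 1) = fun X => X.1 • (X.2.2.1 - (2 : ℝ) •
        InnerProductSpace.rankOne ℝ X.2.1 X.2.1) from rfl]
      exact continuous_fst.smul (continuous_snd.snd.fst.sub
        ((continuous_rankOne continuous_snd.fst continuous_snd.fst).const_smul (2 : ℝ)))
  · obtain ⟨h1, h2⟩ := hbd i θ hθ
    have h3 : (0 : ℝ) ≤ (1 + M i) ^ 2 := sq_nonneg _
    rcases k with _ | k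
    · simp only [qlCoef, localData, id]
      refine (norm_add_le _ _).trans ?_
      rw [norm_neg]
      nlinarith
    · simp only [qlCoef, localData, id]
      rw [norm_smul, Real.norm_eq_abs]
      calc _ ≤ κ⁻¹ * ((1 + M i) ^ 2 + 2 * (1 + M i) ^ 2) := by
            refine mul_le_mul (hb.abs_ratio_le i hθ) ((norm_sub_le _ _).trans ?_)
              (norm_nonneg _) hκ.le
            rw [norm_smul, Real.norm_ofNat]
            linarith
        _ ≤ _ := by nlinarith
  · rw [polyDeriv_qlCoef hb.ne_zero]
    exact hasFDerivAt_qlTerm hb i y hθ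
  · simp only [qlTerm]
    fun_prop
  · rw [qlTerm_eq, norm_smul, one_mul, mul_comm, Finset.sum_range_succ, Finset.sum_range_one,
      pow_zero, pow_one]
    have := (hb.bound i θ₀ (Metric.mem_ball_self hb.r_pos)).1
    gcongr
    · linarith [norm_nonneg (relGrad f (x i) θ₀)]
    · linarith
    · rw [Real.norm_eq_abs]
      refine (abs_sub _ _).trans ?_
      rw [abs_one, add_comm]
  · rw [Finset.sum_range_succ, Finset.sum_range_one]
    simp only [pow_zero, pow_one, integral_relResponse hb.ne_zero hmean, qlCoef, localData, id,
      hb.ratio_self]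
    simp [outer, EuclideanSpace.inner_single_right]
    ring
  · filter_upwards [hpos] with n hn v
    refine (hn v).trans_eq (Finset.sum_congr rfl fun i _ => ?_)
    exact (dotProduct_outer_mulVec _ _).symm

theorem isScoreSum_qlEq (r : ℝ) :
    IsScoreSum Y (fun i y => qlTerm f (x i) y) θ₀ r (qlEq f x Y) := fun _ _ _ _ => rfl

theorem varMat_qlTerm {x : 𝓧} {Y : Ω → ℝ} (hY : Integrable Y μ) :
    varMat μ (fun ω => qlTerm f x (Y ω) θ₀)
      = (variance Y μ / f x θ₀ ^ 2) • outer (relGrad f x θ₀) := by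
  ext a b
  have e : ∀ a, (fun ω => qlTerm f x (Y ω) θ₀ a)
      = fun ω => (Y ω - f x θ₀) * ((f x θ₀)⁻¹ * relGrad f x θ₀ a) := by
    intro a
    ext ω
    simp only [qlTerm, relGrad, PiLp.smul_apply, smul_eq_mul]
    ring
  simp only [varMat, outer, Matrix.of_apply, Matrix.smul_apply, smul_eq_mul]
  rw [e, e, covariance_mul_const_left, covariance_mul_const_right,
    covariance_sub_const_left hY, covariance_sub_const_right hY,
    covariance_self hY.aestronglyMeasurable.aemeasurable]
  ring

theorem inv_smul_matrix {ι : Type*} [Fintype ι] [DecidableEq ι] {k : ℝ} (hk : k ≠ 0)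
    (A : Matrix ι ι ℝ) : (k • A)⁻¹ = k⁻¹ • A⁻¹ := by
  by_cases h : IsUnit A.det
  · simpa [Units.smul_def] using Matrix.inv_smul' A (Units.mk0 k hk) h
  · have h' : ¬ IsUnit (k • A).det := by
      rw [Matrix.det_smul, isUnit_iff_ne_zero] at *
      simp only [ne_eq, not_not] at h
      simp [h]
    rw [Matrix.nonsing_inv_apply_not_isUnit _ h, Matrix.nonsing_inv_apply_not_isUnit _ h', smul_zero]

/-- No invertibility is needed: for singular `A` both sides are zero by convention. The reduced
sandwich formula therefore holds for every `n`. -/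
theorem inv_mul_smul_mul_inv {ι : Type*} [Fintype ι] [DecidableEq ι] (k : ℝ)
    (A : Matrix ι ι ℝ) : A⁻¹ * (k • A) * A⁻¹ = k • A⁻¹ := by
  by_cases h : IsUnit A.det
  · rw [Matrix.mul_smul, Matrix.nonsing_inv_mul _ h, Matrix.smul_mul, Matrix.one_mul]
  · rw [Matrix.nonsing_inv_apply_not_isUnit _ h]
    simp

theorem inv_smul_mul_inv_smul_mul {ι : Type*} [Fintype ι] [DecidableEq ι] (A B : Matrix ι ι ℝ)
    {n : ℕ} (hn : 0 < n) :
    ((√n)⁻¹ • A)⁻¹ * ((n : ℝ)⁻¹ • B) * ((√n)⁻¹ • A)⁻¹ = A⁻¹ * B * A⁻¹ := by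
  have hn' : (0 : ℝ) < √n := Real.sqrt_pos.2 (by exact_mod_cast hn)
  have e : √n * ((n : ℝ)⁻¹ * √n) = 1 := by
    rw [mul_left_comm, mul_comm, Real.mul_self_sqrt n.cast_nonneg]
    exact mul_inv_cancel₀ (by exact_mod_cast hn.ne')
  rw [inv_smul_matrix (inv_ne_zero hn'.ne'), inv_inv]
  simp only [Matrix.smul_mul, Matrix.mul_smul, smul_smul]
  rw [e, one_smul]

theorem weightedGram_eq_smul_gram (hne : ∀ i, f (x i) θ₀ ≠ 0) {σ : ℝ}
    (hvar : ∀ i, variance (Y i) μ = σ ^ 2 * f (x i) θ₀ ^ 2) (n : ℕ) :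
    weightedGram μ f x Y θ₀ n = σ ^ 2 • gram f x θ₀ n := by
  rw [gram_eq_sum, weightedGram, Finset.smul_sum]
  refine Finset.sum_congr rfl fun i _ => ?_
  rw [hvar, mul_div_cancel_right₀ _ (pow_ne_zero 2 (hne i))]

end QL

/-! ### Maximum likelihood: the score -/

section MLScore

variable {𝓧 : Type*} {p : ℕ} {f : 𝓧 → EuclideanSpace ℝ (Fin p) → ℝ} {x : ℕ → 𝓧}
  {θ₀ : EuclideanSpace ℝ (Fin p)}

/-- `thetaPart` as a continuous linear map. -/
def thetaCLM (p : ℕ) : EuclideanSpace ℝ (Fin p ⊕ Unit) →L[ℝ] EuclideanSpace ℝ (Fin p) :=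
  LinearMap.toContinuousLinearMap
    { toFun := thetaPart
      map_add' := fun _ _ => rfl
      map_smul' := fun _ _ => rfl }

/-- The inclusion of the parameters `θ`, as a continuous linear map. -/
def inlCLM (p : ℕ) : EuclideanSpace ℝ (Fin p) →L[ℝ] EuclideanSpace ℝ (Fin p ⊕ Unit) :=
  LinearMap.toContinuousLinearMap
    { toFun := fun v => joint v 0
      map_add' := fun v w => by
        ext (a | a) <;> simp [joint]
      map_smul' := fun c v => by
        ext (a | a) <;> simp [joint] }

/-- The unit vector in the direction of `σ`. -/
def sigmaVec (p : ℕ) : EuclideanSpace ℝ (Fin p ⊕ Unit) := EuclideanSpace.single (Sum.inr ()) 1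

@[simp] theorem thetaCLM_apply (η : EuclideanSpace ℝ (Fin p ⊕ Unit)) :
    thetaCLM p η = thetaPart η := rfl

theorem inlCLM_apply (v : EuclideanSpace ℝ (Fin p)) : inlCLM p v = joint v 0 := rfl

theorem inner_inlCLM (v : EuclideanSpace ℝ (Fin p)) (η : EuclideanSpace ℝ (Fin p ⊕ Unit)) :
    inner ℝ (inlCLM p v) η = inner ℝ v (thetaPart η) := by
  simp [PiLp.inner_apply, inlCLM_apply, thetaPart, joint]

theorem inner_sigmaVec (η : EuclideanSpace ℝ (Fin p ⊕ Unit)) :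
    inner ℝ (sigmaVec p) η = sigmaPart η := by
  simp [sigmaVec, EuclideanSpace.inner_single_left, sigmaPart]

theorem norm_sq_eq_parts (η : EuclideanSpace ℝ (Fin p ⊕ Unit)) :
    ‖η‖ ^ 2 = ‖thetaPart η‖ ^ 2 + sigmaPart η ^ 2 := by
  simp [EuclideanSpace.norm_sq_eq, thetaPart, sigmaPart]

theorem norm_inlCLM (v : EuclideanSpace ℝ (Fin p)) : ‖inlCLM p v‖ = ‖v‖ := by
  rw [← sq_eq_sq₀ (norm_nonneg _) (norm_nonneg _), norm_sq_eq_parts]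
  simp [inlCLM_apply, thetaPart, sigmaPart, joint]

theorem norm_sigmaVec : ‖sigmaVec p‖ = 1 := by
  simp [sigmaVec]

theorem norm_thetaPart_le (η : EuclideanSpace ℝ (Fin p ⊕ Unit)) : ‖thetaPart η‖ ≤ ‖η‖ := by
  refine le_of_sq_le_sq ?_ (norm_nonneg _)
  rw [norm_sq_eq_parts η]
  linarith [sq_nonneg (sigmaPart η)]

theorem thetaPart_joint (θ : EuclideanSpace ℝ (Fin p)) (σ : ℝ) : thetaPart (joint θ σ) = θ := rfl

theorem sigmaPart_joint (θ : EuclideanSpace ℝ (Fin p)) (σ : ℝ) : sigmaPart (joint θ σ) = σ := rfl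

theorem thetaPart_sub (η ξ : EuclideanSpace ℝ (Fin p ⊕ Unit)) :
    thetaPart (η - ξ) = thetaPart η - thetaPart ξ := rfl

theorem hasFDerivAt_sigmaPart (η : EuclideanSpace ℝ (Fin p ⊕ Unit)) :
    HasFDerivAt sigmaPart (innerSL ℝ (sigmaVec p)) η := by
  have e : sigmaPart = innerSL ℝ (sigmaVec p) := by
    ext1 ξ
    rw [innerSL_apply_apply, inner_sigmaVec]
  rw [e]
  exact ContinuousLinearMap.hasFDerivAt _

theorem innerSL_comp_thetaCLM (v : EuclideanSpace ℝ (Fin p)) :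
    (innerSL ℝ v).comp (thetaCLM p) = innerSL ℝ (inlCLM p v) := by
  ext1 η
  simp [inner_inlCLM]

/-- The score of a single normal observation, with respect to `(θ, σ)`. -/
def mlTerm (f : 𝓧 → EuclideanSpace ℝ (Fin p) → ℝ) (x : 𝓧) (y : ℝ)
    (η : EuclideanSpace ℝ (Fin p ⊕ Unit)) : EuclideanSpace ℝ (Fin p ⊕ Unit) :=
  (-1 + ((y / f x (thetaPart η)) ^ 2 - y / f x (thetaPart η)) * (sigmaPart η)⁻¹ ^ 2) •
      inlCLM p (relGrad f x (thetaPart η))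
    + (-(sigmaPart η)⁻¹ + (y / f x (thetaPart η) - 1) ^ 2 * (sigmaPart η)⁻¹ ^ 3) • sigmaVec p

/-- Stated in `s` rather than `|s|`, and true also for `s = 0` under the conventions for logarithm
and inverse, so it rewrites the likelihood without side conditions before differentiation. -/
theorem log_gaussianPDFReal (m s y : ℝ) :
    Real.log (gaussianPDFReal m (Real.toNNReal (s ^ 2)) y)
      = -(1 / 2) * Real.log (2 * Real.pi * s ^ 2) - (1 / 2) * ((y - m) * s⁻¹) ^ 2 := by
  rw [gaussianPDFReal, Real.coe_toNNReal _ (sq_nonneg s)]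
  rcases eq_or_ne s 0 with rfl | hs
  · simp
  · have h1 : 0 < 2 * Real.pi * s ^ 2 := by positivity
    rw [Real.log_mul (inv_ne_zero (Real.sqrt_pos.2 h1).ne') (Real.exp_ne_zero _), Real.log_exp,
      Real.log_inv, Real.log_sqrt h1.le]
    field_simp
    ring

/-- With `w = y / f` the log density is `-log|σf| - (w - 1)²/(2σ²)` up to a constant, and `dw =
-wJ`. This yields the coefficient `-1 + (w² - w)/σ²` of `J` and `-1/σ + (w - 1)²/σ³` in the `σ`
direction. -/
theorem hasFDerivAt_log_gaussianPDFReal {x : 𝓧} (y : ℝ) {η : EuclideanSpace ℝ (Fin p ⊕ Unit)}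
    (hf : DifferentiableAt ℝ (f x) (thetaPart η)) (hne : f x (thetaPart η) ≠ 0)
    (hs : sigmaPart η ≠ 0) :
    HasFDerivAt (fun η => Real.log (gaussianPDFReal (f x (thetaPart η))
      (Real.toNNReal ((sigmaPart η * f x (thetaPart η)) ^ 2)) y))
      (innerSL ℝ (mlTerm f x y η)) η := by
  simp only [log_gaussianPDFReal]
  have hF : HasFDerivAt (fun η => f x (thetaPart η))
      (innerSL ℝ (inlCLM p (gradient (f x) (thetaPart η)))) η := by
    rw [← innerSL_comp_thetaCLM]
    exact (hasFDerivAt_of_differentiableAt hf).comp η (thetaCLM p).hasFDerivAt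
  have hG := (hasFDerivAt_sigmaPart η).fun_mul hF
  have hGne : sigmaPart η * f x (thetaPart η) ≠ 0 := mul_ne_zero hs hne
  have h1 := ((((hG.pow 2).const_mul (2 * Real.pi)).log (by positivity)).const_mul
    (-(1 / 2))).fun_sub ((((hF.const_sub y).fun_mul
      ((hasDerivAt_inv hGne).comp_hasFDerivAt η hG)).pow 2).const_mul (1 / 2))
  refine h1.congr_fderiv ?_
  ext1 v
  have := Real.pi_pos.ne'
  simp only [mlTerm, relGrad, map_smul, map_add, _root_.add_apply, _root_.sub_apply,
    _root_.smul_apply, _root_.neg_apply, innerSL_apply_apply, smul_eq_mul, Function.comp_apply,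
    inner_sigmaVec, inner_inlCLM, nsmul_eq_mul, Nat.cast_ofNat, Nat.add_one_sub_one, pow_one]
  field_simp
  ring

theorem gradient_logLik (y : ℕ → ℝ) (n : ℕ) {η : EuclideanSpace ℝ (Fin p ⊕ Unit)}
    (hf : ∀ i, DifferentiableAt ℝ (f (x i)) (thetaPart η)) (hne : ∀ i, f (x i) (thetaPart η) ≠ 0)
    (hs : sigmaPart η ≠ 0) :
    gradient (logLik f x y n) η = ∑ i ∈ Finset.range n, mlTerm f (x i) (y i) η := by
  refine HasGradientAt.gradient ?_
  rw [hasGradientAt_iff_hasFDerivAt]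
  have h1 := HasFDerivAt.fun_sum (u := Finset.range n) fun i _ =>
    hasFDerivAt_log_gaussianPDFReal (y i) (hf i) (hne i) hs
  refine h1.congr_fderiv ?_
  ext1 v
  simp

/-- The building blocks of the derivative of the score. -/
def mlOp (c₀ c₁ c₂ c₃ : ℝ) (J : EuclideanSpace ℝ (Fin p))
    (K : EuclideanSpace ℝ (Fin p) →L[ℝ] EuclideanSpace ℝ (Fin p)) :
    EuclideanSpace ℝ (Fin p ⊕ Unit) →L[ℝ] EuclideanSpace ℝ (Fin p ⊕ Unit) :=
  c₀ • (inlCLM p).comp (K.comp (thetaCLM p))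
    + c₁ • InnerProductSpace.rankOne ℝ (inlCLM p J) (inlCLM p J)
    + c₂ • (InnerProductSpace.rankOne ℝ (inlCLM p J) (sigmaVec p)
      + InnerProductSpace.rankOne ℝ (sigmaVec p) (inlCLM p J))
    + c₃ • InnerProductSpace.rankOne ℝ (sigmaVec p) (sigmaVec p)

/-- The rules `dw = -wJ`, `dt = -t² dσ` for `t = 1/σ`, and `dJ = K - JJᵀ` close up, so only four
operators occur, with coefficients polynomial in `w` and `t`. -/
theorem hasFDerivAt_mlTerm {r κ : ℝ} {M : ℕ → ℝ} (h : DesignBounds f x θ₀ r κ M) (i : ℕ) (y : ℝ)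
    {η : EuclideanSpace ℝ (Fin p ⊕ Unit)} (hθ : thetaPart η ∈ Metric.ball θ₀ r)
    (hs : sigmaPart η ≠ 0) {w t : ℝ} (hw : w = y / f (x i) (thetaPart η))
    (ht : t = (sigmaPart η)⁻¹) :
    HasFDerivAt (mlTerm f (x i) y) (mlOp (-1 - w * t ^ 2 + w ^ 2 * t ^ 2)
      (1 + 2 * w * t ^ 2 - 3 * w ^ 2 * t ^ 2) (2 * w * t ^ 3 - 2 * w ^ 2 * t ^ 3)
      (t ^ 2 - 3 * t ^ 4 + 6 * w * t ^ 4 - 3 * w ^ 2 * t ^ 4)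
      (relGrad f (x i) (thetaPart η)) (relHess f (x i) (thetaPart η))) η := by
  have e : ∀ ξ, y / f (x i) (thetaPart ξ) = y / f (x i) θ₀ * ratio f (x i) θ₀ (thetaPart ξ) :=
    fun ξ => (div_mul_div_cancel₀ (h.ne_zero i)).symm
  have hπ := (thetaCLM p).hasFDerivAt (x := η)
  have hW : HasFDerivAt (fun ξ => y / f (x i) (thetaPart ξ))
      (-w • innerSL ℝ (inlCLM p (relGrad f (x i) (thetaPart η)))) η := by
    simp only [e]
    refine (((hasFDerivAt_ratio (θ₀ := θ₀) (h.differentiableAt i hθ) (h.ne_zero' i hθ)).comp η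
      hπ).const_mul (y / f (x i) θ₀)).congr_fderiv ?_
    rw [← innerSL_comp_thetaCLM, hw, e, ContinuousLinearMap.smul_comp, smul_smul, mul_neg]
  have hT : HasFDerivAt (fun ξ : EuclideanSpace ℝ (Fin p ⊕ Unit) => (sigmaPart ξ)⁻¹)
      (-t ^ 2 • innerSL ℝ (sigmaVec p)) η := by
    refine ((hasDerivAt_inv hs).comp_hasFDerivAt η (hasFDerivAt_sigmaPart η)).congr_fderiv ?_
    rw [ht, inv_pow]
  have hJ := (inlCLM p).hasFDerivAt.comp η ((h.hasFDerivAt_relGrad i hθ).comp η hπ)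
  have h1 := (((((hW.pow 2).fun_sub hW).fun_mul (hT.pow 2)).const_add (-1)).fun_smul
    hJ).fun_add ((hT.fun_neg.fun_add (((hW.sub_const 1).pow 2).fun_mul
      (hT.pow 3))).smul_const (sigmaVec p))
  refine h1.congr_fderiv ?_
  ext1 v
  simp only [mlOp, _root_.add_apply, _root_.sub_apply,
    _root_.smul_apply, _root_.neg_apply, innerSL_apply_apply, smul_eq_mul, Function.comp_apply,
    inner_sigmaVec, inner_inlCLM, nsmul_eq_mul, Nat.cast_ofNat, ContinuousLinearMap.comp_apply,
    ContinuousLinearMap.smulRight_apply, InnerProductSpace.rankOne_apply, map_sub, map_smul,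
    thetaCLM_apply, ← hw, ← ht]
  module

end MLScore

/-! ### Maximum likelihood: regularity -/

section ML

variable {Ω : Type*} [MeasurableSpace Ω] {μ : Measure Ω} [IsProbabilityMeasure μ]
  {𝓧 : Type*} {p : ℕ} {f : 𝓧 → EuclideanSpace ℝ (Fin p) → ℝ} {x : ℕ → 𝓧}
  {θ₀ : EuclideanSpace ℝ (Fin p)} {Y : ℕ → Ω → ℝ}

theorem memLp_relResponse (hL : ∀ i, MemLp (Y i) 2 μ) (i : ℕ) :
    MemLp (fun ω => Y i ω / f (x i) θ₀) 2 μ := by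
  simp only [div_eq_mul_inv]
  exact (hL i).mul_const _

theorem integral_relResponse_sq (hne : ∀ i, f (x i) θ₀ ≠ 0) (hL : ∀ i, MemLp (Y i) 2 μ)
    (hmean : ∀ i, ∫ ω, Y i ω ∂μ = f (x i) θ₀) {σ : ℝ}
    (hvar : ∀ i, variance (Y i) μ = σ ^ 2 * f (x i) θ₀ ^ 2) (i : ℕ) :
    ∫ ω, (Y i ω / f (x i) θ₀) ^ 2 ∂μ = 1 + σ ^ 2 := by
  have h1 := variance_eq_sub (hL i)
  rw [hvar, hmean] at h1
  simp only [div_pow]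
  rw [integral_div, div_eq_iff (pow_ne_zero 2 (hne i))]
  have h2 : ∫ ω, Y i ω ^ 2 ∂μ = ∫ ω, (Y i ^ 2) ω ∂μ := rfl
  rw [h2]
  linarith

theorem integrable_mlTerm (hL : ∀ i, MemLp (Y i) 2 μ) (σ : ℝ) (i : ℕ) :
    Integrable (fun ω => mlTerm f (x i) (Y i ω) (joint θ₀ σ)) μ := by
  have h1 := memLp_relResponse (f := f) (x := x) (θ₀ := θ₀) hL i
  have h2 : MemLp (fun ω => Y i ω / f (x i) θ₀ - 1) 2 μ := h1.sub (memLp_const 1)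
  simp only [mlTerm, thetaPart_joint, sigmaPart_joint]
  exact (((integrable_const _).add ((h1.integrable_sq.sub
    (h1.integrable one_le_two)).mul_const _)).smul_const _).add
    (((integrable_const _).add (h2.integrable_sq.mul_const _)).smul_const _)

/-- Both `E(w² - w)` and `E(w - 1)²` equal `σ²`, which cancels the terms `-1` and `-1/σ`. Only two
moments enter, not normality. -/
theorem integral_mlTerm (hne : ∀ i, f (x i) θ₀ ≠ 0) (hL : ∀ i, MemLp (Y i) 2 μ)
    (hmean : ∀ i, ∫ ω, Y i ω ∂μ = f (x i) θ₀) {σ : ℝ} (hσ : 0 < σ)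
    (hvar : ∀ i, variance (Y i) μ = σ ^ 2 * f (x i) θ₀ ^ 2) (i : ℕ) :
    ∫ ω, mlTerm f (x i) (Y i ω) (joint θ₀ σ) ∂μ = 0 := by
  have h1 := memLp_relResponse (f := f) (x := x) (θ₀ := θ₀) hL i
  have h2 : MemLp (fun ω => Y i ω / f (x i) θ₀ - 1) 2 μ := h1.sub (memLp_const 1)
  have i1 : Integrable (fun ω => Y i ω / f (x i) θ₀) μ := h1.integrable one_le_two
  have i2 : Integrable (fun ω => (Y i ω / f (x i) θ₀) ^ 2) μ := h1.integrable_sq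
  have i3 : Integrable (fun ω => (Y i ω / f (x i) θ₀ - 1) ^ 2) μ := h2.integrable_sq
  have e1 := integral_relResponse hne hmean i
  have e2 := integral_relResponse_sq hne hL hmean hvar i
  have e3 : ∫ ω, (Y i ω / f (x i) θ₀ - 1) ^ 2 ∂μ = σ ^ 2 := by
    have : ∀ ω, (Y i ω / f (x i) θ₀ - 1) ^ 2
        = (Y i ω / f (x i) θ₀) ^ 2 - 2 * (Y i ω / f (x i) θ₀) + 1 := fun ω => by ring
    simp only [this]
    have i4 : Integrable (fun ω => (Y i ω / f (x i) θ₀) ^ 2 - 2 * (Y i ω / f (x i) θ₀)) μ :=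
      i2.sub (i1.const_mul 2)
    rw [integral_add i4 (integrable_const _),
      integral_sub i2 (i1.const_mul 2), integral_const_mul, e1, e2]
    simp
    ring
  simp only [mlTerm, thetaPart_joint, sigmaPart_joint]
  have j1 : Integrable (fun ω => ((Y i ω / f (x i) θ₀) ^ 2 - Y i ω / f (x i) θ₀) * σ⁻¹ ^ 2) μ :=
    (i2.sub i1).mul_const _
  have j2 : Integrable (fun ω => (Y i ω / f (x i) θ₀ - 1) ^ 2 * σ⁻¹ ^ 3) μ := i3.mul_const _
  have k1 : Integrable (fun ω => -1 + ((Y i ω / f (x i) θ₀) ^ 2 - Y i ω / f (x i) θ₀) * σ⁻¹ ^ 2) μ :=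
    (integrable_const _).add j1
  have k2 : Integrable (fun ω => -σ⁻¹ + (Y i ω / f (x i) θ₀ - 1) ^ 2 * σ⁻¹ ^ 3) μ :=
    (integrable_const _).add j2
  rw [integral_add (k1.smul_const _) (k2.smul_const _), integral_smul_const, integral_smul_const,
    integral_add (integrable_const _) j1, integral_add (integrable_const _) j2,
    integral_mul_const, integral_mul_const, integral_sub i2 i1, e1, e2, e3]
  have c1 : ∫ _ω, (-1 : ℝ) ∂μ + (1 + σ ^ 2 - 1) * σ⁻¹ ^ 2 = 0 := by
    rw [integral_const]
    simp
    field_simp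
    ring
  have c2 : ∫ _ω, -σ⁻¹ ∂μ + σ ^ 2 * σ⁻¹ ^ 3 = 0 := by
    rw [integral_const]
    simp
    field_simp
    ring
  rw [c1, c2, zero_smul, zero_smul, add_zero]

/-- The powers of the relative response in the derivative of the ML terms, at `t = 1 / σ`. -/
def mlCoefs : ℕ → ℝ → ℝ × ℝ × ℝ × ℝ
  | 0, t => (-1, 1, 0, t ^ 2 - 3 * t ^ 4)
  | 1, t => (-t ^ 2, 2 * t ^ 2, 2 * t ^ 3, 6 * t ^ 4)
  | _ + 2, t => (t ^ 2, -3 * t ^ 2, -2 * t ^ 3, -3 * t ^ 4)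

/-- The coefficients of the derivative of the ML terms. -/
def mlCoef (k : ℕ) (X : ℝ × EuclideanSpace ℝ (Fin p) ×
      (EuclideanSpace ℝ (Fin p) →L[ℝ] EuclideanSpace ℝ (Fin p)) ×
      EuclideanSpace ℝ (Fin p ⊕ Unit)) :
    EuclideanSpace ℝ (Fin p ⊕ Unit) →L[ℝ] EuclideanSpace ℝ (Fin p ⊕ Unit) :=
  X.1 ^ k • mlOp (mlCoefs k (sigmaPart X.2.2.2)⁻¹).1 (mlCoefs k (sigmaPart X.2.2.2)⁻¹).2.1
    (mlCoefs k (sigmaPart X.2.2.2)⁻¹).2.2.1 (mlCoefs k (sigmaPart X.2.2.2)⁻¹).2.2.2 X.2.1 X.2.2.1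

theorem polyDeriv_mlCoef (hne : ∀ i, f (x i) θ₀ ≠ 0) (i : ℕ) (y : ℝ)
    (η : EuclideanSpace ℝ (Fin p ⊕ Unit)) {w t : ℝ} (hw : w = y / f (x i) (thetaPart η))
    (ht : t = (sigmaPart η)⁻¹) :
    polyDeriv f x θ₀ thetaPart 2 mlCoef i y η = mlOp (-1 - w * t ^ 2 + w ^ 2 * t ^ 2)
      (1 + 2 * w * t ^ 2 - 3 * w ^ 2 * t ^ 2) (2 * w * t ^ 3 - 2 * w ^ 2 * t ^ 3)
      (t ^ 2 - 3 * t ^ 4 + 6 * w * t ^ 4 - 3 * w ^ 2 * t ^ 4)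
      (relGrad f (x i) (thetaPart η)) (relHess f (x i) (thetaPart η)) := by
  simp only [polyDeriv, Finset.sum_range_succ, Finset.sum_range_zero, mlCoef, mlCoefs, localData,
    smul_smul, ← mul_pow, ratio]
  rw [div_mul_div_cancel₀ (hne i), ← hw, ← ht]
  simp only [mlOp]
  module

theorem continuousOn_mlCoef (k : ℕ) {η₀ : EuclideanSpace ℝ (Fin p ⊕ Unit)} {r : ℝ}
    (hr : ∀ η ∈ Metric.closedBall η₀ r, sigmaPart η ≠ 0) :
    ContinuousOn (mlCoef (p := p) k) {X | X.2.2.2 ∈ Metric.closedBall η₀ r} := by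
  have hs : Continuous (sigmaPart (p := p)) := by
    unfold sigmaPart
    fun_prop
  have ht : ContinuousOn (fun X : ℝ × EuclideanSpace ℝ (Fin p) ×
      (EuclideanSpace ℝ (Fin p) →L[ℝ] EuclideanSpace ℝ (Fin p)) ×
      EuclideanSpace ℝ (Fin p ⊕ Unit) => (sigmaPart X.2.2.2)⁻¹)
      {X | X.2.2.2 ∈ Metric.closedBall η₀ r} :=
    (hs.comp continuous_snd.snd.snd).continuousOn.inv₀ fun X hX => hr _ hX
  have hc : Continuous (mlCoefs k) := by
    rcases k with _ | _ | k <;> unfold mlCoefs <;> fun_prop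
  have hcoef := hc.comp_continuousOn ht
  have hJ : Continuous fun X : ℝ × EuclideanSpace ℝ (Fin p) ×
      (EuclideanSpace ℝ (Fin p) →L[ℝ] EuclideanSpace ℝ (Fin p)) ×
      EuclideanSpace ℝ (Fin p ⊕ Unit) => inlCLM p X.2.1 :=
    (inlCLM p).continuous.comp continuous_snd.fst
  have hK : Continuous fun X : ℝ × EuclideanSpace ℝ (Fin p) ×
      (EuclideanSpace ℝ (Fin p) →L[ℝ] EuclideanSpace ℝ (Fin p)) ×
      EuclideanSpace ℝ (Fin p ⊕ Unit) => (inlCLM p).comp (X.2.2.1.comp (thetaCLM p)) :=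
    continuous_const.clm_comp (continuous_snd.snd.fst.clm_comp continuous_const)
  exact (continuous_fst.pow k).continuousOn.smul
    ((((hcoef.fst.smul hK.continuousOn).add
      (hcoef.snd.fst.smul (continuous_rankOne hJ hJ).continuousOn)).add
      (hcoef.snd.snd.fst.smul ((continuous_rankOne hJ continuous_const).add
        (continuous_rankOne continuous_const hJ)).continuousOn)).add
      (hcoef.snd.snd.snd.smul continuousOn_const))

theorem norm_mlOp_le (c₀ c₁ c₂ c₃ : ℝ) {J : EuclideanSpace ℝ (Fin p)}
    {K : EuclideanSpace ℝ (Fin p) →L[ℝ] EuclideanSpace ℝ (Fin p)} {m : ℝ} (hJ : ‖J‖ ≤ m)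
    (hK : ‖K‖ ≤ m ^ 2) (hm : 1 ≤ m) :
    ‖mlOp c₀ c₁ c₂ c₃ J K‖ ≤ (|c₀| + |c₁| + 2 * |c₂| + |c₃|) * m ^ 2 := by
  have h0 : ‖(inlCLM p).comp (K.comp (thetaCLM p))‖ ≤ m ^ 2 := by
    refine ContinuousLinearMap.opNorm_le_bound _ (sq_nonneg _) fun v => ?_
    rw [ContinuousLinearMap.comp_apply, ContinuousLinearMap.comp_apply, norm_inlCLM]
    exact (K.le_opNorm _).trans (mul_le_mul hK (norm_thetaPart_le v) (norm_nonneg _)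
      (sq_nonneg _))
  have h1 : ‖InnerProductSpace.rankOne ℝ (inlCLM p J) (inlCLM p J)‖ ≤ m ^ 2 := by
    rw [InnerProductSpace.norm_rankOne, norm_inlCLM, sq]
    exact mul_le_mul hJ hJ (norm_nonneg _) (by linarith)
  have h2 : ‖InnerProductSpace.rankOne ℝ (inlCLM p J) (sigmaVec p)
      + InnerProductSpace.rankOne ℝ (sigmaVec p) (inlCLM p J)‖ ≤ 2 * m ^ 2 := by
    refine (norm_add_le _ _).trans ?_
    rw [InnerProductSpace.norm_rankOne, InnerProductSpace.norm_rankOne, norm_inlCLM, norm_sigmaVec]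
    nlinarith
  have h3 : ‖InnerProductSpace.rankOne ℝ (sigmaVec p) (sigmaVec p)‖ ≤ m ^ 2 := by
    rw [InnerProductSpace.norm_rankOne, norm_sigmaVec]
    nlinarith
  have hsm : ∀ (c : ℝ) (T : EuclideanSpace ℝ (Fin p ⊕ Unit) →L[ℝ] EuclideanSpace ℝ (Fin p ⊕ Unit))
      (b : ℝ), ‖T‖ ≤ b → ‖c • T‖ ≤ |c| * b := fun c T b h => by
    rw [norm_smul, Real.norm_eq_abs]
    gcongr
  refine (norm_add₄_le.trans (add_le_add (add_le_add (add_le_add (hsm c₀ _ _ h0) (hsm c₁ _ _ h1))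
    (hsm c₂ _ _ h2)) (hsm c₃ _ _ h3))).trans_eq ?_
  ring

theorem abs_mlCoefs_le (k : ℕ) {t a : ℝ} (ht : |t| ≤ a) (ha : 1 ≤ a) :
    |(mlCoefs k t).1| + |(mlCoefs k t).2.1| + 2 * |(mlCoefs k t).2.2.1| + |(mlCoefs k t).2.2.2|
      ≤ 13 * a ^ 4 := by
  have hp : ∀ j ≤ 4, |t| ^ j ≤ a ^ 4 := fun j hj =>
    (pow_le_pow_left₀ (abs_nonneg _) ht j).trans (pow_le_pow_right₀ ha hj)
  have p0 := hp 0 (by norm_num)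
  have p2 := hp 2 (by norm_num)
  have p3 := hp 3 (by norm_num)
  have p4 := hp 4 le_rfl
  have q := abs_sub (t ^ 2) (3 * t ^ 4)
  -- The worst case is degree one, where the constants add up to `1 + 2 + 4 + 6 = 13`.
  rcases k with _ | _ | k <;> simp [mlCoefs, abs_mul, abs_pow] at * <;> linarith

/-- The information matrix of a single observation. -/
def mlInfo (t : ℝ) (J : EuclideanSpace ℝ (Fin p)) : Matrix (Fin p ⊕ Unit) (Fin p ⊕ Unit) ℝ :=
  t ^ 2 • Matrix.vecMulVec (inlCLM p J) (inlCLM p J)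
    + (2 : ℝ) • Matrix.vecMulVec (inlCLM p J + t • sigmaVec p : EuclideanSpace ℝ (Fin p ⊕ Unit))
      (inlCLM p J + t • sigmaVec p : EuclideanSpace ℝ (Fin p ⊕ Unit))

theorem mlInfo_transpose (t : ℝ) (J : EuclideanSpace ℝ (Fin p)) :
    (mlInfo t J).transpose = mlInfo t J := by
  simp [mlInfo, Matrix.transpose_add, Matrix.transpose_smul, Matrix.transpose_vecMulVec]

theorem dotProduct_vecMulVec_mulVec {ι : Type*} [Fintype ι] (u v : EuclideanSpace ℝ ι) :
    v ⬝ᵥ (Matrix.vecMulVec u u).mulVec v = inner ℝ u v ^ 2 := by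
  have h1 : inner ℝ u v = u ⬝ᵥ v := by
    simp [PiLp.inner_apply, dotProduct, mul_comm]
  rw [h1, Matrix.vecMulVec_mulVec, dotProduct_smul, dotProduct_comm (v : ι → ℝ) u]
  simp [sq]

/-- A sum of two squares: the first is the information in the mean; the second, with factor 2, that
in the scale, `J + t e_σ` being the gradient of `log(σf)`. -/
theorem dotProduct_mlInfo_mulVec (t : ℝ) (J : EuclideanSpace ℝ (Fin p))
    (v : EuclideanSpace ℝ (Fin p ⊕ Unit)) :
    v ⬝ᵥ (mlInfo t J).mulVec v = t ^ 2 * inner ℝ J (thetaPart v) ^ 2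
      + 2 * (inner ℝ J (thetaPart v) + t * sigmaPart v) ^ 2 := by
  rw [mlInfo, Matrix.add_mulVec, Matrix.smul_mulVec, Matrix.smul_mulVec, dotProduct_add,
    dotProduct_smul, dotProduct_smul, dotProduct_vecMulVec_mulVec, dotProduct_vecMulVec_mulVec,
    inner_add_left, inner_smul_left, inner_inlCLM, inner_sigmaVec]
  simp

theorem rankOne_single_apply {ι : Type*} [Fintype ι] [DecidableEq ι] (u v : EuclideanSpace ℝ ι)
    (a b : ι) : InnerProductSpace.rankOne ℝ u v (EuclideanSpace.single b 1) a = u a * v b := by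
  simp [EuclideanSpace.inner_single_right, mul_comm]

theorem mlOp_single_eq (t : ℝ) (J : EuclideanSpace ℝ (Fin p))
    (K : EuclideanSpace ℝ (Fin p) →L[ℝ] EuclideanSpace ℝ (Fin p)) (a b : Fin p ⊕ Unit) :
    mlOp 0 (-2 - t ^ 2) (-2 * t) (-2 * t ^ 2) J K (EuclideanSpace.single b 1) a
      = -mlInfo t J a b := by
  simp only [mlOp, mlInfo, zero_smul, zero_add, _root_.add_apply, _root_.smul_apply,
    PiLp.add_apply, PiLp.smul_apply, rankOne_single_apply, Matrix.add_apply, Matrix.smul_apply,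
    Matrix.vecMulVec_apply, smul_eq_mul]
  ring

/-- The moments `1, 1, 1 + σ²` of the relative response are inserted. By `(1 + σ²)t² = t² + 1` the
coefficient of `K` becomes zero, so the expected derivative is minus the information. -/
theorem sum_mlCoef_eq {t σ : ℝ} (hσ : σ * t = 1) (J : EuclideanSpace ℝ (Fin p))
    (K : EuclideanSpace ℝ (Fin p) →L[ℝ] EuclideanSpace ℝ (Fin p)) (a b : Fin p ⊕ Unit)
    {X : ℝ × EuclideanSpace ℝ (Fin p) ×
      (EuclideanSpace ℝ (Fin p) →L[ℝ] EuclideanSpace ℝ (Fin p)) ×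
      EuclideanSpace ℝ (Fin p ⊕ Unit)} (hX : X = (1, J, K, X.2.2.2)) (hs : sigmaPart X.2.2.2 = σ) :
    mlCoef 0 X (EuclideanSpace.single b 1) a + mlCoef 1 X (EuclideanSpace.single b 1) a
      + (1 + σ ^ 2) * mlCoef 2 X (EuclideanSpace.single b 1) a = -mlInfo t J a b := by
  have ht : (sigmaPart X.2.2.2)⁻¹ = t := by
    rw [hs]
    exact inv_eq_of_mul_eq_one_right hσ
  have h1 : X.1 = 1 := by rw [hX]
  have h2 : X.2.1 = J := by rw [hX]
  have h3 : X.2.2.1 = K := by rw [hX]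
  rw [← mlOp_single_eq t J K]
  simp only [mlCoef, ht, h1, h2, h3, mlCoefs, mlOp, _root_.add_apply, _root_.smul_apply,
    PiLp.add_apply, PiLp.smul_apply, smul_eq_mul, one_pow, one_mul]
  have e : (1 + σ ^ 2) * t ^ 2 = t ^ 2 + 1 := by linear_combination (σ * t + 1) * hσ
  generalize ((inlCLM p).comp (K.comp (thetaCLM p))) (EuclideanSpace.single b 1) a = A₀
  generalize InnerProductSpace.rankOne ℝ (inlCLM p J) (inlCLM p J) (EuclideanSpace.single b 1) a
    = A₁
  generalize InnerProductSpace.rankOne ℝ (inlCLM p J) (sigmaVec p) (EuclideanSpace.single b 1) a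
    = A₂
  generalize InnerProductSpace.rankOne ℝ (sigmaVec p) (inlCLM p J) (EuclideanSpace.single b 1) a
    = A₃
  generalize InnerProductSpace.rankOne ℝ (sigmaVec p) (sigmaVec p) (EuclideanSpace.single b 1) a
    = A₄
  linear_combination (A₀ - 3 * A₁ - 2 * t * (A₂ + A₃) - 3 * t ^ 2 * A₄) * e

/-- The Gram matrix gives coercivity in `θ` only. The `σ` direction is recovered from the scale
square through `b² ≤ 2(a + b)² + 2a²`, at the cost of half of the mean square. -/
theorem exists_pos_mlInfo {t : ℝ} (ht : 0 < t)
    (h : ∃ c > 0, ∀ᶠ n : ℕ in atTop, ∀ v : EuclideanSpace ℝ (Fin p),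
      c * n * ‖v‖ ^ 2 ≤ ∑ i ∈ Finset.range n, inner ℝ (relGrad f (x i) θ₀) v ^ 2) :
    ∃ c > 0, ∀ᶠ n : ℕ in atTop, ∀ v : EuclideanSpace ℝ (Fin p ⊕ Unit),
      c * n * ‖v‖ ^ 2 ≤ ∑ i ∈ Finset.range n, v ⬝ᵥ (mlInfo t (relGrad f (x i) θ₀)).mulVec v := by
  obtain ⟨c, hc, h⟩ := h
  -- With `ρ ≤ 1` the term `2ρ(a + b)²` fits into the scale square, with `ρ ≤ t²/4` the term `2ρa²`
  -- into half of the mean square.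
  set ρ := min 1 (t ^ 2 / 4) with hρ
  have hρ0 : 0 < ρ := lt_min one_pos (by positivity)
  have hρ1 : ρ ≤ 1 := min_le_left _ _
  have hρ2 : ρ ≤ t ^ 2 / 4 := min_le_right _ _
  refine ⟨min (t ^ 2 / 2 * c) (ρ * t ^ 2), by positivity, ?_⟩
  filter_upwards [h] with n hn v
  have hn0 : (0 : ℝ) ≤ n := n.cast_nonneg
  calc min (t ^ 2 / 2 * c) (ρ * t ^ 2) * n * ‖v‖ ^ 2
      = min (t ^ 2 / 2 * c) (ρ * t ^ 2) * (n * ‖thetaPart v‖ ^ 2)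
        + min (t ^ 2 / 2 * c) (ρ * t ^ 2) * (n * sigmaPart v ^ 2) := by
        rw [norm_sq_eq_parts]
        ring
    _ ≤ t ^ 2 / 2 * c * (n * ‖thetaPart v‖ ^ 2) + ρ * t ^ 2 * (n * sigmaPart v ^ 2) := by
        gcongr
        · exact min_le_left _ _
        · exact min_le_right _ _
    _ = t ^ 2 / 2 * (c * n * ‖thetaPart v‖ ^ 2) + ∑ i ∈ Finset.range n, ρ * (t * sigmaPart v) ^ 2 := by
        rw [Finset.sum_const, Finset.card_range, nsmul_eq_mul]
        ring
    _ ≤ t ^ 2 / 2 * ∑ i ∈ Finset.range n, inner ℝ (relGrad f (x i) θ₀) (thetaPart v) ^ 2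
        + ∑ i ∈ Finset.range n, ρ * (t * sigmaPart v) ^ 2 := by
        gcongr
        exact hn _
    _ ≤ _ := by
        rw [Finset.mul_sum, ← Finset.sum_add_distrib]
        refine Finset.sum_le_sum fun i _ => ?_
        rw [dotProduct_mlInfo_mulVec]
        generalize inner ℝ (relGrad f (x i) θ₀) (thetaPart v) = a
        generalize t * sigmaPart v = b
        have h1 : ρ * b ^ 2 ≤ 2 * ρ * (a + b) ^ 2 + 2 * ρ * a ^ 2 := by
          nlinarith [mul_nonneg hρ0.le (sq_nonneg (2 * a + b))]
        have h2 : 2 * ρ * (a + b) ^ 2 ≤ 2 * (a + b) ^ 2 := by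
          nlinarith [sq_nonneg (a + b)]
        have h3 : 2 * ρ * a ^ 2 ≤ t ^ 2 / 2 * a ^ 2 := by
          nlinarith [sq_nonneg a]
        linarith

theorem measurable_mlTerm (x : 𝓧) (η : EuclideanSpace ℝ (Fin p ⊕ Unit)) :
    Measurable fun y => mlTerm f x y η := by
  unfold mlTerm
  fun_prop

theorem norm_mlTerm_le {x : 𝓧} (y : ℝ) {η : EuclideanSpace ℝ (Fin p ⊕ Unit)} {t M : ℝ}
    (ht : t = (sigmaPart η)⁻¹) (ht0 : 0 < t) (hM : ‖relGrad f x (thetaPart η)‖ ≤ M) :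
    ‖mlTerm f x y η‖ ≤ (1 + t + t ^ 2 + 2 * t ^ 3) * (1 + M) *
      ∑ k ∈ Finset.range (2 + 1), |y / f x (thetaPart η)| ^ k := by
  rw [mlTerm, ← ht]
  generalize y / f x (thetaPart η) = w
  have hM0 : 0 ≤ M := (norm_nonneg _).trans hM
  have h1 : |-1 + (w ^ 2 - w) * t ^ 2| ≤ 1 + (|w| ^ 2 + |w|) * t ^ 2 := by
    refine (abs_add_le _ _).trans ?_
    rw [abs_neg, abs_one, abs_mul, abs_of_pos (pow_pos ht0 2), ← abs_pow]
    gcongr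
    exact abs_sub _ _
  have h2 : |-t + (w - 1) ^ 2 * t ^ 3| ≤ t + (|w| + 1) ^ 2 * t ^ 3 := by
    refine (abs_add_le _ _).trans ?_
    rw [abs_neg, abs_of_pos ht0, abs_mul, abs_of_pos (pow_pos ht0 3), abs_pow]
    gcongr
    exact (abs_sub _ _).trans_eq (by rw [abs_one])
  refine (norm_add_le _ _).trans ?_
  rw [norm_smul, norm_smul, norm_inlCLM, norm_sigmaVec, Real.norm_eq_abs, Real.norm_eq_abs, mul_one]
  simp only [Finset.sum_range_succ, Finset.sum_range_zero, pow_zero, pow_one, zero_add]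
  have hw := abs_nonneg w
  calc _ ≤ (1 + (|w| ^ 2 + |w|) * t ^ 2) * (1 + M) + (t + (|w| + 1) ^ 2 * t ^ 3) * (1 + M) := by
        gcongr ?_ + ?_
        · gcongr
          linarith
        · exact h2.trans (le_mul_of_one_le_right (by positivity) (by linarith))
    _ = (1 + (|w| ^ 2 + |w|) * t ^ 2 + (t + (|w| + 1) ^ 2 * t ^ 3)) * (1 + M) := by ring
    _ ≤ ((1 + t + t ^ 2 + 2 * t ^ 3) * (1 + |w| + |w| ^ 2)) * (1 + M) := by
        refine mul_le_mul_of_nonneg_right ?_ (by linarith)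
        have e : (1 + t + t ^ 2 + 2 * t ^ 3) * (1 + |w| + |w| ^ 2)
          = 1 + (|w| ^ 2 + |w|) * t ^ 2 + (t + (|w| + 1) ^ 2 * t ^ 3)
            + (t ^ 2 + t ^ 3 + (1 + t) * |w| + (1 + t + t ^ 3) * |w| ^ 2) := by ring
        rw [e]
        exact le_add_of_nonneg_right (by positivity)
    _ = _ := by ring

theorem abs_sigmaPart_sub_le (η ξ : EuclideanSpace ℝ (Fin p ⊕ Unit)) :
    |sigmaPart η - sigmaPart ξ| ≤ ‖η - ξ‖ :=
  abs_apply_le_norm (η - ξ) (Sum.inr ())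

theorem exists_regularScore_ml (hY : ∀ i, Measurable (Y i)) (hL : ∀ i, MemLp (Y i) 2 μ)
    (hmean : ∀ i, ∫ ω, Y i ω ∂μ = f (x i) θ₀) {σ : ℝ} (hσ : 0 < σ)
    (hvar : ∀ i, variance (Y i) μ = σ ^ 2 * f (x i) θ₀ ^ 2)
    (h : RegularDesign f x θ₀) (hind : iIndepFun Y μ)
    (hui : UniformIntegrable (fun i ω => (Y i ω - f (x i) θ₀) / f (x i) θ₀) 4 μ) :
    ∃ (R : ℕ → ℝ → ℝ) (m : ℕ → ℝ) (r : ℝ), RegularScore μ Y (fun i y => mlTerm f (x i) y)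
      (polyDeriv f x θ₀ thetaPart 2 mlCoef) (fun i => mlInfo σ⁻¹ (relGrad f (x i) θ₀)) R m
      (joint θ₀ σ) r ∧ IsScoreSum Y (fun i y => mlTerm f (x i) y) (joint θ₀ σ) r (mlEq f x Y) := by
  obtain ⟨r, κ, M, hb⟩ := h.exists_bounds
  obtain ⟨-, hK, hpos⟩ := h
  have hκ : 0 < κ⁻¹ := inv_pos.2 hb.κ_pos
  have hπ : ∀ η, ‖thetaPart η - θ₀‖ ≤ ‖η - joint θ₀ σ‖ := fun η => by
    have := norm_thetaPart_le (η - joint θ₀ σ)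
    rwa [thetaPart_sub, thetaPart_joint] at this
  -- Within distance `σ/2` the scale component stays at least `σ/2`, so its inverse is bounded.
  have hr' : 0 < min r (σ / 2) := lt_min hb.r_pos (by positivity)
  have hs : ∀ η ∈ Metric.closedBall (joint θ₀ σ) (min r (σ / 2)), σ / 2 ≤ sigmaPart η := by
    intro η hη
    rw [mem_closedBall_iff_norm] at hη
    have h1 := abs_le.1 ((abs_sigmaPart_sub_le η (joint θ₀ σ)).trans
      (hη.trans (min_le_right _ _)))
    rw [sigmaPart_joint] at h1
    linarith [h1.1]
  have hs0 : ∀ η ∈ Metric.closedBall (joint θ₀ σ) (min r (σ / 2)), sigmaPart η ≠ 0 :=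
    fun η hη => ((half_pos hσ).trans_le (hs η hη)).ne'
  have hθ : ∀ η ∈ Metric.ball (joint θ₀ σ) (min r (σ / 2)), thetaPart η ∈ Metric.ball θ₀ r := by
    intro η hη
    rw [mem_ball_iff_norm] at hη ⊢
    exact (hπ η).trans_lt (hη.trans_le (min_le_left _ _))
  have hsub := Metric.ball_subset_closedBall (x := joint θ₀ σ) (ε := min r (σ / 2))
  have ha : 1 ≤ 1 + 2 / σ := by linarith [show 0 < 2 / σ by positivity]
  have hψb : ∀ i y, ‖mlTerm f (x i) y (joint θ₀ σ)‖ ≤ (1 + σ⁻¹ + σ⁻¹ ^ 2 + 2 * σ⁻¹ ^ 3) *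
      (1 + M i) * ∑ k ∈ Finset.range (2 + 1), |y / f (x i) θ₀| ^ k := fun i y =>
    norm_mlTerm_le y (η := joint θ₀ σ) (sigmaPart_joint θ₀ σ ▸ rfl) (inv_pos.2 hσ)
      (hb.bound i θ₀ (Metric.mem_ball_self hb.r_pos)).1
  have hui' : UniformIntegrable (fun i ω => (Y i ω - f (x i) θ₀) / f (x i) θ₀)
      ((4 : ℕ) : ENNReal) μ := by exact_mod_cast hui
  refine (hb.exists_regularScore (μ := μ) (Y := Y) hK (d := 2) (q := 4) two_pos rfl hY
    hind hui' (π := thetaPart) (η₀ := joint θ₀ σ) hπ hr' (min_le_left _ _)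
    (g := mlCoef) (fun k _ => continuousOn_mlCoef k hs0)
    (C₁ := (1 + κ⁻¹) ^ 2 * (13 * (1 + 2 / σ) ^ 4)) (by positivity) (fun k hk i η hη => ?_)
    (ψ := fun i y => mlTerm f (x i) y) (fun i y η hη => ?_)
    (fun i θ _ => measurable_mlTerm _ _) (C₂ := 1 + σ⁻¹ + σ⁻¹ ^ 2 + 2 * σ⁻¹ ^ 3) (by positivity)
    hψb (fun i => integral_mlTerm hb.ne_zero hL hmean hσ hvar i)
    (A := fun i => mlInfo σ⁻¹ (relGrad f (x i) θ₀)) (fun i a b => ?_)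
    (fun i => mlInfo_transpose _ _) (exists_pos_mlInfo (inv_pos.2 hσ) hpos)).elim
    fun C hC => ⟨_, _, _, hC, fun n ω η hη => ?_⟩
  · have hM := hb.M_nonneg i
    obtain ⟨h1, h2⟩ := hb.bound i _ (hθ η hη)
    have hsη := hs η (hsub hη)
    have ht : |(sigmaPart η)⁻¹| ≤ 1 + 2 / σ := by
      rw [abs_of_pos (inv_pos.2 ((half_pos hσ).trans_le hsη))]
      calc (sigmaPart η)⁻¹ ≤ (σ / 2)⁻¹ := inv_anti₀ (half_pos hσ) hsη
        _ = 2 / σ := inv_div _ _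
        _ ≤ _ := by linarith
    rw [mlCoef, norm_smul, mul_assoc]
    simp only [localData]
    refine mul_le_mul ?_ ((norm_mlOp_le _ _ _ _ (m := 1 + M i) (by linarith)
      (h2.trans (by nlinarith)) (by linarith)).trans
      (mul_le_mul_of_nonneg_right (abs_mlCoefs_le k ht ha) (sq_nonneg _)))
      (norm_nonneg _) (by positivity)
    rw [norm_pow, Real.norm_eq_abs]
    calc _ ≤ (1 + κ⁻¹) ^ k := by
          refine pow_le_pow_left₀ (abs_nonneg _) ((hb.abs_ratio_le i (hθ η hη)).trans ?_) k
          linarith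
      _ ≤ _ := pow_le_pow_right₀ (by linarith) (by omega)
  · rw [polyDeriv_mlCoef hb.ne_zero i y η rfl rfl]
    exact hasFDerivAt_mlTerm hb i y (hθ η hη) (hs0 η (hsub hη)) rfl rfl
  · simp only [Finset.sum_range_succ, Finset.sum_range_zero, zero_add, pow_zero, pow_one,
      integral_relResponse hb.ne_zero hmean, integral_relResponse_sq hb.ne_zero hL hmean hvar]
    rw [← sum_mlCoef_eq (mul_inv_cancel₀ hσ.ne') (relGrad f (x i) θ₀) (relHess f (x i) θ₀) a b
      (X := localData f (x i) θ₀ thetaPart (joint θ₀ σ))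
      (by rw [localData, thetaPart_joint, hb.ratio_self]) rfl]
    simp
  · rw [mlEq, mlH, gradient_logLik _ _ (fun i => hb.differentiableAt i (hθ η hη))
      (fun i => hb.ne_zero' i (hθ η hη)) (hs0 η (hsub hη))]

end ML

/-! ### Maximum likelihood: unbiasedness, and normal moments -/

section MLMoments

variable {Ω : Type*} [MeasurableSpace Ω] {μ : Measure Ω} [IsProbabilityMeasure μ]
  {𝓧 : Type*} {p : ℕ} {f : 𝓧 → EuclideanSpace ℝ (Fin p) → ℝ} {x : ℕ → 𝓧}
  {θ₀ : EuclideanSpace ℝ (Fin p)} {Y : ℕ → Ω → ℝ}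

theorem mlEq_joint_eq {σ : ℝ} (hσ : 0 < σ) (hne : ∀ i, f (x i) θ₀ ≠ 0)
    (hf : ∀ i, DifferentiableAt ℝ (f (x i)) θ₀) (n : ℕ) (ω : Ω) :
    mlEq f x Y n ω (joint θ₀ σ)
      = (√n)⁻¹ • ∑ i ∈ Finset.range n, mlTerm f (x i) (Y i ω) (joint θ₀ σ) := by
  rw [mlEq, mlH, gradient_logLik _ _ hf hne (by rw [sigmaPart_joint]; exact hσ.ne')]

theorem integrable_mlEq {σ : ℝ} (hσ : 0 < σ) (hne : ∀ i, f (x i) θ₀ ≠ 0)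
    (hf : ∀ i, DifferentiableAt ℝ (f (x i)) θ₀) (hL : ∀ i, MemLp (Y i) 2 μ) (n : ℕ) :
    Integrable (fun ω => mlEq f x Y n ω (joint θ₀ σ)) μ := by
  simp only [mlEq_joint_eq hσ hne hf]
  exact (integrable_finsetSum _ fun i _ => integrable_mlTerm hL σ i).smul (√n)⁻¹

theorem integral_mlEq {σ : ℝ} (hσ : 0 < σ) (hne : ∀ i, f (x i) θ₀ ≠ 0)
    (hf : ∀ i, DifferentiableAt ℝ (f (x i)) θ₀) (hL : ∀ i, MemLp (Y i) 2 μ)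
    (hmean : ∀ i, ∫ ω, Y i ω ∂μ = f (x i) θ₀)
    (hvar : ∀ i, variance (Y i) μ = σ ^ 2 * f (x i) θ₀ ^ 2) (n : ℕ) :
    ∫ ω, mlEq f x Y n ω (joint θ₀ σ) ∂μ = 0 := by
  simp only [mlEq_joint_eq hσ hne hf]
  rw [integral_smul, integral_finsetSum _ fun i _ => integrable_mlTerm hL σ i]
  simp [integral_mlTerm hne hL hmean hσ hvar]

theorem integral_sub_sq (hL : ∀ i, MemLp (Y i) 2 μ) (hmean : ∀ i, ∫ ω, Y i ω ∂μ = f (x i) θ₀)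
    (i : ℕ) : ∫ ω, (Y i ω - f (x i) θ₀) ^ 2 ∂μ = variance (Y i) μ := by
  rw [variance_eq_integral (hL i).aestronglyMeasurable.aemeasurable, hmean]

theorem integrable_sub_sq (hL : ∀ i, MemLp (Y i) 2 μ) (c : ℝ) (i : ℕ) :
    Integrable (fun ω => (Y i ω - c) ^ 2) μ :=
  ((hL i).sub (memLp_const c)).integrable_sq

/-- The estimated variance factor has mean `σ²`, so the first term has mean `σ² ∑ J_i`; the
cubic-denominator term has the same mean, and the middle one is the unbiased QL sum. -/
theorem mlProfile_unbiased {σ : ℝ} (hne : ∀ i, f (x i) θ₀ ≠ 0) (hL : ∀ i, MemLp (Y i) 2 μ)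
    (hmean : ∀ i, ∫ ω, Y i ω ∂μ = f (x i) θ₀)
    (hvar : ∀ i, variance (Y i) μ = σ ^ 2 * f (x i) θ₀ ^ 2) (n : ℕ) :
    Integrable (fun ω => mlProfile f x (fun i => Y i ω) n θ₀) μ ∧
      ∫ ω, mlProfile f x (fun i => Y i ω) n θ₀ ∂μ = 0 := by
  have i1 : Integrable (fun ω => (n : ℝ)⁻¹ * ∑ i ∈ Finset.range n,
      (Y i ω - f (x i) θ₀) ^ 2 / f (x i) θ₀ ^ 2) μ :=
    (integrable_finsetSum _ fun i _ => (integrable_sub_sq hL _ i).div_const _).const_mul _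
  have i2 : ∀ i, Integrable (fun ω => ((Y i ω - f (x i) θ₀) / f (x i) θ₀ ^ 2)
      • gradient (f (x i)) θ₀) μ := fun i =>
    integrable_qlTerm ((hL i).integrable one_le_two)
  have i3 : ∀ i, Integrable (fun ω => ((Y i ω - f (x i) θ₀) ^ 2 / f (x i) θ₀ ^ 3)
      • gradient (f (x i)) θ₀) μ := fun i =>
    ((integrable_sub_sq hL _ i).div_const _).smul_const _
  have j1 := i1.smul_const (∑ i ∈ Finset.range n, (f (x i) θ₀)⁻¹ • gradient (f (x i)) θ₀)
  have j2 := integrable_finsetSum (Finset.range n) fun i _ => i2 i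
  have j3 := integrable_finsetSum (Finset.range n) fun i _ => i3 i
  have e1 : ∀ i, ∫ ω, (Y i ω - f (x i) θ₀) ^ 2 / f (x i) θ₀ ^ 2 ∂μ = σ ^ 2 := fun i => by
    rw [integral_div, integral_sub_sq hL hmean, hvar, mul_div_cancel_right₀]
    exact pow_ne_zero 2 (hne i)
  have e2 : ∀ i, ∫ ω, ((Y i ω - f (x i) θ₀) / f (x i) θ₀ ^ 2) • gradient (f (x i)) θ₀ ∂μ = 0 :=
    fun i => integral_qlTerm ((hL i).integrable one_le_two) (hmean i)
  have e3 : ∀ i, ∫ ω, ((Y i ω - f (x i) θ₀) ^ 2 / f (x i) θ₀ ^ 3) • gradient (f (x i)) θ₀ ∂μ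
      = σ ^ 2 • (f (x i) θ₀)⁻¹ • gradient (f (x i)) θ₀ := fun i => by
    rw [integral_smul_const, integral_div, integral_sub_sq hL hmean, hvar, smul_smul]
    have := hne i
    congr 1
    field_simp
  refine ⟨(j1.sub j2).sub j3, ?_⟩
  simp only [mlProfile]
  have j12 : Integrable (fun ω => ((n : ℝ)⁻¹ * ∑ i ∈ Finset.range n,
      (Y i ω - f (x i) θ₀) ^ 2 / f (x i) θ₀ ^ 2) • (∑ i ∈ Finset.range n,
        (f (x i) θ₀)⁻¹ • gradient (f (x i)) θ₀) - ∑ i ∈ Finset.range n,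
        ((Y i ω - f (x i) θ₀) / f (x i) θ₀ ^ 2) • gradient (f (x i)) θ₀) μ := j1.sub j2
  rw [integral_sub j12 j3, integral_sub j1 j2, integral_smul_const, integral_const_mul,
    integral_finsetSum _ fun i _ => (integrable_sub_sq hL _ i).div_const _,
    integral_finsetSum _ fun i _ => i2 i, integral_finsetSum _ fun i _ => i3 i]
  simp only [e1, e2, e3, Finset.sum_const_zero, sub_zero, Finset.sum_const, Finset.card_range,
    nsmul_eq_mul, ← Finset.smul_sum]
  rcases Nat.eq_zero_or_pos n with rfl | hn
  · simp
  · rw [inv_mul_cancel_left₀ (by exact_mod_cast hn.ne'), sub_self]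

/-- The information identity. The score is affine in `e` and `e²`, for the relative error `e`. Under
normal moments these are uncorrelated with variances `σ²` and `2σ⁴`, which produce the two squares
of the information matrix. -/
theorem varMat_mlTerm (hne : ∀ i, f (x i) θ₀ ≠ 0) (hY : ∀ i, Measurable (Y i))
    (hL : ∀ i, MemLp (Y i) 2 μ) (hmean : ∀ i, ∫ ω, Y i ω ∂μ = f (x i) θ₀) {σ : ℝ} (hσ : 0 < σ)
    (hvar : ∀ i, variance (Y i) μ = σ ^ 2 * f (x i) θ₀ ^ 2)
    (hui : UniformIntegrable (fun i ω => (Y i ω - f (x i) θ₀) / f (x i) θ₀) 4 μ)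
    (h3 : ∀ i, ∫ ω, (Y i ω - f (x i) θ₀) ^ 3 ∂μ = 0)
    (h4 : ∀ i, ∫ ω, (Y i ω - f (x i) θ₀) ^ 4 ∂μ = 3 * σ ^ 4 * f (x i) θ₀ ^ 4) (i : ℕ) :
    varMat μ (fun ω => mlTerm f (x i) (Y i ω) (joint θ₀ σ))
      = mlInfo σ⁻¹ (relGrad f (x i) θ₀) := by
  have hi := hne i
  set e : Ω → ℝ := fun ω => (Y i ω - f (x i) θ₀) / f (x i) θ₀ with he
  have hui' : UniformIntegrable (fun i ω => (Y i ω - f (x i) θ₀) / f (x i) θ₀)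
      ((4 : ℕ) : ENNReal) μ := by exact_mod_cast hui
  have hw : ∀ ω, Y i ω / f (x i) θ₀ = e ω + 1 := fun ω => by
    rw [he]
    field_simp
    ring
  have z1 := integrable_relResponse_pow (d := 2) two_pos rfl hne hY hui' i (k := 1) one_le_two
  have z2 := integrable_relResponse_pow (d := 2) two_pos rfl hne hY hui' i (k := 2) le_rfl
  simp only [pow_one, hw] at z1 z2
  have m1 : MemLp e 2 μ := by
    refine (z1.sub (memLp_const (1 : ℝ))).ae_eq (ae_of_all _ fun ω => ?_)
    simp
  have m2 : MemLp (fun ω => e ω ^ 2) 2 μ := by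
    have := (z2.sub (m1.const_mul 2)).sub (memLp_const (1 : ℝ))
    refine this.ae_eq (ae_of_all _ fun ω => ?_)
    simp only [Pi.sub_apply]
    ring
  have x1 : ∫ ω, e ω ∂μ = 0 := by
    rw [he, integral_div, integral_sub ((hL i).integrable one_le_two) (integrable_const _), hmean]
    simp
  have x2 : ∫ ω, e ω ^ 2 ∂μ = σ ^ 2 := by
    simp only [he, div_pow]
    rw [integral_div, integral_sub_sq hL hmean, hvar, mul_div_cancel_right₀]
    exact pow_ne_zero 2 hi
  have x3 : ∫ ω, e ω ^ 3 ∂μ = 0 := by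
    simp only [he, div_pow]
    rw [integral_div, h3, zero_div]
  have x4 : ∫ ω, e ω ^ 4 ∂μ = 3 * σ ^ 4 := by
    simp only [he, div_pow]
    rw [integral_div, h4, mul_div_cancel_right₀]
    exact pow_ne_zero 4 hi
  have v11 : covariance e e μ = σ ^ 2 := by
    rw [covariance_eq_sub m1 m1, x1, ← x2]
    simp [sq]
  have v12 : covariance e (fun ω => e ω ^ 2) μ = 0 := by
    rw [covariance_eq_sub m1 m2, x1, zero_mul, sub_zero, ← x3]
    refine integral_congr_ae (ae_of_all _ fun ω => ?_)
    simp only [Pi.mul_apply]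
    ring
  have v22 : covariance (fun ω => e ω ^ 2) (fun ω => e ω ^ 2) μ = 2 * σ ^ 4 := by
    rw [covariance_eq_sub m2 m2, x2]
    have : ∫ ω, ((fun ω => e ω ^ 2) * fun ω => e ω ^ 2) ω ∂μ = 3 * σ ^ 4 := by
      rw [← x4]
      refine integral_congr_ae (ae_of_all _ fun ω => ?_)
      simp only [Pi.mul_apply]
      ring
    rw [this]
    ring
  ext a b
  set J := inlCLM p (relGrad f (x i) θ₀) with hJ
  have hψ : ∀ a, (fun ω => mlTerm f (x i) (Y i ω) (joint θ₀ σ) a)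
      = fun ω => (σ⁻¹ ^ 2 * J a * e ω + (σ⁻¹ ^ 2 * J a + σ⁻¹ ^ 3 * sigmaVec p a) * e ω ^ 2)
        + (-J a - σ⁻¹ * sigmaVec p a) := by
    intro a
    ext ω
    simp only [mlTerm, thetaPart_joint, sigmaPart_joint, hw, PiLp.add_apply, PiLp.smul_apply,
      smul_eq_mul, ← hJ]
    ring
  have n1 : ∀ c : ℝ, MemLp (fun ω => c * e ω) 2 μ := fun c => m1.const_mul c
  have n2 : ∀ c : ℝ, MemLp (fun ω => c * e ω ^ 2) 2 μ := fun c => m2.const_mul c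
  have n12 : ∀ c d : ℝ, MemLp (fun ω => c * e ω + d * e ω ^ 2) 2 μ := fun c d => (n1 c).add (n2 d)
  have cov : ∀ c d c' d' : ℝ, covariance (fun ω => c * e ω + d * e ω ^ 2)
      (fun ω => c' * e ω + d' * e ω ^ 2) μ = c * c' * σ ^ 2 + d * d' * (2 * σ ^ 4) := by
    intro c d c' d'
    have hl : covariance (fun ω => c * e ω + d * e ω ^ 2) (fun ω => c' * e ω + d' * e ω ^ 2) μ
        = covariance (fun ω => c * e ω) (fun ω => c' * e ω + d' * e ω ^ 2) μ
          + covariance (fun ω => d * e ω ^ 2) (fun ω => c' * e ω + d' * e ω ^ 2) μ :=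
      covariance_add_left (n1 c) (n2 d) (n12 c' d')
    have hr : ∀ X : Ω → ℝ, MemLp X 2 μ → covariance X (fun ω => c' * e ω + d' * e ω ^ 2) μ
        = c' * covariance X e μ + d' * covariance X (fun ω => e ω ^ 2) μ := fun X hX =>
      (covariance_add_right hX (n1 c') (n2 d')).trans
        (by rw [covariance_const_mul_right, covariance_const_mul_right])
    rw [hl, covariance_const_mul_left, covariance_const_mul_left, hr _ m1, hr _ m2,
      covariance_comm (fun ω => e ω ^ 2) e, v11, v12, v22]
    ring
  rw [varMat, Matrix.of_apply, hψ, hψ, covariance_add_const_left ((n12 _ _).integrable one_le_two),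
    covariance_add_const_right ((n12 _ _).integrable one_le_two), cov]
  simp only [mlInfo, Matrix.add_apply, Matrix.smul_apply, Matrix.vecMulVec_apply, smul_eq_mul,
    PiLp.add_apply, PiLp.smul_apply, ← hJ]
  field_simp

/-- Schur complement: the first block column of `B B⁻¹ = 1` determines the lower left block of the
inverse, which is then eliminated. -/
theorem toBlocks₁₁_inv {ι : Type*} [Fintype ι] [DecidableEq ι] {B : Matrix (ι ⊕ Unit) (ι ⊕ Unit) ℝ}
    (hB : IsUnit B.det) {c : ℝ} (hc : c ≠ 0) (h22 : B.toBlocks₂₂ = c • 1) :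
    (B⁻¹).toBlocks₁₁ = (B.toBlocks₁₁ - c⁻¹ • (B.toBlocks₁₂ * B.toBlocks₂₁))⁻¹ := by
  have h1 := Matrix.mul_nonsing_inv B hB
  rw [← Matrix.fromBlocks_toBlocks B, ← Matrix.fromBlocks_toBlocks (Matrix.fromBlocks _ _ _ _)⁻¹,
    Matrix.fromBlocks_multiply, ← Matrix.fromBlocks_one, Matrix.fromBlocks_inj,
    Matrix.fromBlocks_toBlocks, h22] at h1
  obtain ⟨h11, -, h21, -⟩ := h1
  refine (Matrix.inv_eq_right_inv ?_).symm
  rw [Matrix.smul_mul, Matrix.one_mul] at h21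
  have h3 : (B⁻¹).toBlocks₂₁ = -(c⁻¹ • (B.toBlocks₂₁ * (B⁻¹).toBlocks₁₁)) := by
    rw [eq_neg_of_add_eq_zero_left h21, smul_neg, neg_neg, inv_smul_smul₀ hc]
  rw [h3] at h11
  rw [Matrix.sub_mul, ← h11, Matrix.smul_mul, Matrix.mul_neg, Matrix.mul_smul, Matrix.mul_assoc,
    sub_eq_add_neg]

/-- The off-diagonal block is `2J̄/σ` and the corner `2/σ²`, so eliminating `σ` subtracts `2 J̄
J̄ᵀ`. This centres exactly the part of the information that comes from the scale. -/
theorem schur_avgInfo {σ : ℝ} (hσ : 0 < σ) {n : ℕ} (hn : 0 < n)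
    (hdet : IsUnit (avgInfo (fun i => mlInfo σ⁻¹ (relGrad f (x i) θ₀)) n).det) :
    ((avgInfo (fun i => mlInfo σ⁻¹ (relGrad f (x i) θ₀)) n)⁻¹).toBlocks₁₁
      = (n : ℝ) • σ ^ 2 • (gram f x θ₀ n + (2 * σ ^ 2) • ∑ i ∈ Finset.range n,
        outer (relGrad f (x i) θ₀ - meanRelGrad f x θ₀ n))⁻¹ := by
  have hn' : (n : ℝ) ≠ 0 := by exact_mod_cast hn.ne'
  have hc : 2 * σ⁻¹ ^ 2 ≠ 0 := by positivity
  rw [toBlocks₁₁_inv hdet hc]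
  · have e : (n : ℝ) • σ ^ 2 • (gram f x θ₀ n + (2 * σ ^ 2) • ∑ i ∈ Finset.range n,
        outer (relGrad f (x i) θ₀ - meanRelGrad f x θ₀ n))⁻¹
        = (((n : ℝ) * σ ^ 2)⁻¹ • (gram f x θ₀ n + (2 * σ ^ 2) • ∑ i ∈ Finset.range n,
          outer (relGrad f (x i) θ₀ - meanRelGrad f x θ₀ n)))⁻¹ := by
      rw [inv_smul_matrix (inv_ne_zero (mul_ne_zero hn' (pow_ne_zero 2 hσ.ne'))), inv_inv,
        smul_smul]
    rw [e]
    congr 1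
    ext a b
    have hS : ∀ a, meanRelGrad f x θ₀ n a
        = (n : ℝ)⁻¹ * ∑ i ∈ Finset.range n, relGrad f (x i) θ₀ a := fun a => by
      simp [meanRelGrad]
    have hout : ∑ i ∈ Finset.range n, outer (relGrad f (x i) θ₀ - meanRelGrad f x θ₀ n) a b
        = ∑ i ∈ Finset.range n, relGrad f (x i) θ₀ a * relGrad f (x i) θ₀ b
          - (n : ℝ)⁻¹ * ((∑ i ∈ Finset.range n, relGrad f (x i) θ₀ a)
            * ∑ i ∈ Finset.range n, relGrad f (x i) θ₀ b) := by
      have : ∀ i, outer (relGrad f (x i) θ₀ - meanRelGrad f x θ₀ n) a b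
          = relGrad f (x i) θ₀ a * relGrad f (x i) θ₀ b
            - meanRelGrad f x θ₀ n b * relGrad f (x i) θ₀ a
            - meanRelGrad f x θ₀ n a * relGrad f (x i) θ₀ b
            + meanRelGrad f x θ₀ n a * meanRelGrad f x θ₀ n b := fun i => by
        simp only [outer, Matrix.of_apply, PiLp.sub_apply]
        ring
      simp only [this, Finset.sum_add_distrib, Finset.sum_sub_distrib, ← Finset.mul_sum,
        Finset.sum_const, Finset.card_range, nsmul_eq_mul, hS]
      field_simp
      ring
    have hJ : ∀ v : EuclideanSpace ℝ (Fin p), ∀ a, inlCLM p v (Sum.inl a) = v a :=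
      fun v a => rfl
    have hJ' : ∀ v : EuclideanSpace ℝ (Fin p), inlCLM p v (Sum.inr ()) = 0 := fun v => rfl
    have hu : ∀ a, sigmaVec p (Sum.inl a) = 0 := fun a => by simp [sigmaVec]
    have hu' : sigmaVec p (Sum.inr ()) = 1 := by simp [sigmaVec]
    simp only [Matrix.sub_apply, Matrix.smul_apply, Matrix.add_apply, Matrix.mul_apply,
      Matrix.toBlocks₁₁, Matrix.toBlocks₁₂, Matrix.toBlocks₂₁, Matrix.of_apply, avgInfo, mlInfo,
      Matrix.sum_apply, gram_eq_sum, hout, smul_eq_mul, Matrix.vecMulVec_apply, PiLp.add_apply,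
      PiLp.smul_apply, hJ, hJ', hu, hu', Finset.univ_unique, Finset.sum_singleton,
      PUnit.default_eq_unit, mul_zero, zero_mul, add_zero, zero_add, mul_one]
    simp only [outer, Matrix.of_apply, Finset.sum_add_distrib, ← Finset.mul_sum, ← Finset.sum_mul]
    field_simp
    ring
  · ext a b
    simp [Matrix.toBlocks₂₂, avgInfo, mlInfo, Matrix.sum_apply, Matrix.vecMulVec_apply,
      inlCLM_apply, joint, sigmaVec]
    field_simp

/-- When the score covariance equals the information, the sandwich reduces to a single inverse. -/
theorem smul_sandwich_ml {σ : ℝ} (hσ : 0 < σ) {D R m r}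
    (h : RegularScore μ Y (fun i y => mlTerm f (x i) y) D
      (fun i => mlInfo σ⁻¹ (relGrad f (x i) θ₀)) R m (joint θ₀ σ) r)
    (hH : IsScoreSum Y (fun i y => mlTerm f (x i) y) (joint θ₀ σ) r (mlEq f x Y))
    (hv : ∀ i, varMat μ (fun ω => mlTerm f (x i) (Y i ω) (joint θ₀ σ))
      = mlInfo σ⁻¹ (relGrad f (x i) θ₀)) {n : ℕ} (hn : 0 < n)
    (hdet : IsUnit (avgInfo (fun i => mlInfo σ⁻¹ (relGrad f (x i) θ₀)) n).det) :
    ((n : ℝ) • sandwich μ (mlEq f x Y n) (joint θ₀ σ)).toBlocks₁₁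
      = (n : ℝ) • σ ^ 2 • (gram f x θ₀ n + (2 * σ ^ 2) • ∑ i ∈ Finset.range n,
        outer (relGrad f (x i) θ₀ - meanRelGrad f x θ₀ n))⁻¹ := by
  rw [← schur_avgInfo hσ hn hdet, h.smul_sandwich_eq hH hn hdet, h.varMat_eq hH]
  simp only [hv]
  congr 1
  rw [← avgInfo, Matrix.nonsing_inv_mul _ hdet, Matrix.one_mul]

theorem AsympMVN.thetaPart {Z : ℕ → Ω → EuclideanSpace ℝ (Fin p ⊕ Unit)}
    {V : ℕ → Matrix (Fin p ⊕ Unit) (Fin p ⊕ Unit) ℝ} {W : ℕ → Matrix (Fin p) (Fin p) ℝ}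
    (h : AsympMVN μ Z V) (hV : ∀ᶠ n : ℕ in atTop, ((n : ℝ) • V n).PosSemidef)
    (hW : ∀ᶠ n : ℕ in atTop, ((n : ℝ) • V n).toBlocks₁₁ = (n : ℝ) • W n) :
    AsympMVN μ (fun n ω => PropErr.thetaPart (Z n ω)) W := by
  intro g
  have hc : Continuous (PropErr.thetaPart (p := p)) := (thetaCLM p).continuous
  refine (h (g.compContinuous ⟨PropErr.thetaPart, hc⟩)).congr' ?_
  filter_upwards [hV, hW] with n h1 h2
  rw [← h2, ← map_thetaPart_multivariateGaussian h1,
    integral_map hc.measurable.aemeasurable g.continuous.aestronglyMeasurable]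
  rfl

end MLMoments

end PropErr

end

/-! ### Assembly of the QL and ML statements. -/

theorem mainTheorem7 {Ω : Type*} [MeasurableSpace Ω] (μ : Measure Ω) [IsProbabilityMeasure μ]
    {𝓧 : Type*} {p : ℕ} (f : 𝓧 → EuclideanSpace ℝ (Fin p) → ℝ) (x : ℕ → 𝓧)
    (θ₀ : EuclideanSpace ℝ (Fin p)) (Y : ℕ → Ω → ℝ) (hY : ∀ i, Measurable (Y i))
    (hint : ∀ i, Integrable (Y i) μ) (hmean : ∀ i, ∫ ω, Y i ω ∂μ = f (x i) θ₀) :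
    -- QL: the estimating equations are unbiased
    ((∀ i, Integrable (fun ω => PropErr.qlTerm f (x i) (Y i ω) θ₀) μ ∧
        ∫ ω, PropErr.qlTerm f (x i) (Y i ω) θ₀ ∂μ = 0 ∧
        (MemLp (Y i) 2 μ → MemLp (fun ω => PropErr.qlTerm f (x i) (Y i ω) θ₀) 2 μ)) ∧
      ∀ n, Integrable (fun ω => PropErr.qlEq f x Y n ω θ₀) μ ∧
        ∫ ω, PropErr.qlEq f x Y n ω θ₀ ∂μ = 0) ∧
    -- QL: large-sample distribution
    (PropErr.RegularDesign f x θ₀ → iIndepFun Y μ →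
      UniformIntegrable (fun i ω => (Y i ω - f (x i) θ₀) / f (x i) θ₀) 2 μ →
      PropErr.SandwichWellDefined μ (PropErr.qlEq f x Y) θ₀ ∧
      (∃ est : ℕ → Ω → EuclideanSpace ℝ (Fin p), (∀ n, Measurable (est n)) ∧
        PropErr.IsConsistentRoot μ (PropErr.qlEq f x Y) θ₀ est) ∧
      (∀ est : ℕ → Ω → EuclideanSpace ℝ (Fin p),
          PropErr.IsConsistentRoot μ (PropErr.qlEq f x Y) θ₀ est →
        PropErr.LinearExpansion μ (PropErr.qlEq f x Y) θ₀ est ∧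
        PropErr.AsympMVN μ (fun n ω => est n ω - θ₀)
          (fun n => PropErr.sandwich μ (PropErr.qlEq f x Y n) θ₀)) ∧
      (∀ n, PropErr.meanNegJac μ (PropErr.qlEq f x Y n) θ₀ =
        (Real.sqrt n)⁻¹ • PropErr.gram f x θ₀ n) ∧
      (∀ n, PropErr.varMat μ (fun ω => PropErr.qlEq f x Y n ω θ₀) =
        (n : ℝ)⁻¹ • PropErr.weightedGram μ f x Y θ₀ n) ∧
      (∀ n, PropErr.sandwich μ (PropErr.qlEq f x Y n) θ₀ =
        (PropErr.gram f x θ₀ n)⁻¹ * PropErr.weightedGram μ f x Y θ₀ n *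
          (PropErr.gram f x θ₀ n)⁻¹) ∧
      -- reduction for variance proportional to the squared mean
      (∀ σ > 0, (∀ i, variance (Y i) μ = σ ^ 2 * f (x i) θ₀ ^ 2) →
        (∀ n, PropErr.sandwich μ (PropErr.qlEq f x Y n) θ₀ = σ ^ 2 • (PropErr.gram f x θ₀ n)⁻¹) ∧
        ∀ est : ℕ → Ω → EuclideanSpace ℝ (Fin p),
          PropErr.IsConsistentRoot μ (PropErr.qlEq f x Y) θ₀ est →
          PropErr.AsympMVN μ (fun n ω => est n ω - θ₀)
            (fun n => σ ^ 2 • (PropErr.gram f x θ₀ n)⁻¹))) ∧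
    -- ML, when the variance is proportional to the squared mean
    (∀ σ > 0, (∀ i, MemLp (Y i) 2 μ) → (∀ i, variance (Y i) μ = σ ^ 2 * f (x i) θ₀ ^ 2) →
      -- ML: the estimating equations are unbiased
      ((∀ i, f (x i) θ₀ ≠ 0) → (∀ i, DifferentiableAt ℝ (f (x i)) θ₀) →
        ∀ n, (Integrable (fun ω => PropErr.mlEq f x Y n ω (PropErr.joint θ₀ σ)) μ ∧
            ∫ ω, PropErr.mlEq f x Y n ω (PropErr.joint θ₀ σ) ∂μ = 0) ∧
          (Integrable (fun ω => PropErr.mlProfile f x (fun i => Y i ω) n θ₀) μ ∧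
            ∫ ω, PropErr.mlProfile f x (fun i => Y i ω) n θ₀ ∂μ = 0)) ∧
      -- ML: large-sample distribution
      (PropErr.RegularDesign f x θ₀ → iIndepFun Y μ →
        UniformIntegrable (fun i ω => (Y i ω - f (x i) θ₀) / f (x i) θ₀) 4 μ →
        PropErr.SandwichWellDefined μ (PropErr.mlEq f x Y) (PropErr.joint θ₀ σ) ∧
        (∃ est : ℕ → Ω → EuclideanSpace ℝ (Fin p ⊕ Unit), (∀ n, Measurable (est n)) ∧
          PropErr.IsConsistentRoot μ (PropErr.mlEq f x Y) (PropErr.joint θ₀ σ) est) ∧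
        (∀ est : ℕ → Ω → EuclideanSpace ℝ (Fin p ⊕ Unit),
          PropErr.IsConsistentRoot μ (PropErr.mlEq f x Y) (PropErr.joint θ₀ σ) est →
          PropErr.AsympMVN μ (fun n ω => est n ω - PropErr.joint θ₀ σ)
            (fun n => PropErr.sandwich μ (PropErr.mlEq f x Y n) (PropErr.joint θ₀ σ))) ∧
        -- closed form under normal third and fourth moments
        ((∀ i, ∫ ω, (Y i ω - f (x i) θ₀) ^ 3 ∂μ = 0) →
          (∀ i, ∫ ω, (Y i ω - f (x i) θ₀) ^ 4 ∂μ = 3 * σ ^ 4 * f (x i) θ₀ ^ 4) →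
          ∀ est : ℕ → Ω → EuclideanSpace ℝ (Fin p ⊕ Unit),
            PropErr.IsConsistentRoot μ (PropErr.mlEq f x Y) (PropErr.joint θ₀ σ) est →
            PropErr.AsympMVN μ (fun n ω => PropErr.thetaPart (est n ω) - θ₀)
              (fun n => σ ^ 2 •
                (PropErr.gram f x θ₀ n
                  + (2 * σ ^ 2) • ∑ i ∈ Finset.range n, PropErr.outer
                    (PropErr.relGrad f (x i) θ₀ - PropErr.meanRelGrad f x θ₀ n))⁻¹)))) := by
  refine ⟨⟨fun i => ⟨PropErr.integrable_qlTerm (hint i), PropErr.integral_qlTerm (hint i) (hmean i),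
    PropErr.memLp_qlTerm⟩, fun n => ⟨PropErr.integrable_qlEq hint n,
    PropErr.integral_qlEq hint hmean n⟩⟩, fun hreg hind hui => ?_, fun σ hσ hL hvar => ⟨?_, ?_⟩⟩
  · obtain ⟨R, m, r, h⟩ := PropErr.exists_regularScore_ql hY hint hmean hreg hind hui
    obtain ⟨r₁, κ, M, hb⟩ := hreg.exists_bounds
    have hH := PropErr.isScoreSum_qlEq (f := f) (x := x) (θ₀ := θ₀) (Y := Y) r
    have hJ : ∀ n, PropErr.meanNegJac μ (PropErr.qlEq f x Y n) θ₀
        = (Real.sqrt n)⁻¹ • PropErr.gram f x θ₀ n := fun n => by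
      rw [h.meanNegJac_eq hH, PropErr.gram_eq_sum]
    have hV : ∀ n, PropErr.varMat μ (fun ω => PropErr.qlEq f x Y n ω θ₀)
        = (n : ℝ)⁻¹ • PropErr.weightedGram μ f x Y θ₀ n := fun n => by
      rw [h.varMat_eq hH, PropErr.weightedGram]
      exact congrArg _ (Finset.sum_congr rfl fun i _ => PropErr.varMat_qlTerm (hint i))
    have hS : ∀ n, PropErr.sandwich μ (PropErr.qlEq f x Y n) θ₀
        = (PropErr.gram f x θ₀ n)⁻¹ * PropErr.weightedGram μ f x Y θ₀ n
          * (PropErr.gram f x θ₀ n)⁻¹ := fun n => by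
      rw [PropErr.sandwich, hJ, hV]
      rcases Nat.eq_zero_or_pos n with rfl | hn
      -- For `n = 0` the powers of `n` do not cancel, but the middle matrix is an empty sum and both
      -- sides vanish.
      · simp [PropErr.weightedGram]
      · exact PropErr.inv_smul_mul_inv_smul_mul _ _ hn
    have hN : ∀ est, PropErr.IsConsistentRoot μ (PropErr.qlEq f x Y) θ₀ est →
        PropErr.AsympMVN μ (fun n ω => est n ω - θ₀)
          (fun n => PropErr.sandwich μ (PropErr.qlEq f x Y n) θ₀) :=
      fun est hest => h.asympMVN hH hest
    refine ⟨h.sandwichWellDefined hH, h.exists_consistentRoot hH,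
      fun est hest => ⟨h.linearExpansion hH hest, hN est hest⟩, hJ, hV, hS, fun σ hσ hvar => ?_⟩
    have hS' : ∀ n, PropErr.sandwich μ (PropErr.qlEq f x Y n) θ₀
        = σ ^ 2 • (PropErr.gram f x θ₀ n)⁻¹ := fun n => by
      rw [hS, PropErr.weightedGram_eq_smul_gram hb.ne_zero hvar, PropErr.inv_mul_smul_mul_inv]
    refine ⟨hS', fun est hest => ?_⟩
    have := hN est hest
    simpa only [hS'] using this
  · exact fun hne hf n => ⟨⟨PropErr.integrable_mlEq hσ hne hf hL n,
      PropErr.integral_mlEq hσ hne hf hL hmean hvar n⟩,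
      PropErr.mlProfile_unbiased hne hL hmean hvar n⟩
  · intro hreg hind hui
    obtain ⟨R, m, r, h, hH⟩ := PropErr.exists_regularScore_ml hY hL hmean hσ hvar hreg hind hui
    obtain ⟨r₁, κ, M, hb⟩ := hreg.exists_bounds
    refine ⟨h.sandwichWellDefined hH, h.exists_consistentRoot hH,
      fun est hest => h.asympMVN hH hest, fun h3 h4 est hest => ?_⟩
    have hdet : ∀ᶠ n : ℕ in Filter.atTop, 0 < n ∧ IsUnit (PropErr.avgInfo
        (fun i => PropErr.mlInfo σ⁻¹ (PropErr.relGrad f (x i) θ₀)) n).det := by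
      obtain ⟨c, hc, hlow⟩ := h.exists_lower_bound
      filter_upwards [hlow, Filter.eventually_gt_atTop 0] with n hn hn0
      exact ⟨hn0, PropErr.RegularScore.isUnit_det_of_lower_bound hc hn⟩
    exact (h.asympMVN hH hest).thetaPart
      (hdet.mono fun n hn => h.posSemidef_smul_sandwich hH hn.1 hn.2)
      (hdet.mono fun n hn => PropErr.smul_sandwich_ml hσ h hH
        (PropErr.varMat_mlTerm hb.ne_zero hY hL hmean hσ hvar hui h3 h4) hn.1 hn.2)
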